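/- **Setting.** Let $G=(V,E)$ be a finite simple graph with integer edge weights $w$ and further (noisy) integer edge weights $w'$, let $\lambda\in\mathbb Z$, $\varepsilon_1>0$, $\beta>0$, $p=e^{-\varepsilon_1}$, $x=\frac{p}{(1-p)^2}$, and let $\rho$ assign each triangle of $G$ to one of its vertices. Put $$h(m)=\begin{cases}0&m>\lambda\\-x&m=\lambda\\1+x&m=\lambda-1\\1&m<\lambda-1.\end{cases}$$ For a node $v$ of degree $d$ with neighbourhood $\mathcal N(v)$, the local count with the unbiased estimator is the function of the vector $y\in\mathbb Z^{\mathcal N(v)}$ of weights of the edges at $v$ $$f'_v(y)=\sum_{T=\{v,u,z\}:\ \rho(T)=v} h\bigl(y_u+y_z+w'_{uz}\bigr).$$ For $f:\mathbb Z^d\to\mathbb R$ let $LS_f(y)=\max_{\|y-y'\|_1\le 1}|f(y)-f(y')|$; the $\beta$-smooth sensitivity of $f$ at $y$ is $\max_{y'\in\mathbb Z^d}LS_f(y')\,e^{-\beta\|y-y'\|_1}$. **Algorithm.** Number the edges at $v$ by $1,\dots,d$; write $w_i$ for the weight of edge $i$ and $w'_{ij}$ for the noisy weight of the edge joining the far ends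 of edges $i,j$. Start with $s=0$. For every edge $i$ at $v$: 1. Collect the list $c$ of all $c_j=w_j+w'_{ij}$ such that edges $i,j$ lie in a triangle assigned to $v$, and sort it. 2. For each initial target $t_0\in\{\lambda-1-w_i,\ \lambda-w_i\}$ (edge $i$ is increased, respectively decreased, by one), form the sorted list $\mathcal T$ of targets consisting of $t_0$ and of $c_j-1,c_j,c_j+1$ for all $j$. For each sign (positive and negative), store $c$ with its prefix sums in arrays, run through all $t\in\mathcal T$, and do the following. * Find by binary search the blocks of entries of $c$ equal to $t-1$, $t$ and $t+1$; let $M$ be the entries equal to $t\pm1$, $N$ those equal to $t$, and $O$ the others. Put $(a,b,S,F)=(x,\,1+2x,\,M,\,N)$ for the positive sign and $(a,b,S,F)=(1+2x,\,x,\,N,\,M)$ for the negative sign. Let $A=a|S|-b|F|$, $B=a+b$ and $k^*=\frac1\beta-\frac AB$. * If $k^*<|F|$, replace $s$ by the maximum of $s$ and of $(A+Bk)\,e^{-\beta(k+|t_0-t|)}$ for $k\in\{\max(0,\lfloor k^*\rfloor),\max(0,\lceil k^*\rceil)\}$. * Otherwise let $d_t(1)\le d_t(2)\le\cdots$ be the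 distances of the entries of $O$ to the nearer of $t-1,t+1$ (positive sign), respectively to $t$ (negative sign). Find by binary search the least $k\in\{0,\dots,|O|\}$ with $k=|O|$ or $\frac{k+|M|+|N|}{k+|M|+|N|+1}\ge e^{-\beta d_t(k+1)}$, and replace $s$ by the maximum of $s$ and of $a\,(k+|M|+|N|)\,e^{-\beta(|F|+\sum_{j\le k}d_t(j)+|t_0-t|)}$. Each $d_t(k+1)$ is computed by a binary search for the number of values among the closest ones that lie left of the target, and the sum of distances is computed from the same kind of split with the prefix sums. Return $s$. **Cost model.** A random access machine with integer and real registers: every arithmetic operation, comparison, evaluation of $\exp$, rounding of a real, access to an array or list, look-up of an input datum ($w_i$, $w'_{ij}$, whether $i,j$ lie in an assigned triangle, $\lambda,\varepsilon_1,\beta,d$), and each loop iteration costs one step; copying a list of length $\ell$ into an array costs $\ell+1$ steps. Lists are sorted by merge sort. **Theorem (running time).** For all such data the algorithm returns the $\beta$-smooth sensitivity of $f'_v$ at the vector $w^v$ of weights of the edges at $v$ (in particular the maxima in its definition exist), and it runs in $O(d^2\log^2 d)$ steps: there is an absolute constant $C$, independent of all the data, such that the number of steps is at most $C\,d^2\log^2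 d$ if $d\ge2$, and at most $C$ if $d\le1$. -/

import Mathlib

/-! ## Triangles, the unbiased estimator and the local count -/

/-- The vectors of incident weights of the node `v`: one integer for every neighbour of `v`. -/
abbrev IncidentVector {n : ℕ} (G : SimpleGraph (Fin n)) (v : Fin n) : Type :=
  G.neighborSet v → ℤ

/-- The vector of incident weights of `v` in the graph `G` with edge weights `w`. -/
def incidentWeights {n : ℕ} (G : SimpleGraph (Fin n)) (w : Sym2 (Fin n) → ℤ) (v : Fin n) :
    IncidentVector G v :=
  fun u => w s(v, (u : Fin n))

/-- The set of triangles of `G` that the assignment `ρ` hands to `v`. -/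
def assignedTriangles {n : ℕ} (G : SimpleGraph (Fin n)) [DecidableRel G.Adj]
    (ρ : Finset (Fin n) → Fin n) (v : Fin n) : Finset (Finset (Fin n)) :=
  {T ∈ G.cliqueFinset 3 | ρ T = v}

/-- The function `h` of the unbiased estimator, with threshold `lam` and parameter `p`. -/
noncomputable def unbiasedStep (lam : ℤ) (p : ℝ) (m : ℤ) : ℝ :=
  if m > lam then 0
  else if m = lam then -(p / (1 - p) ^ 2)
  else if m = lam - 1 then 1 + p / (1 - p) ^ 2
  else 1

/-- The weight of a triangle `T` as seen by its vertex `v`: the true weights `y` of the two edges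
of `T` at `v`, plus the noisy weight of the third edge. -/
def seenWeight {n : ℕ} (G : SimpleGraph (Fin n)) [DecidableRel G.Adj]
    (noisy : Sym2 (Fin n) → ℤ) (v : Fin n) (y : IncidentVector G v) (T : Finset (Fin n)) : ℤ :=
  (∑ u : G.neighborSet v with u.val ∈ T, y u) +
    (∑ e ∈ G.edgeFinset with e ∈ (T.erase v).sym2, noisy e)

/-- The local count of `v` with the unbiased estimator, as a function of the incident weights;
the parameter of the estimator is `p = exp (-ε₁)`. -/
noncomputable def localCount {n : ℕ} (G : SimpleGraph (Fin n)) [DecidableRel G.Adj]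
    (noisy : Sym2 (Fin n) → ℤ) (ρ : Finset (Fin n) → Fin n) (lam : ℤ) (ε₁ : ℝ) (v : Fin n)
    (y : IncidentVector G v) : ℝ :=
  ∑ T ∈ assignedTriangles G ρ v,
    unbiasedStep lam (Real.exp (-ε₁)) (seenWeight G noisy v y T)

/-! ## Smooth sensitivity -/

/-- The `ℓ₁` distance of two integer vectors. -/
def l1Dist {ι : Type} [Fintype ι] (x y : ι → ℤ) : ℤ := ∑ i, |x i - y i|

/-- `s` is the local sensitivity of `f` at `x`: the maximum of `|f x - f y|` over all `y`
at `ℓ₁` distance at most one from `x`. -/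
def IsLocalSensitivity {ι : Type} [Fintype ι] (f : (ι → ℤ) → ℝ) (x : ι → ℤ) (s : ℝ) : Prop :=
  IsGreatest {a : ℝ | ∃ y : ι → ℤ, l1Dist x y ≤ 1 ∧ a = |f x - f y|} s

/-- `S` is the `β`-smooth sensitivity of `f` at `x`: the maximum over all `y` of the local
sensitivity at `y` times `exp (-β * d(x, y))`. Both maxima are required to exist. -/
def IsSmoothSensitivity {ι : Type} [Fintype ι] (β : ℝ) (f : (ι → ℤ) → ℝ) (x : ι → ℤ) (S : ℝ) :
    Prop :=
  ∃ LS : (ι → ℤ) → ℝ, (∀ y, IsLocalSensitivity f y (LS y)) ∧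
    IsGreatest {a : ℝ | ∃ y : ι → ℤ, a = LS y * Real.exp (-β * (l1Dist x y : ℝ))} S

/-! ## The machine: a random access machine with integer and real registers

A program is a tree of instructions; the continuation chooses the next instruction according to
the result of the present one. The running time is the total cost of the executed instructions.
The continuations of the programs below only pass results on, branch on booleans and on whether a
list is empty, and count loops down; whatever else is done to a number goes through an
instruction. -/

namespace RAM

/-- The input of the algorithm in the memory of the machine. The incident edges of the node are
numbered `0, …, degree - 1`. `assigned i j` tells whether the edges `i` and `j` are two edges of a
triangle assigned to the node, and `noisy i j` is the noisy weight of the edge that joins the far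
ends of the edges `i` and `j`. -/
structure Input where
  degree : ℕ
  weight : ℕ → ℤ
  assigned : ℕ → ℕ → Bool
  noisy : ℕ → ℕ → ℤ
  threshold : ℤ
  eps : ℝ
  beta : ℝ

/-- The instructions, indexed by the type of their result. -/
inductive Instr : Type → Type
  -- access to the input
  | degree : Instr ℕ
  | weight (i : ℕ) : Instr ℤ
  | assigned (i j : ℕ) : Instr Bool
  | noisy (i j : ℕ) : Instr ℤ
  | threshold : Instr ℤ
  | eps : Instr ℝ
  | beta : Instr ℝ
  -- arithmetic of indices
  | addN (a b : ℕ) : Instr ℕ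
  | subN (a b : ℕ) : Instr ℕ
  | halfN (a : ℕ) : Instr ℕ
  | ltN (a b : ℕ) : Instr Bool
  -- arithmetic of integers
  | ofNatZ (a : ℕ) : Instr ℤ
  | addZ (a b : ℤ) : Instr ℤ
  | subZ (a b : ℤ) : Instr ℤ
  | mulZ (a b : ℤ) : Instr ℤ
  | absZ (a : ℤ) : Instr ℤ
  | ltZ (a b : ℤ) : Instr Bool
  -- arithmetic of reals
  | ofIntR (a : ℤ) : Instr ℝ
  | addR (a b : ℝ) : Instr ℝ
  | subR (a b : ℝ) : Instr ℝ
  | mulR (a b : ℝ) : Instr ℝ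
  | divR (a b : ℝ) : Instr ℝ
  | expR (a : ℝ) : Instr ℝ
  | floorR (a : ℝ) : Instr ℕ
  | ceilR (a : ℝ) : Instr ℕ
  | ltR (a b : ℝ) : Instr Bool
  -- linked lists and arrays of integers
  | cons (a : ℤ) (l : List ℤ) : Instr (List ℤ)
  | alloc (l : List ℤ) : Instr (Array ℤ)
  | size (a : Array ℤ) : Instr ℕ
  | read (a : Array ℤ) (i : ℕ) : Instr ℤ
  -- transfer of control
  | jump : Instr Unit

/-- The result of an instruction. -/
noncomputable def Instr.result (I : Input) : {α : Type} → Instr α → α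
  | _, .degree => I.degree
  | _, .weight i => I.weight i
  | _, .assigned i j => I.assigned i j
  | _, .noisy i j => I.noisy i j
  | _, .threshold => I.threshold
  | _, .eps => I.eps
  | _, .beta => I.beta
  | _, .addN a b => a + b
  | _, .subN a b => a - b
  | _, .halfN a => a / 2
  | _, .ltN a b => decide (a < b)
  | _, .ofNatZ a => (a : ℤ)
  | _, .addZ a b => a + b
  | _, .subZ a b => a - b
  | _, .mulZ a b => a * b
  | _, .absZ a => |a|
  | _, .ltZ a b => decide (a < b)
  | _, .ofIntR a => (a : ℝ)
  | _, .addR a b => a + b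
  | _, .subR a b => a - b
  | _, .mulR a b => a * b
  | _, .divR a b => a / b
  | _, .expR a => Real.exp a
  | _, .floorR a => ⌊a⌋₊
  | _, .ceilR a => ⌈a⌉₊
  | _, .ltR a b => decide (a < b)
  | _, .cons a l => a :: l
  | _, .alloc l => l.toArray
  | _, .size a => a.size
  | _, .read a i => a.getD i 0
  | _, .jump => ()

/-- Every instruction costs one step, except that copying a linked list into an array costs one
step more than the list has entries. -/
def Instr.cost : {α : Type} → Instr α → ℕ
  | _, .alloc l => l.length + 1
  | _, _ => 1

/-- Programs with a result in `α`. -/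
inductive Prog (α : Type) : Type 1
  | ret (a : α) : Prog α
  | exec {γ : Type} (i : Instr γ) (next : γ → Prog α) : Prog α

namespace Prog

/-- Sequential composition. -/
def seq {α γ : Type} : Prog α → (α → Prog γ) → Prog γ
  | ret a, f => f a
  | exec i next, f => exec i fun c => seq (next c) f

instance : Monad Prog where
  pure := ret
  bind := seq

/-- The result of a program on the input `I`. -/
noncomputable def output (I : Input) {α : Type} : Prog α → α
  | ret a => a
  | exec i next => output I (next (i.result I))

/-- The number of steps that a program makes on the input `I`. -/
noncomputable def steps (I : Input) {α : Type} : Prog α → ℕ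
  | ret _ => 0
  | exec i next => i.cost + steps I (next (i.result I))

theorem output_pure (I : Input) {α : Type} (a : α) : output I (pure a : Prog α) = a := rfl

theorem steps_pure (I : Input) {α : Type} (a : α) : steps I (pure a : Prog α) = 0 := rfl

theorem output_bind (I : Input) {α γ : Type} (m : Prog α) (f : α → Prog γ) :
    output I (m >>= f) = output I (f (output I m)) := by
  change output I (seq m f) = _
  induction m with
  | ret a => rfl
  | exec i next ih => exact ih _

theorem steps_bind (I : Input) {α γ : Type} (m : Prog α) (f : α → Prog γ) :
    steps I (m >>= f) = steps I m + steps I (f (output I m)) := by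
  change steps I (seq m f) = _
  induction m with
  | ret a => simp [seq, steps, output]
  | exec i next ih =>
    have h := ih (i.result I)
    simp only [seq, steps, output, h]
    omega

end Prog

/-- The program that consists of a single instruction. -/
def op {α : Type} (i : Instr α) : Prog α := Prog.exec i Prog.ret

/-! ## Sorting, prefix sums and binary search -/

/-- Distribute the entries of a list alternately to two lists. -/
def split : List ℤ → Prog (List ℤ × List ℤ)
  | [] => pure ([], [])
  | a :: l => do
    op .jump
    let (x, y) ← split l
    let y ← op (.cons a y)
    pure (y, x)

/-- Merge two sorted lists. -/
def merge : List ℤ → List ℤ → Prog (List ℤ)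
  | [], l => pure l
  | a :: k, [] => pure (a :: k)
  | a :: k, b :: l => do
    op .jump
    if ← op (.ltZ b a) then
      op (.cons b (← merge (a :: k) l))
    else
      op (.cons a (← merge k (b :: l)))
  termination_by k l => k.length + l.length

/-- Merge sort; the first argument bounds the depth of the recursion. -/
def mergeSort : ℕ → List ℤ → Prog (List ℤ)
  | 0, l => pure l
  | _ + 1, [] => pure []
  | _ + 1, [a] => pure [a]
  | fuel + 1, a :: b :: l => do
    op .jump
    let (x, y) ← split (a :: b :: l)
    let x ← mergeSort fuel x
    let y ← mergeSort fuel y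
    merge x y

/-- Sort a list in nondecreasing order. -/
def sort (l : List ℤ) : Prog (List ℤ) := mergeSort l.length l

/-- The list of all prefix sums, the empty one included, each increased by `acc`. -/
def prefixSums : ℤ → List ℤ → Prog (List ℤ)
  | acc, [] => op (.cons acc [])
  | acc, a :: l => do
    op .jump
    op (.cons acc (← prefixSums (← op (.addZ acc a)) l))

/-- Binary search for the first index in `[lo, hi)` at which a monotone test succeeds (`hi` if it
succeeds nowhere). The first argument bounds the number of rounds; `hi - lo` rounds suffice. -/
def firstTrue (test : ℕ → Prog Bool) : ℕ → ℕ → ℕ → Prog ℕ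
  | 0, lo, _ => pure lo
  | fuel + 1, lo, hi => do
    op .jump
    if ← op (.ltN lo hi) then
      let mid ← op (.halfN (← op (.addN lo hi)))
      if ← test mid then
        firstTrue test fuel lo mid
      else
        firstTrue test fuel (← op (.addN mid 1)) hi
    else
      pure lo

/-- The number of entries smaller than `y` in a sorted array with `n` entries, that is, the first
index whose entry is at least `y`. -/
def lowerBound (a : Array ℤ) (n : ℕ) (y : ℤ) : Prog ℕ :=
  firstTrue (fun i => do
    if ← op (.ltZ (← op (.read a i)) y) then pure false else pure true) n 0 n

def maxR (a b : ℝ) : Prog ℝ := do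
  if ← op (.ltR a b) then pure b else pure a

def maxZ (a b : ℤ) : Prog ℤ := do
  if ← op (.ltZ a b) then pure b else pure a

def minN (a b : ℕ) : Prog ℕ := do
  if ← op (.ltN a b) then pure a else pure b

/-! ## The distance data structure -/

/-- The two optimization problems: maximize the sum of the contributions, or its negative. -/
inductive Sign
  | pos
  | neg

/-- A sorted array `p` with its prefix sums `pre` and its number of entries `n`. -/
structure Sorted where
  p : Array ℤ
  pre : Array ℤ
  n : ℕ

/-- The distance data structure with its current target. Distances are measured to the nearer of
the points `tl` and `tr`. The `nZero` entries on these points have distance zero, the `nOne`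
entries of the second kind have distance one, and the remaining entries are those with index
below `left`, which lie left of `tl`, and those with index at least `right`, which lie right of
`tr`. -/
structure DistTable extends Sorted where
  tl : ℤ
  tr : ℤ
  left : ℕ
  right : ℕ
  nZero : ℕ
  nOne : ℕ

/-- Initialization from a sorted list. -/
def buildSorted (c : List ℤ) : Prog Sorted := do
  let p ← op (.alloc c)
  let pre ← op (.alloc (← prefixSums 0 c))
  let n ← op (.size p)
  pure { p := p, pre := pre, n := n }

/-- Set the target to `t`. With the four binary searches the entries are partitioned into those
smaller than `t - 1`, equal to `t - 1`, equal to `t`, equal to `t + 1` and larger than `t + 1`.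
For the positive problem, distances are measured to `t - 1` and `t + 1`, and the entries equal to
`t` have distance one. For the negative problem, distances are measured to `t`, and the entries
equal to `t - 1` or `t + 1` have distance one. -/
def setTarget (sgn : Sign) (D : Sorted) (t : ℤ) : Prog DistTable := do
  let tm ← op (.subZ t 1)
  let tp ← op (.addZ t 1)
  let l0 ← lowerBound D.p D.n tm
  let l1 ← lowerBound D.p D.n t
  let r0 ← lowerBound D.p D.n tp
  let r1 ← lowerBound D.p D.n (← op (.addZ t 2))
  let nM ← op (.addN (← op (.subN l1 l0)) (← op (.subN r1 r0)))
  let nN ← op (.subN r0 l1)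
  match sgn with
  | .pos =>
    pure { toSorted := D, tl := tm, tr := tp, left := l0, right := r1, nZero := nM, nOne := nN }
  | .neg =>
    pure { toSorted := D, tl := t, tr := t, left := l0, right := r1, nZero := nN, nOne := nM }

/-- Distance from `tl` of the `k`-th closest entry on the left, for `k ≥ 1`. -/
def leftDist (D : DistTable) (k : ℕ) : Prog ℤ := do
  op (.subZ D.tl (← op (.read D.p (← op (.subN D.left k)))))

/-- Distance from `tr` of the `k`-th closest entry on the right, for `k ≥ 1`. -/
def rightDist (D : DistTable) (k : ℕ) : Prog ℤ := do
  let i ← op (.subN (← op (.addN D.right k)) 1)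
  op (.subZ (← op (.read D.p i)) D.tr)

/-- How many of the `k` closest among the remaining entries are taken from the left. A binary
search finds the first `l` for which the `(l + 1)`-st entry on the left is farther away than the
`(k - l)`-th on the right. -/
def splitPoint (D : DistTable) (k : ℕ) : Prog ℕ := do
  let lo ← op (.subN k (← op (.subN D.n D.right)))
  let hi ← minN k D.left
  firstTrue (fun l => do
    let a ← leftDist D (← op (.addN l 1))
    let b ← rightDist D (← op (.subN k l))
    op (.ltZ b a)) hi lo hi

/-- The `k`-th smallest distance, for `1 ≤ k ≤ n`. -/
def kthDistance (D : DistTable) (k : ℕ) : Prog ℤ := do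
  let near ← op (.addN D.nZero D.nOne)
  if ← op (.ltN D.nZero k) then
    if ← op (.ltN near k) then
      let k' ← op (.subN k near)
      let l ← splitPoint D k'
      let r ← op (.subN k' l)
      let a ← if ← op (.ltN 0 l) then leftDist D l else pure 0
      let b ← if ← op (.ltN 0 r) then rightDist D r else pure 0
      maxZ a b
    else
      pure 1
  else
    pure 0

/-- The sum of the `k` smallest distances, for `k ≤ n`. -/
def sumDistances (D : DistTable) (k : ℕ) : Prog ℤ := do
  let near ← op (.addN D.nZero D.nOne)
  if ← op (.ltN D.nZero k) then
    if ← op (.ltN near k) then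
      let k' ← op (.subN k near)
      let l ← splitPoint D k'
      let r ← op (.subN k' l)
      let a1 ← op (.read D.pre D.left)
      let a0 ← op (.read D.pre (← op (.subN D.left l)))
      let b1 ← op (.read D.pre (← op (.addN D.right r)))
      let b0 ← op (.read D.pre D.right)
      let sl ← op (.subZ (← op (.mulZ (← op (.ofNatZ l)) D.tl)) (← op (.subZ a1 a0)))
      let sr ← op (.subZ (← op (.subZ b1 b0)) (← op (.mulZ (← op (.ofNatZ r)) D.tr)))
      op (.addZ (← op (.ofNatZ D.nOne)) (← op (.addZ sl sr)))
    else
      op (.ofNatZ (← op (.subN k D.nZero)))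
  else
    pure 0

/-! ## The algorithm -/

/-- The real number `total * exp (-(β * moved))`. -/
def objective (β total : ℝ) (moved : ℤ) : Prog ℝ := do
  let e ← op (.mulR β (← op (.ofIntR moved)))
  op (.mulR total (← op (.expR (← op (.subR 0 e)))))

def natToReal (k : ℕ) : Prog ℝ := do
  op (.ofIntR (← op (.ofNatZ k)))

/-- The optimal value of the problem `sgn` for the fixed target `t`, where `t₀` is the target
without a change of the weight of the fixed edge, so that this weight changes by `|t₀ - t|`.

A value at distance zero contributes `gain` when it is not shifted, and so does every shifted
value; a value at distance one contributes `-loss` unless it is shifted; all others contribute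
zero unless they are shifted. First the optimal real number `kOpt` of shifts of values at distance
one is computed. If it is less than the number of these values, one of the neighbouring integers
is optimal. Otherwise all of them are shifted, and the number of further shifts is found by binary
search. -/
def bestAtTarget (β x : ℝ) (sgn : Sign) (D₀ : Sorted) (t₀ t : ℤ) : Prog ℝ := do
  let D ← setTarget sgn D₀ t
  let own ← op (.absZ (← op (.subZ t₀ t)))
  let y ← op (.addR 1 (← op (.addR x x)))
  let (gain, loss) := match sgn with
    | .pos => (x, y)
    | .neg => (y, x)
  let one ← natToReal D.nOne
  let A ← op (.subR (← op (.mulR gain (← natToReal D.nZero))) (← op (.mulR loss one)))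
  let B ← op (.addR gain loss)
  let kOpt ← op (.subR (← op (.divR 1 β)) (← op (.divR A B)))
  let candidate : ℕ → Prog ℝ := fun k => do
    let total ← op (.addR A (← op (.mulR B (← natToReal k))))
    objective β total (← op (.addZ (← op (.ofNatZ k)) own))
  if ← op (.ltR kOpt one) then
    let v₁ ← candidate (← op (.floorR kOpt))
    let v₂ ← candidate (← op (.ceilR kOpt))
    maxR v₁ v₂
  else
    let near ← op (.addN D.nZero D.nOne)
    let far ← op (.subN D.n near)
    let kO ← firstTrue (fun k => do
      let K ← op (.addN near k)
      let K1 ← op (.addN K 1)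
      let q ← op (.divR (← natToReal K) (← natToReal K1))
      let e ← objective β 1 (← kthDistance D K1)
      if ← op (.ltR q e) then pure false else pure true) far 0 far
    let K ← op (.addN near kO)
    let total ← op (.mulR gain (← natToReal K))
    objective β total (← op (.addZ (← sumDistances D K) own))

/-- Run through a list of targets and update the current maximum `s`. -/
def scanTargets (β x : ℝ) (sgn : Sign) (D : Sorted) (t₀ : ℤ) : List ℤ → ℝ → Prog ℝ
  | [], s => pure s
  | t :: ts, s => do
    op .jump
    let s ← maxR s (← bestAtTarget β x sgn D t₀ t)
    scanTargets β x sgn D t₀ ts s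

/-- The candidate targets `a - 1`, `a`, `a + 1` for `a` in the list, in front of `acc`. -/
def candidates (acc : List ℤ) : List ℤ → Prog (List ℤ)
  | [] => pure acc
  | a :: l => do
    op .jump
    let ts ← candidates acc l
    let ts ← op (.cons (← op (.addZ a 1)) ts)
    let ts ← op (.cons a ts)
    op (.cons (← op (.subZ a 1)) ts)

/-- Solve the positive and the negative problem for a sorted list `c` of partial triangle weights
and the initial target `t₀`, and update the current maximum `s`. -/
def solveBoth (β x : ℝ) (c : List ℤ) (t₀ : ℤ) (s : ℝ) : Prog ℝ := do
  let targets ← sort (← candidates (← op (.cons t₀ [])) c)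
  let D ← buildSorted c
  let s ← scanTargets β x .pos D t₀ targets s
  let D ← buildSorted c
  scanTargets β x .neg D t₀ targets s

/-- The partial triangle weights `w_j + w'_{ij}` of the assigned triangles at the edges `i`
and `j`, for all `j` smaller than the second argument. -/
def partialWeights (i : ℕ) : ℕ → List ℤ → Prog (List ℤ)
  | 0, acc => pure acc
  | j + 1, acc => do
    op .jump
    if ← op (.assigned i j) then
      let a ← op (.addZ (← op (.weight j)) (← op (.noisy i j)))
      partialWeights i j (← op (.cons a acc))
    else
      partialWeights i j acc

/-- The body of the main loop for the incident edge `i`: the weight of the edge is increased by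
one (initial target `λ - 1 - w_i`) or decreased by one (initial target `λ - w_i`). -/
def edgeStep (β x : ℝ) (lam : ℤ) (d i : ℕ) (s : ℝ) : Prog ℝ := do
  let c ← sort (← partialWeights i d [])
  let t₀ ← op (.subZ lam (← op (.weight i)))
  let s ← solveBoth β x c (← op (.subZ t₀ 1)) s
  solveBoth β x c t₀ s

/-- The main loop, over all incident edges with number smaller than the last but one argument. -/
def edgeLoop (β x : ℝ) (lam : ℤ) (d : ℕ) : ℕ → ℝ → Prog ℝ
  | 0, s => pure s
  | i + 1, s => do
    op .jump
    let s ← edgeStep β x lam d i s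
    edgeLoop β x lam d i s

/-- The algorithm for the smooth sensitivity of the local count with the unbiased estimator. -/
def smoothSensitivityUnbiased : Prog ℝ := do
  let d ← op .degree
  let lam ← op .threshold
  let β ← op .beta
  let p ← op (.expR (← op (.subR 0 (← op .eps))))
  let q ← op (.subR 1 p)
  let x ← op (.divR p (← op (.mulR q q)))
  edgeLoop β x lam d d 0

/-- The input of the node `v`, when its incident edges are numbered by `num`. -/
def nodeInput {n : ℕ} (G : SimpleGraph (Fin n)) [DecidableRel G.Adj] (w noisy : Sym2 (Fin n) → ℤ)
    (ρ : Finset (Fin n) → Fin n) (lam : ℤ) (ε₁ β : ℝ) (v : Fin n)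
    (num : Fin (G.degree v) ≃ G.neighborSet v) : Input where
  degree := G.degree v
  weight i := if hi : i < G.degree v then w s(v, (num ⟨i, hi⟩ : Fin n)) else 0
  assigned i j :=
    if hi : i < G.degree v then
      if hj : j < G.degree v then
        decide ({v, (num ⟨i, hi⟩ : Fin n), (num ⟨j, hj⟩ : Fin n)} ∈ assignedTriangles G ρ v)
      else false
    else false
  noisy i j :=
    if hi : i < G.degree v then
      if hj : j < G.degree v then noisy s((num ⟨i, hi⟩ : Fin n), (num ⟨j, hj⟩ : Fin n))
      else 0
    else 0
  threshold := lam
  eps := ε₁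
  beta := β

end RAM

/-!
Fix an incident edge `i`. Increasing its weight by one changes the local count by a sum, over the
edges `j` that form an assigned triangle with `i`, of differences `h (m + 1) - h m` of the unbiased
estimator. These differences are supported on three consecutive integers around a target `t` that is
determined by the weight of `i`: up to a common sign, they are `1 + 2 x` at `t`, `-x` at `t ± 1` and
zero elsewhere (`localCount_update_sub`). So the smooth sensitivity is the maximum, over the edge,
the direction of the change (which fixes the initial target `t₀`), the sign, the target `t` and the
new positions `c'` of the partial weights `c` of the triangles, of `(∑ j, contribution (c' j - t)) *
exp (-β * (∑ j, |c' j - c j| + |t₀ - t|))`, called `configValue` below. The changes of all other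
weights only add to the distance.

*Fixed target.* A weight at distance zero, that is, at a position with positive contribution, stays.
Weights at distance one lose when they stay, so shifting them gains more, at a lower cost, than
shifting the remaining ones, among which the closest are shifted first. The value as a function of
the number `k` of shifts is `(A + B k) exp (-β k)` up to a factor as long as weights at distance one
remain, with the real optimum `1 / β - A / B`; afterwards it is unimodal because `K / (K + 1)`
increases and `exp (-β d)` decreases. So rounding the optimum or a binary search for the sign change
of the marginal gain finds the maximum (`output_bestAtTarget`, `configValue_le_bestAtTarget`).

*Candidate targets.* A target that is neither `t₀` nor within distance one of a weight can be moved.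
The cost is linear there, so one of the two moves does not increase it (`candidateReaches_of_free`).
In the negative problem a move may run into weights that contribute a loss at the new target. If
these are few, they are shifted as well; if they are many, they are a gain for the positive problem
at the new target (`exists_good_shift`). As the algorithm maximizes over both signs, the candidate
targets suffice, although they do not for the negative problem alone
(`configValue_nonpos_or_candidateReaches`).

*Running time.* There are `d` edges, four scans for each of them, and at most `3 d + 1` targets in a
scan. A target costs a constant number of binary searches, one of which has a binary search as its
test, hence `O(log² d)` steps; merge sort costs `O(d log d)`.
-/

namespace RAM

open Prog

/-! ### Single instructions and conditionals -/

section Basics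

variable (I : Input)

@[simp] theorem output_op {α : Type} (i : Instr α) : output I (op i) = i.result I := rfl

@[simp] theorem steps_op {α : Type} (i : Instr α) : steps I (op i) = i.cost := by
  simp [op, steps]

theorem output_ite {α : Type} (b : Prop) {_ : Decidable b} (m k : Prog α) :
    output I (if b then m else k) = if b then output I m else output I k := by
  split <;> rfl

theorem steps_ite {α : Type} (b : Prop) {_ : Decidable b} (m k : Prog α) :
    steps I (if b then m else k) = if b then steps I m else steps I k := by
  split <;> rfl

attribute [simp] output_pure steps_pure output_bind steps_bind

theorem output_maxR (a b : ℝ) : output I (maxR a b) = max a b := by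
  simp only [maxR, output_bind, output_op, Instr.result, ↓output_ite, output_pure]
  by_cases h : a < b
  · simp [h, h.le]
  · simp [h, not_lt.mp h]

theorem steps_maxR (a b : ℝ) : steps I (maxR a b) = 1 := by
  simp only [maxR, steps_bind, steps_op, Instr.cost, ↓steps_ite, steps_pure, ite_self]

theorem output_maxZ (a b : ℤ) : output I (maxZ a b) = max a b := by
  simp only [maxZ, output_bind, output_op, Instr.result, ↓output_ite, output_pure]
  by_cases h : a < b
  · simp [h, h.le]
  · simp [h, not_lt.mp h]

theorem steps_maxZ (a b : ℤ) : steps I (maxZ a b) = 1 := by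
  simp only [maxZ, steps_bind, steps_op, Instr.cost, ↓steps_ite, steps_pure, ite_self]

theorem output_minN (a b : ℕ) : output I (minN a b) = min a b := by
  simp only [minN, output_bind, output_op, Instr.result, ↓output_ite, output_pure]
  by_cases h : a < b
  · simp [h, h.le]
  · simp [h, not_lt.mp h]

theorem steps_minN (a b : ℕ) : steps I (minN a b) = 1 := by
  simp only [minN, steps_bind, steps_op, Instr.cost, ↓steps_ite, steps_pure, ite_self]

/-! ### Merge sort and prefix sums -/

theorem split_spec (l : List ℤ) :
    ((output I (split l)).1 ++ (output I (split l)).2).Perm l ∧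
      (output I (split l)).1.length = (l.length + 1) / 2 ∧
      (output I (split l)).2.length = l.length / 2 ∧
      steps I (split l) = 2 * l.length := by
  induction l with
  | nil => simp [split]
  | cons a l ih =>
    obtain ⟨h₁, h₂, h₃, h₄⟩ := ih
    simp only [split, output_bind, output_op, Instr.result, output_pure, steps_bind, steps_op,
      Instr.cost, steps_pure, List.length_cons, h₂, h₃, h₄]
    refine ⟨?_, by omega, trivial, by omega⟩
    exact (List.perm_append_comm.trans h₁).cons a

theorem merge_spec (k l : List ℤ) :
    (output I (merge k l)).Perm (k ++ l) ∧
      (k.SortedLE → l.SortedLE → (output I (merge k l)).SortedLE) ∧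
      steps I (merge k l) ≤ 3 * (k.length + l.length) := by
  induction k, l using merge.induct with
  | case1 l => simp [merge]
  | case2 a k => simp +contextual [merge]
  | case3 a k b l ih₁ ih₂ =>
    simp only [merge, output_bind, output_op, Instr.result, ↓output_ite, steps_bind, steps_op,
      Instr.cost, ↓steps_ite, List.length_cons] at ih₁ ih₂ ⊢
    obtain ⟨p₁, s₁, c₁⟩ := ih₁
    obtain ⟨p₂, s₂, c₂⟩ := ih₂
    by_cases h : b < a
    · simp only [h, decide_true, if_true]
      refine ⟨?_, fun hk hl => ?_, by omega⟩
      · exact (p₁.cons b).trans List.perm_middle.symm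
      · have hl' := List.sortedLE_iff_pairwise.1 hl
        have hk' := List.sortedLE_iff_pairwise.1 hk
        rw [List.pairwise_cons] at hl' hk'
        refine List.sortedLE_iff_pairwise.2 (List.pairwise_cons.2 ⟨fun y hy => ?_,
          List.sortedLE_iff_pairwise.1 (s₁ hk (List.sortedLE_iff_pairwise.2 hl'.2))⟩)
        rcases List.mem_append.1 (p₁.mem_iff.1 hy) with hy | hy
        · rcases List.mem_cons.1 hy with rfl | hy
          · exact h.le
          · exact h.le.trans (hk'.1 y hy)
        · exact hl'.1 y hy
    · simp only [h, decide_false, Bool.false_eq_true, if_false]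
      refine ⟨p₂.cons a, fun hk hl => ?_, by omega⟩
      have hl' := List.sortedLE_iff_pairwise.1 hl
      have hk' := List.sortedLE_iff_pairwise.1 hk
      rw [List.pairwise_cons] at hl' hk'
      refine List.sortedLE_iff_pairwise.2 (List.pairwise_cons.2 ⟨fun y hy => ?_,
        List.sortedLE_iff_pairwise.1 (s₂ (List.sortedLE_iff_pairwise.2 hk'.2) hl)⟩)
      rcases List.mem_append.1 (p₂.mem_iff.1 hy) with hy | hy
      · exact hk'.1 y hy
      · rcases List.mem_cons.1 hy with rfl | hy
        · exact not_lt.mp h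
        · exact (not_lt.mp h).trans (hl'.1 y hy)

theorem mergeSort_output (fuel : ℕ) (l : List ℤ) :
    (output I (mergeSort fuel l)).Perm l ∧
      (l.length ≤ fuel → (output I (mergeSort fuel l)).SortedLE) := by
  induction fuel, l using mergeSort.induct with
  | case1 l =>
    refine ⟨by simp [mergeSort], fun h => ?_⟩
    have : l = [] := by simpa using h
    simp [mergeSort, this, List.sortedLE_iff_pairwise]
  | case2 => simp [mergeSort, List.sortedLE_iff_pairwise]
  | case3 => simp [mergeSort, List.sortedLE_iff_pairwise]
  | case4 fuel a b l ih =>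
    obtain ⟨hp, h₁, h₂, -⟩ := split_spec I (a :: b :: l)
    simp only [mergeSort, output_bind]
    refine ⟨(merge_spec I _ _).1.trans (((ih _).1.append (ih _).1).trans hp), fun h => ?_⟩
    simp only [List.length_cons] at h h₁ h₂
    exact (merge_spec I _ _).2.1 ((ih _).2 (by omega)) ((ih _).2 (by omega))

/-- The recursion tree has at most `e` levels if the list has at most `2 ^ e` entries, and a level
costs at most six steps per entry. -/
theorem steps_mergeSort_le (fuel e : ℕ) (l : List ℤ) (h : l.length ≤ 2 ^ e) :
    steps I (mergeSort fuel l) ≤ 6 * l.length * e := by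
  induction fuel generalizing e l with
  | zero => simp [mergeSort]
  | succ fuel ih =>
    match l with
    | [] => simp [mergeSort]
    | [a] => simp [mergeSort]
    | a :: b :: l =>
      obtain ⟨-, h₁, h₂, h₃⟩ := split_spec I (a :: b :: l)
      obtain _ | e := e
      · simp at h
      rw [pow_succ] at h
      set X := output I (split (a :: b :: l))
      have s₁ := ih e X.1 (by omega)
      have s₂ := ih e X.2 (by omega)
      have m₁ := (merge_spec I (output I (mergeSort fuel X.1)) (output I (mergeSort fuel X.2))).2.2
      rw [(mergeSort_output I fuel X.1).1.length_eq, (mergeSort_output I fuel X.2).1.length_eq]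
        at m₁
      simp only [mergeSort, steps_bind, steps_op, Instr.cost, h₃]
      have hlen : X.1.length + X.2.length = (a :: b :: l).length := by omega
      have : 1 ≤ (a :: b :: l).length := by simp
      generalize (a :: b :: l).length = m at *
      have : 6 * X.1.length * e + 6 * X.2.length * e = 6 * m * e := by rw [← hlen]; ring
      have : 6 * m * (e + 1) = 6 * m * e + 6 * m := by ring
      change 1 + (2 * m + (steps I (mergeSort fuel X.1) + (steps I (mergeSort fuel X.2) +
        steps I (merge (output I (mergeSort fuel X.1)) (output I (mergeSort fuel X.2)))))) ≤ _
      omega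

theorem output_sort (l : List ℤ) :
    (output I (sort l)).Perm l ∧ (output I (sort l)).SortedLE :=
  ⟨(mergeSort_output I _ l).1, (mergeSort_output I _ l).2 le_rfl⟩

theorem steps_sort_le (e : ℕ) (l : List ℤ) (h : l.length ≤ 2 ^ e) :
    steps I (sort l) ≤ 6 * l.length * e :=
  steps_mergeSort_le I _ e l h

theorem output_prefixSums (acc : ℤ) (l : List ℤ) :
    output I (prefixSums acc l) =
      (List.range (l.length + 1)).map fun i => acc + (l.take i).sum := by
  induction l generalizing acc with
  | nil => simp [prefixSums, Instr.result]
  | cons a l ih =>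
    simp only [prefixSums, output_bind, output_op, Instr.result, ih, List.length_cons]
    rw [List.range_succ_eq_map (n := l.length + 1)]
    simp [Function.comp_def, add_assoc]

theorem steps_prefixSums (acc : ℤ) (l : List ℤ) :
    steps I (prefixSums acc l) = 3 * l.length + 1 := by
  induction l generalizing acc with
  | nil => simp [prefixSums, Instr.cost]
  | cons a l ih =>
    simp only [prefixSums, steps_bind, steps_op, Instr.cost, ih, List.length_cons]
    omega

/-! ### Binary search -/

/-- What binary search guarantees for an arbitrary test: it stops at an index where the outcome of
the test changes. -/
theorem firstTrue_spec (test : ℕ → Prog Bool) (fuel lo hi : ℕ) (hlh : lo ≤ hi)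
    (hf : hi ≤ lo + fuel) :
    lo ≤ output I (firstTrue test fuel lo hi) ∧ output I (firstTrue test fuel lo hi) ≤ hi ∧
      (output I (firstTrue test fuel lo hi) < hi →
        output I (test (output I (firstTrue test fuel lo hi))) = true) ∧
      (∀ m, m + 1 = output I (firstTrue test fuel lo hi) → lo ≤ m →
        output I (test m) = false) := by
  induction fuel generalizing lo hi with
  | zero =>
    simp only [firstTrue, output_pure]
    exact ⟨le_rfl, hlh, fun h => by omega, fun m h₁ h₂ => by omega⟩
  | succ fuel ih =>
    simp only [firstTrue, output_bind, output_op, Instr.result, ↓output_ite, output_pure,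
      decide_eq_true_eq]
    by_cases h : lo < hi
    · simp only [h, if_true]
      set mid := (lo + hi) / 2
      by_cases ht : output I (test mid) = true
      · simp only [ht, if_true]
        obtain ⟨h₁, h₂, h₃, h₄⟩ := ih lo mid (by omega) (by omega)
        refine ⟨h₁, by omega, fun _ => ?_, h₄⟩
        rcases h₂.lt_or_eq with h₂ | h₂
        · exact h₃ h₂
        · rw [h₂, ht]
      · simp only [ht, Bool.false_eq_true, if_false]
        obtain ⟨h₁, h₂, h₃, h₄⟩ := ih (mid + 1) hi (by omega) (by omega)
        refine ⟨by omega, h₂, h₃, fun m hm _ => ?_⟩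
        rcases h₁.lt_or_eq with h₁ | h₁
        · exact h₄ m hm (by omega)
        · obtain rfl : m = mid := by omega
          simpa using ht
    · simp only [h, if_false]
      exact ⟨le_rfl, hlh, fun h' => h'.elim, fun m h₁ h₂ => by omega⟩

/-- An interval with fewer than `2 ^ e` points is exhausted after `e` rounds, of at most `T + 5`
steps each; the last two steps discover that it is empty. -/
theorem steps_firstTrue_le (test : ℕ → Prog Bool) (T : ℕ) (hT : ∀ m, steps I (test m) ≤ T)
    (e fuel lo hi : ℕ) (h : hi < lo + 2 ^ e) :
    steps I (firstTrue test fuel lo hi) ≤ e * (T + 5) + 2 := by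
  induction fuel generalizing e lo hi with
  | zero => simp [firstTrue]
  | succ fuel ih =>
    simp only [firstTrue, steps_bind, steps_op, Instr.cost, output_op, Instr.result,
      ↓steps_ite, steps_pure, decide_eq_true_eq]
    by_cases hl : lo < hi
    · simp only [hl, if_true]
      obtain _ | e := e
      · simp at h; omega
      rw [pow_succ] at h
      set mid := (lo + hi) / 2
      have := hT mid
      have h₁ := ih e lo mid (by omega)
      have h₂ := ih e (mid + 1) hi (by omega)
      rw [add_one_mul]
      split <;> omega
    · simp [hl]

theorem getD_toArray (l : List ℤ) {i : ℕ} (hi : i < l.length) : l.toArray.getD i 0 = l[i] := by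
  simp [hi]

/-- In a sorted list the entries smaller than `y` come first. -/
theorem getElem_lt_iff_lt_countP {l : List ℤ} (hs : l.SortedLE) (y : ℤ) (i : ℕ)
    (hi : i < l.length) : l[i] < y ↔ i < l.countP (· < y) := by
  have hc := List.sortedLE_iff_pairwise.1 hs
  clear hs
  induction l generalizing i with
  | nil => simp at hi
  | cons a l ih =>
    rw [List.pairwise_cons] at hc
    by_cases ha : a < y
    · rw [List.countP_cons_of_pos (by simpa using ha)]
      obtain _ | i := i
      · simpa using ha
      · simpa using ih i (by simpa using hi) hc.2
    · have h0 : ∀ b ∈ l, ¬ b < y := fun b hb => by have := hc.1 b hb; omega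
      rw [List.countP_cons_of_neg (by simpa using ha),
        List.countP_eq_zero.2 (by simpa using h0)]
      obtain _ | i := i
      · simpa using ha
      · simpa using h0 _ (List.getElem_mem _)

theorem output_lowerBound {l : List ℤ} (hl : l.SortedLE) (y : ℤ) :
    output I (lowerBound l.toArray l.length y) = l.countP (· < y) := by
  obtain ⟨-, h₂, h₃, h₄⟩ := firstTrue_spec I (fun i => do
    if ← op (.ltZ (← op (.read l.toArray i)) y) then pure false else pure true) l.length 0 l.length
    (Nat.zero_le _) (by omega)
  simp only [output_bind, output_op, Instr.result, ↓output_ite, output_pure,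
    decide_eq_true_eq] at h₃ h₄
  change output I (lowerBound l.toArray l.length y) ≤ l.length at h₂
  change output I (lowerBound l.toArray l.length y) < l.length →
    (if l.toArray.getD (output I (lowerBound l.toArray l.length y)) 0 < y then _ else _) = _ at h₃
  change ∀ m, m + 1 = output I (lowerBound l.toArray l.length y) → _ at h₄
  set m := output I (lowerBound l.toArray l.length y)
  have hle : l.countP (· < y) ≤ l.length := List.countP_le_length
  refine le_antisymm ?_ ?_
  · by_contra! hlt
    obtain ⟨m', hm'⟩ : ∃ m', m' + 1 = m := ⟨m - 1, by omega⟩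
    have := h₄ m' hm' (Nat.zero_le _)
    have hlen : m' < l.length := by omega
    simp only [getD_toArray _ hlen, getElem_lt_iff_lt_countP hl] at this
    simp at this
    omega
  · by_contra! hlt
    have := h₃ (by omega)
    have hlen : m < l.length := by omega
    simp only [getD_toArray _ hlen, getElem_lt_iff_lt_countP hl] at this
    simp at this
    omega

theorem steps_lowerBound_le (a : Array ℤ) (n e : ℕ) (y : ℤ) (h : n < 2 ^ e) :
    steps I (lowerBound a n y) ≤ e * 7 + 2 := by
  refine steps_firstTrue_le I _ 2 (fun m => ?_) e n 0 n (by omega)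
  simp only [steps_bind, steps_op, Instr.cost, ↓steps_ite, steps_pure]
  split <;> omega

end Basics

/-! ### The distance data structure -/

/-- The array of a sorted list with its prefix sums. -/
def sortedOf (l : List ℤ) : Sorted where
  p := l.toArray
  pre := ((List.range (l.length + 1)).map fun i => (l.take i).sum).toArray
  n := l.length

/-- The distances of the entries below `left` from `tl`, and of the entries from `right` on from
`tr`, in the order of the entries. -/
def farDistances (l : List ℤ) (D : DistTable) : List ℤ :=
  (l.take D.left).map (D.tl - ·) ++ (l.drop D.right).map (· - D.tr)

/-- `D` is a distance table of the sorted list `l`, and `ds` lists the distances of the remaining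
entries in nondecreasing order. -/
structure IsDistTable (l : List ℤ) (D : DistTable) (ds : List ℤ) : Prop where
  sorted : l.SortedLE
  toSorted_eq : D.toSorted = sortedOf l
  left_le : D.left ≤ D.right
  right_le : D.right ≤ l.length
  near_eq : D.nZero + D.nOne = D.right - D.left
  ds_sorted : ds.SortedLE
  ds_perm : ds.Perm (farDistances l D)
  ds_nonneg : ∀ x ∈ ds, 0 ≤ x

/-- If no element of `U` exceeds an element of `W`, then sorting `U ++ W` puts `U` in front. -/
theorem perm_take_of_forall_le {U W ds : List ℤ} (hds : ds.SortedLE) (hp : ds.Perm (U ++ W))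
    (h : ∀ u ∈ U, ∀ w ∈ W, u ≤ w) : (ds.take U.length).Perm U := by
  have key : U.mergeSort (· ≤ ·) ++ W.mergeSort (· ≤ ·) = ds := by
    refine List.Perm.eq_of_sortedLE (List.sortedLE_iff_pairwise.2 ?_) hds
      (((List.mergeSort_perm U _).append (List.mergeSort_perm W _)).trans hp.symm)
    refine List.pairwise_append.2 ⟨List.sortedLE_mergeSort.pairwise,
      List.sortedLE_mergeSort.pairwise, fun u hu w hw => h u ?_ w ?_⟩
    · simpa using hu
    · simpa using hw
  rw [← key, List.take_append_of_le_length (by simp), List.take_of_length_le (by simp)]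
  exact List.mergeSort_perm U _

section Table

variable (I : Input)

theorem output_buildSorted (l : List ℤ) : output I (buildSorted l) = sortedOf l := by
  simp [buildSorted, sortedOf, Instr.result, output_prefixSums]

theorem steps_buildSorted (l : List ℤ) : steps I (buildSorted l) = 5 * l.length + 5 := by
  simp only [buildSorted, steps_bind, steps_op, output_op, Instr.result, Instr.cost,
    steps_prefixSums, output_prefixSums, steps_pure, List.length_map, List.length_range]
  omega

variable {I} {l : List ℤ} {D : DistTable} {ds : List ℤ}

theorem IsDistTable.p_eq (h : IsDistTable l D ds) : D.p = l.toArray := by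
  rw [h.toSorted_eq]; rfl

theorem IsDistTable.n_eq (h : IsDistTable l D ds) : D.n = l.length := by
  rw [h.toSorted_eq]; rfl

theorem IsDistTable.pre_getD (h : IsDistTable l D ds) {i : ℕ} (hi : i ≤ l.length) :
    D.pre.getD i 0 = (l.take i).sum := by
  rw [h.toSorted_eq, sortedOf, getD_toArray _ (by simp; omega)]
  simp

theorem IsDistTable.length_eq (h : IsDistTable l D ds) :
    ds.length = D.left + (l.length - D.right) := by
  have := h.left_le
  have := h.right_le
  rw [h.ds_perm.length_eq, farDistances]
  simp
  omega

theorem output_leftDist (h : IsDistTable l D ds) {k : ℕ} (hk : 1 ≤ k) (hk' : k ≤ D.left) :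
    output I (leftDist D k) = D.tl - (l.take D.left).getD (D.left - k) 0 := by
  have := h.left_le
  have := h.right_le
  simp only [leftDist, output_bind, output_op, Instr.result, h.p_eq]
  rw [getD_toArray _ (by omega), List.getD_eq_getElem _ _ (by simp; omega)]
  simp

theorem output_rightDist (h : IsDistTable l D ds) {k : ℕ} (hk : 1 ≤ k)
    (hk' : k ≤ l.length - D.right) :
    output I (rightDist D k) = (l.drop D.right).getD (k - 1) 0 - D.tr := by
  have := h.left_le
  have := h.right_le
  simp only [rightDist, output_bind, output_op, Instr.result, h.p_eq]
  rw [getD_toArray _ (by omega), List.getD_eq_getElem _ _ (by simp; omega)]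
  simp only [List.getElem_drop]
  congr 2
  omega

/-- The distances of the `s` closest entries on the left and the `r` closest ones on the right. -/
def closest (l : List ℤ) (D : DistTable) (s r : ℕ) : List ℤ :=
  ((l.take D.left).drop (D.left - s)).map (D.tl - ·) ++ ((l.drop D.right).take r).map (· - D.tr)

theorem getD_le_of_mem_drop {A : List ℤ} (hA : A.SortedLE) {m : ℕ} {x : ℤ} (hx : x ∈ A.drop m) :
    m < A.length ∧ A.getD m 0 ≤ x := by
  obtain ⟨i, hi, rfl⟩ := List.mem_iff_getElem.1 hx
  simp only [List.length_drop] at hi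
  refine ⟨by omega, ?_⟩
  rw [List.getD_eq_getElem _ _ (by omega), List.getElem_drop]
  exact hA.getElem_le_getElem_of_le (by omega)

theorem le_getD_of_mem_take {A : List ℤ} (hA : A.SortedLE) {m : ℕ} (hm : m ≤ A.length) {x : ℤ}
    (hx : x ∈ A.take m) : 0 < m ∧ x ≤ A.getD (m - 1) 0 := by
  obtain ⟨i, hi, rfl⟩ := List.mem_iff_getElem.1 hx
  simp only [List.length_take] at hi
  refine ⟨by omega, ?_⟩
  rw [List.getD_eq_getElem _ _ (by omega), List.getElem_take]
  exact hA.getElem_le_getElem_of_le (by omega)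

/-- The `k` closest entries are those that `splitPoint` selects on both sides: at the index found
by the binary search, no selected distance exceeds one that is not selected. -/
theorem splitPoint_spec (h : IsDistTable l D ds) {k : ℕ} (hk : k ≤ ds.length) :
    output I (splitPoint D k) ≤ k ∧ output I (splitPoint D k) ≤ D.left ∧
      k - output I (splitPoint D k) ≤ l.length - D.right ∧
      (ds.take k).Perm
        (closest l D (output I (splitPoint D k)) (k - output I (splitPoint D k))) := by
  have hlen := h.length_eq
  have hle := h.left_le
  have hre := h.right_le
  have hspec := firstTrue_spec I (fun l => do
    let a ← leftDist D (← op (.addN l 1))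
    let b ← rightDist D (← op (.subN k l))
    op (.ltZ b a)) (min k D.left) (k - (D.n - D.right)) (min k D.left)
    (by rw [h.n_eq]; omega) (by omega)
  have hout : output I (splitPoint D k) = output I (firstTrue (fun l => do
    let a ← leftDist D (← op (.addN l 1))
    let b ← rightDist D (← op (.subN k l))
    op (.ltZ b a)) (min k D.left) (k - (D.n - D.right)) (min k D.left)) := by
    simp only [splitPoint, output_bind, output_op, Instr.result, output_minN]
  rw [← hout] at hspec
  set s := output I (splitPoint D k)
  obtain ⟨h₁, h₂, h₃, h₄⟩ := hspec
  rw [h.n_eq] at h₁ h₄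
  have hsk : s ≤ k := by omega
  have hsl : s ≤ D.left := by omega
  have hsr : k - s ≤ l.length - D.right := by omega
  refine ⟨hsk, hsl, hsr, ?_⟩
  set A := l.take D.left with hA
  set B := l.drop D.right with hB
  have sA : A.SortedLE := List.sortedLE_iff_pairwise.2
    (h.sorted.pairwise.sublist (List.take_sublist _ _))
  have sB : B.SortedLE := List.sortedLE_iff_pairwise.2
    (h.sorted.pairwise.sublist (List.drop_sublist _ _))
  have lA : A.length = D.left := by simp [hA]; omega
  have lB : B.length = l.length - D.right := by simp [hB]
  -- the two outcomes of the test next to the split point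
  have c₁ : s < k → s < D.left →
      B.getD (k - s - 1) 0 - D.tr ≤ D.tl - A.getD (D.left - s - 1) 0 := by
    intro hs hs'
    have := h₃ (by omega)
    simp only [output_bind, output_op, Instr.result, decide_eq_true_eq] at this
    rw [output_leftDist h (by omega) (by omega), output_rightDist h (by omega) (by omega)] at this
    exact this.le
  have c₂ : 0 < s → k - s < l.length - D.right →
      D.tl - A.getD (D.left - s) 0 ≤ B.getD (k - s) 0 - D.tr := by
    intro hs hs'
    have := h₄ (s - 1) (by omega) (by omega)
    simp only [output_bind, output_op, Instr.result, decide_eq_false_iff_not, not_lt] at this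
    rw [output_leftDist h (by omega) (by omega), output_rightDist h (by omega) (by omega)] at this
    rwa [show D.left - (s - 1 + 1) = D.left - s by omega,
      show k - (s - 1) - 1 = k - s by omega] at this
  have hcl : (closest l D s (k - s)).length = k := by
    simp [closest, ← hA, ← hB, lA, lB]; omega
  have := perm_take_of_forall_le (U := closest l D s (k - s))
    (W := (A.take (D.left - s)).map (D.tl - ·) ++ (B.drop (k - s)).map (· - D.tr)) h.ds_sorted ?_ ?_
  · rwa [hcl] at this
  · refine h.ds_perm.trans ?_
    rw [farDistances, closest, ← hA, ← hB]
    conv_lhs => rw [← List.take_append_drop (D.left - s) A, ← List.take_append_drop (k - s) B]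
    simp only [List.map_append]
    rw [List.perm_iff_count]
    intro x
    simp only [List.count_append]
    omega
  · intro u hu w hw
    simp only [closest, ← hA, ← hB, List.mem_append, List.mem_map] at hu hw
    rcases hu with ⟨u, hu, rfl⟩ | ⟨u, hu, rfl⟩ <;> rcases hw with ⟨w, hw, rfl⟩ | ⟨w, hw, rfl⟩
    · have h₁ := getD_le_of_mem_drop sA hu
      have h₂ := le_getD_of_mem_take sA (by omega) hw
      have : A.getD (D.left - s - 1) 0 ≤ A.getD (D.left - s) 0 := by
        rw [List.getD_eq_getElem _ _ (by omega), List.getD_eq_getElem _ _ (by omega)]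
        exact sA.getElem_le_getElem_of_le (by omega)
      omega
    · have h₁ := getD_le_of_mem_drop sA hu
      have h₂ := getD_le_of_mem_drop sB hw
      have := c₂ (by omega) (by omega)
      omega
    · have h₁ := le_getD_of_mem_take sB (by omega) hu
      have h₂ := le_getD_of_mem_take sA (by omega) hw
      have := c₁ (by omega) (by omega)
      omega
    · have h₁ := le_getD_of_mem_take sB (by omega) hu
      have h₂ := getD_le_of_mem_drop sB hw
      have : B.getD (k - s - 1) 0 ≤ B.getD (k - s) 0 := by
        rw [List.getD_eq_getElem _ _ (by omega), List.getD_eq_getElem _ _ (by omega)]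
        exact sB.getElem_le_getElem_of_le (by omega)
      omega

/-- Beyond the entries at distance zero and one, `kthDistance` reads off the sorted list of the
remaining distances: the larger of the outermost selected distances on the two sides is the
largest of the selected ones. -/
theorem output_kthDistance (h : IsDistTable l D ds) {k : ℕ} (hk : k < ds.length) :
    output I (kthDistance D (D.nZero + D.nOne + (k + 1))) = ds[k] := by
  obtain ⟨h₁, h₂, h₃, h₄⟩ := splitPoint_spec (I := I) h (k := k + 1) hk
  simp only [kthDistance, output_bind, output_op, Instr.result, ↓output_ite, output_pure,
    decide_eq_true_eq, output_maxZ]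
  rw [if_pos (by omega), if_pos (by omega)]
  rw [Nat.add_sub_cancel_left]
  set s := output I (splitPoint D (k + 1))
  have hlr := h.left_le
  have hre := h.right_le
  set A := l.take D.left with hA
  set B := l.drop D.right with hB
  have sA : A.SortedLE := List.sortedLE_iff_pairwise.2
    (h.sorted.pairwise.sublist (List.take_sublist _ _))
  have sB : B.SortedLE := List.sortedLE_iff_pairwise.2
    (h.sorted.pairwise.sublist (List.drop_sublist _ _))
  have lA : A.length = D.left := by simp [hA]; omega
  have lB : B.length = l.length - D.right := by simp [hB]
  have hmem : ds[k] ∈ ds.take (k + 1) := by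
    rw [List.mem_take_iff_getElem]
    exact ⟨k, by omega, rfl⟩
  have hmax : ∀ x ∈ closest l D s (k + 1 - s), x ≤ ds[k] := by
    intro x hx
    obtain ⟨i, hi, rfl⟩ := List.mem_take_iff_getElem.1 (h₄.mem_iff.2 hx)
    exact h.ds_sorted.getElem_le_getElem_of_le (by omega)
  have hnn := h.ds_nonneg _ (List.getElem_mem hk)
  suffices max (if 0 < s then output I (leftDist D s) else 0)
      (if 0 < k + 1 - s then output I (rightDist D (k + 1 - s)) else 0) = ds[k] by
    split_ifs at this ⊢ <;> exact this
  refine le_antisymm (max_le ?_ ?_) ?_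
  · split_ifs with hs
    · rw [output_leftDist h hs h₂]
      refine hmax _ (List.mem_append_left _ (List.mem_map_of_mem ?_))
      rw [← hA, List.getD_eq_getElem _ _ (by omega), List.mem_drop_iff_getElem]
      exact ⟨0, by omega, by simp⟩
    · exact hnn
  · split_ifs with hs
    · rw [output_rightDist h hs h₃]
      refine hmax _ (List.mem_append_right _ (List.mem_map_of_mem (f := (· - D.tr)) ?_))
      rw [← hB, List.getD_eq_getElem _ _ (by omega), List.mem_take_iff_getElem]
      exact ⟨k + 1 - s - 1, by omega, rfl⟩
    · exact hnn
  · have hm := h₄.mem_iff.1 hmem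
    simp only [closest, ← hA, ← hB, List.mem_append, List.mem_map] at hm
    rcases hm with ⟨x, hx, hx'⟩ | ⟨x, hx, hx'⟩
    · refine le_max_of_le_left ?_
      have := getD_le_of_mem_drop sA hx
      rw [if_pos (by omega), output_leftDist h (by omega) h₂, ← hA]
      omega
    · refine le_max_of_le_right ?_
      have := le_getD_of_mem_take sB (by omega) hx
      rw [if_pos (by omega), output_rightDist h (by omega) h₃, ← hB]
      omega

theorem sum_map_sub_left (A : List ℤ) (t : ℤ) : (A.map (t - ·)).sum = A.length * t - A.sum := by
  induction A with
  | nil => simp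
  | cons a A ih => simp [ih]; ring

theorem sum_map_sub_right (A : List ℤ) (t : ℤ) : (A.map (· - t)).sum = A.sum - A.length * t := by
  induction A with
  | nil => simp
  | cons a A ih => simp [ih]; ring

theorem output_sumDistances (h : IsDistTable l D ds) {k : ℕ} (hk : k ≤ ds.length) :
    output I (sumDistances D (D.nZero + D.nOne + k)) = D.nOne + (ds.take k).sum := by
  obtain ⟨h₁, h₂, h₃, h₄⟩ := splitPoint_spec (I := I) h hk
  have hlr := h.left_le
  have hre := h.right_le
  simp only [sumDistances, output_bind, output_op, Instr.result, ↓output_ite, output_pure,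
    decide_eq_true_eq]
  rw [Nat.add_sub_cancel_left]
  set s := output I (splitPoint D k)
  rcases Nat.eq_zero_or_pos k with rfl | hk0
  · rw [if_neg (c := D.nZero + D.nOne < D.nZero + D.nOne + 0) (by omega)]
    split_ifs with h'
    · simp only [List.take_zero, List.sum_nil, add_zero]
      congr 1
      omega
    · simp
      omega
  · rw [if_pos (by omega), if_pos (by omega), h.pre_getD (by omega), h.pre_getD (by omega),
      h.pre_getD (by omega), h.pre_getD (by omega), h₄.sum_eq, closest, List.sum_append,
      sum_map_sub_left, sum_map_sub_right]
    have e₁ : (l.take D.left).sum =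
        (l.take (D.left - s)).sum + ((l.take D.left).drop (D.left - s)).sum := by
      rw [← List.sum_take_add_sum_drop (l.take D.left) (D.left - s), List.take_take,
        min_eq_left (by omega)]
    have e₂ : (l.take (D.right + (k - s))).sum =
        (l.take D.right).sum + ((l.drop D.right).take (k - s)).sum := by
      rw [List.take_add, List.sum_append]
    have e₃ : ((l.take D.left).drop (D.left - s)).length = s := by simp; omega
    have e₄ : ((l.drop D.right).take (k - s)).length = k - s := by simp; omega
    rw [e₁, e₂, e₃, e₄]
    ring

theorem steps_leftDist (k : ℕ) : steps I (leftDist D k) = 3 := by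
  simp [leftDist, Instr.cost]

theorem steps_rightDist (k : ℕ) : steps I (rightDist D k) = 4 := by
  simp [rightDist, Instr.cost]

theorem steps_splitPoint_le (k e : ℕ) (he : D.left < 2 ^ e) :
    steps I (splitPoint D k) ≤ e * 15 + 5 := by
  simp only [splitPoint, steps_bind, steps_op, Instr.cost, output_minN, steps_minN]
  have := steps_firstTrue_le I (fun l => do
    let a ← leftDist D (← op (.addN l 1))
    let b ← rightDist D (← op (.subN k l))
    op (.ltZ b a)) 10 (fun m => by simp [steps_leftDist, steps_rightDist, Instr.cost]) e
    (min k D.left) (k - (D.n - D.right)) (min k D.left) (by omega)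
  simp only [output_op, Instr.result] at this ⊢
  omega

theorem steps_kthDistance_le (k e : ℕ) (he : D.left < 2 ^ e) :
    steps I (kthDistance D k) ≤ e * 15 + 20 := by
  simp only [kthDistance, steps_bind, steps_op, Instr.cost, ↓steps_ite, steps_pure, steps_maxZ,
    steps_leftDist, steps_rightDist]
  have := steps_splitPoint_le (I := I) (output I (op (.subN k (output I
    (op (.addN D.nZero D.nOne)))))) e he
  split_ifs <;> omega

theorem steps_sumDistances_le (k e : ℕ) (he : D.left < 2 ^ e) :
    steps I (sumDistances D k) ≤ e * 15 + 30 := by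
  simp only [sumDistances, steps_bind, steps_op, Instr.cost, ↓steps_ite, steps_pure]
  have := steps_splitPoint_le (I := I) (output I (op (.subN k (output I
    (op (.addN D.nZero D.nOne)))))) e he
  split_ifs <;> omega

end Table

/-! ### The optimal numbers of shifts for a fixed target -/

section Optimum

/-- The function `u ↦ (1 + u) exp (-u)` increases up to zero. -/
theorem one_add_mul_exp_neg_le_of_nonpos {u u' : ℝ} (h : u ≤ u') (h' : u' ≤ 0) :
    (1 + u) * Real.exp (-u) ≤ (1 + u') * Real.exp (-u') := by
  have e : Real.exp (-u) = Real.exp (u' - u) * Real.exp (-u') := by rw [← Real.exp_add]; ring_nf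
  rw [e, ← mul_assoc]
  refine mul_le_mul_of_nonneg_right ?_ (Real.exp_pos _).le
  rcases le_or_gt (1 + u) 0 with h0 | h0
  · nlinarith [Real.add_one_le_exp (u' - u)]
  · have h1 : 1 - (u' - u) ≤ Real.exp (-(u' - u)) := by
      linarith [Real.add_one_le_exp (-(u' - u))]
    have h2 : Real.exp (u' - u) * Real.exp (-(u' - u)) = 1 := by rw [← Real.exp_add]; simp
    have h3 := Real.exp_pos (u' - u)
    have h4 : 1 + u ≤ (1 + u') * Real.exp (-(u' - u)) := by nlinarith
    nlinarith

/-- The function `u ↦ (1 + u) exp (-u)` decreases from zero on. -/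
theorem one_add_mul_exp_neg_le_of_nonneg {u u' : ℝ} (h : u' ≤ u) (h' : 0 ≤ u') :
    (1 + u) * Real.exp (-u) ≤ (1 + u') * Real.exp (-u') := by
  have e : Real.exp (-u') = Real.exp (u - u') * Real.exp (-u) := by rw [← Real.exp_add]; ring_nf
  rw [e, ← mul_assoc]
  refine mul_le_mul_of_nonneg_right ?_ (Real.exp_pos _).le
  nlinarith [Real.add_one_le_exp (u - u')]

/-- The function `s ↦ (A + B s) exp (-β s)` increases up to `1 / β - A / B` and decreases from
there on. -/
theorem linear_mul_exp_le {A B β s s' : ℝ} (hB : 0 < B) (hβ : 0 < β)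
    (h : s ≤ s' ∧ s' ≤ 1 / β - A / B ∨ s' ≤ s ∧ 1 / β - A / B ≤ s') :
    (A + B * s) * Real.exp (-(β * s)) ≤ (A + B * s') * Real.exp (-(β * s')) := by
  set κ := 1 / β - A / B with hκ
  -- in terms of `u = β (r - κ)` the function is a multiple of `(1 + u) exp (-u)`
  have key : ∀ r, (A + B * r) * Real.exp (-(β * r)) =
      B / β * Real.exp (-(β * κ)) * ((1 + β * (r - κ)) * Real.exp (-(β * (r - κ)))) := by
    intro r
    have e : Real.exp (-(β * r)) = Real.exp (-(β * κ)) * Real.exp (-(β * (r - κ))) := by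
      rw [← Real.exp_add]; ring_nf
    rw [e, show A + B * r = B / β * (1 + β * (r - κ)) by rw [hκ]; field_simp; ring]
    ring
  rw [key s, key s']
  refine mul_le_mul_of_nonneg_left ?_ (by positivity)
  rcases h with ⟨h, h'⟩ | ⟨h, h'⟩
  · exact one_add_mul_exp_neg_le_of_nonpos (by nlinarith) (by nlinarith)
  · exact one_add_mul_exp_neg_le_of_nonneg (by nlinarith) (by nlinarith)

/-- The value of shifting `k` values from distance one and the `l` closest remaining values, of
distances `ds`: `A` is the total without shifts, a shift from distance one raises it by `B`, and a
shift of a remaining value by `a`; `own` is the change of the fixed weight. -/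
noncomputable def shiftValue (β A B a : ℝ) (ds : List ℤ) (own : ℤ) (k l : ℕ) : ℝ :=
  (A + B * k + a * l) * Real.exp (-(β * (k + (ds.take l).sum + own : ℤ)))

variable {β A B a b : ℝ} {ds : List ℤ} {own : ℤ} {z o : ℕ}

theorem sum_take_add_le (h1 : ∀ x ∈ ds, 1 ≤ x) (l m : ℕ) (hl : l + m ≤ ds.length) :
    (ds.take l).sum + m ≤ (ds.take (l + m)).sum := by
  induction m with
  | zero => simp
  | succ m ih =>
    have := h1 _ (List.getElem_mem (show l + m < ds.length by omega))
    rw [← add_assoc, List.sum_take_succ _ _ (by omega)]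
    have := ih (by omega)
    push_cast
    omega

theorem shiftValue_zero (k : ℕ) : shiftValue β A B a ds own k 0 =
    (A + B * k) * Real.exp (-(β * k)) * Real.exp (-(β * own)) := by
  simp only [shiftValue, List.take_zero, List.sum_nil]
  rw [mul_assoc, ← Real.exp_add]
  push_cast
  ring_nf

theorem shiftValue_zero_le (hB : 0 < B) (hβ : 0 < β) {k k' : ℕ}
    (h : (k : ℝ) ≤ k' ∧ (k' : ℝ) ≤ 1 / β - A / B ∨ (k' : ℝ) ≤ k ∧ 1 / β - A / B ≤ k') :
    shiftValue β A B a ds own k 0 ≤ shiftValue β A B a ds own k' 0 := by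
  rw [shiftValue_zero, shiftValue_zero]
  exact mul_le_mul_of_nonneg_right (linear_mul_exp_le hB hβ h) (Real.exp_pos _).le

/-- Shifting a value from distance one gains more, and costs no more, than shifting a more distant
value. The bound zero covers totals that are not positive, for which a lower cost does not help. -/
theorem shiftValue_exchange (hβ : 0 < β) (haB : a ≤ B) (h1 : ∀ x ∈ ds, 1 ≤ x) (k l m : ℕ)
    (hl : l + m ≤ ds.length) :
    shiftValue β A B a ds own k (l + m) ≤ max 0 (shiftValue β A B a ds own (k + m) l) := by
  rcases le_or_gt (A + B * k + a * (l + m : ℕ)) 0 with h0 | h0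
  · exact le_max_of_le_left (mul_nonpos_of_nonpos_of_nonneg h0 (Real.exp_pos _).le)
  · refine le_max_of_le_right ?_
    have hs := sum_take_add_le h1 l m hl
    refine mul_le_mul ?_ ?_ (Real.exp_pos _).le ?_
    · push_cast
      nlinarith [mul_le_mul_of_nonneg_right haB (Nat.cast_nonneg (α := ℝ) m)]
    · refine Real.exp_le_exp.2 (neg_le_neg (mul_le_mul_of_nonneg_left ?_ hβ.le))
      refine Int.cast_le.2 ?_
      push_cast
      omega
    · refine h0.le.trans ?_
      push_cast
      nlinarith [mul_le_mul_of_nonneg_right haB (Nat.cast_nonneg (α := ℝ) m)]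

/-- If there are enough values at distance one, nothing else is shifted, and the number of shifts is
one of the two integers next to the real optimum. -/
theorem shiftValue_le_of_lt (hB : 0 < B) (hβ : 0 < β) (haB : a ≤ B) (h1 : ∀ x ∈ ds, 1 ≤ x)
    (k l : ℕ) (hl : l ≤ ds.length) :
    shiftValue β A B a ds own k l ≤
      max 0 (max (shiftValue β A B a ds own ⌊1 / β - A / B⌋₊ 0)
        (shiftValue β A B a ds own ⌈1 / β - A / B⌉₊ 0)) := by
  have h := shiftValue_exchange (A := A) (own := own) hβ haB h1 k 0 l (by omega)
  rw [zero_add] at h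
  refine h.trans (max_le_max le_rfl ?_)
  rcases le_total ((k + l : ℕ) : ℝ) (1 / β - A / B) with h' | h'
  · refine le_max_of_le_left (shiftValue_zero_le hB hβ (Or.inl ⟨?_, Nat.floor_le ?_⟩))
    · exact_mod_cast Nat.le_floor h'
    · exact (Nat.cast_nonneg _).trans h'
  · refine le_max_of_le_right (shiftValue_zero_le hB hβ (Or.inr ⟨?_, Nat.le_ceil _⟩))
    exact_mod_cast Nat.ceil_le.2 h'

theorem shiftValue_all_succ (l : ℕ) (hl : l < ds.length) :
    shiftValue β (a * z - b * o) (a + b) a ds own o (l + 1) =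
      a * ((z + o + l : ℕ) + 1) * Real.exp (-(β * ds[l])) *
        Real.exp (-(β * (o + (ds.take l).sum + own : ℤ))) := by
  rw [shiftValue, List.sum_take_succ _ _ hl, mul_assoc, ← Real.exp_add]
  congr 2
  · push_cast; ring
  · push_cast; ring

theorem shiftValue_all (l : ℕ) :
    shiftValue β (a * z - b * o) (a + b) a ds own o l =
      a * (z + o + l : ℕ) * Real.exp (-(β * (o + (ds.take l).sum + own : ℤ))) := by
  rw [shiftValue]
  congr 1
  push_cast; ring

/-- When all values at distance one are shifted, a further shift at distance `d` pays off if and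
only if `K / (K + 1) ≤ exp (-β d)`, where `K` values contribute before it. -/
theorem shiftValue_all_succ_le (ha : 0 < a) (l : ℕ) (hl : l < ds.length)
    (h : Real.exp (-(β * ds[l])) ≤ ((z + o + l : ℕ) : ℝ) / (z + o + l + 1 : ℕ)) :
    shiftValue β (a * z - b * o) (a + b) a ds own o (l + 1) ≤
      shiftValue β (a * z - b * o) (a + b) a ds own o l := by
  rw [shiftValue_all_succ l hl, shiftValue_all]
  refine mul_le_mul_of_nonneg_right ?_ (Real.exp_pos _).le
  rw [le_div_iff₀ (by positivity)] at h
  push_cast at h ⊢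
  nlinarith

theorem shiftValue_all_le_succ (ha : 0 < a) (l : ℕ) (hl : l < ds.length)
    (h : ((z + o + l : ℕ) : ℝ) / (z + o + l + 1 : ℕ) ≤ Real.exp (-(β * ds[l]))) :
    shiftValue β (a * z - b * o) (a + b) a ds own o l ≤
      shiftValue β (a * z - b * o) (a + b) a ds own o (l + 1) := by
  rw [shiftValue_all_succ l hl, shiftValue_all]
  refine mul_le_mul_of_nonneg_right ?_ (Real.exp_pos _).le
  rw [div_le_iff₀ (by positivity)] at h
  push_cast at h ⊢
  nlinarith

theorem ratio_mono {m n : ℕ} (h : m ≤ n) : (m : ℝ) / (m + 1 : ℕ) ≤ (n : ℝ) / (n + 1 : ℕ) := by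
  rw [div_le_div_iff₀ (by positivity) (by positivity)]
  have : (m : ℝ) ≤ n := by exact_mod_cast h
  push_cast
  nlinarith

/-- The ratios `K / (K + 1)` increase with the number of shifts and the exponentials of the
distances decrease, so the value is unimodal, and a sign change of the marginal gain is a maximum.
-/
theorem shiftValue_all_le (ha : 0 < a) (hβ : 0 < β) (hs : ds.SortedLE) (m : ℕ)
    (hm : ∀ h : m < ds.length,
      Real.exp (-(β * ds[m])) ≤ ((z + o + m : ℕ) : ℝ) / (z + o + m + 1 : ℕ))
    (hm' : ∀ i, i + 1 = m → ∀ h : i < ds.length,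
      ((z + o + i : ℕ) : ℝ) / (z + o + i + 1 : ℕ) ≤ Real.exp (-(β * ds[i])))
    (hml : m ≤ ds.length) (l : ℕ) (hl : l ≤ ds.length) :
    shiftValue β (a * z - b * o) (a + b) a ds own o l ≤
      shiftValue β (a * z - b * o) (a + b) a ds own o m := by
  have hexp : ∀ i j, ∀ hij : i ≤ j, ∀ hj : j < ds.length,
      Real.exp (-(β * ds[j])) ≤ Real.exp (-(β * ds[i]'(hij.trans_lt hj))) := by
    intro i j hij hj
    have : ds[i] ≤ ds[j] := hs.getElem_le_getElem_of_le hij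
    gcongr
  rcases le_total m l with h | h
  · induction l, h using Nat.le_induction with
    | base => exact le_rfl
    | succ l h ih =>
      refine (shiftValue_all_succ_le ha l (by omega) ?_).trans (ih (by omega))
      exact (hexp m l h (by omega)).trans ((hm (by omega)).trans (ratio_mono (by omega)))
  · induction h using Nat.decreasingInduction with
    | self => exact le_rfl
    | of_succ l h ih =>
      refine (shiftValue_all_le_succ ha l (by omega) ?_).trans (ih (by omega))
      exact (ratio_mono (by omega)).trans ((hm' (m - 1) (by omega) (by omega)).trans
        (hexp l (m - 1) (by omega) (by omega)))

/-- If the real optimum is at least the number `o` of values at distance one, all of these are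
shifted. -/
theorem shiftValue_le_of_le (ha : 0 < a) (hb : 0 < b) (hβ : 0 < β) (hs : ds.SortedLE)
    (h1 : ∀ x ∈ ds, 1 ≤ x)
    (ho : (o : ℝ) ≤ 1 / β - (a * z - b * o) / (a + b)) (m : ℕ)
    (hm : ∀ h : m < ds.length,
      Real.exp (-(β * ds[m])) ≤ ((z + o + m : ℕ) : ℝ) / (z + o + m + 1 : ℕ))
    (hm' : ∀ i, i + 1 = m → ∀ h : i < ds.length,
      ((z + o + i : ℕ) : ℝ) / (z + o + i + 1 : ℕ) ≤ Real.exp (-(β * ds[i])))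
    (hml : m ≤ ds.length) (k l : ℕ) (hk : k ≤ o) (hl : l ≤ ds.length) :
    shiftValue β (a * z - b * o) (a + b) a ds own k l ≤
      max 0 (shiftValue β (a * z - b * o) (a + b) a ds own o m) := by
  have haB : a ≤ a + b := by linarith
  have key := shiftValue_all_le (b := b) (own := own) ha hβ hs m hm hm' hml
  rcases le_total (k + l) o with h | h
  · have h₁ := shiftValue_exchange (A := a * z - b * o) (B := a + b) (own := own) hβ
      haB h1 k 0 l (by omega)
    rw [zero_add] at h₁
    refine h₁.trans (max_le_max le_rfl ?_)
    refine le_trans (shiftValue_zero_le (by linarith) hβ (Or.inl ⟨?_, ho⟩)) (key 0 (by omega))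
    exact_mod_cast h
  · have h₁ := shiftValue_exchange (A := a * z - b * o) (B := a + b) (own := own) hβ
      haB h1 k (l - (o - k)) (o - k) (by omega)
    rw [show l - (o - k) + (o - k) = l by omega, show k + (o - k) = o by omega] at h₁
    exact h₁.trans (max_le_max le_rfl (key _ (by omega)))

end Optimum

/-! ### The value found for a fixed target -/

/-- The contribution of an unshifted value at distance zero. -/
def gain (x : ℝ) : Sign → ℝ
  | .pos => x
  | .neg => 1 + (x + x)

/-- The negative of the contribution of an unshifted value at distance one. -/
def loss (x : ℝ) : Sign → ℝ
  | .pos => 1 + (x + x)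
  | .neg => x

section Target

variable (I : Input)

theorem output_objective (β total : ℝ) (moved : ℤ) :
    output I (objective β total moved) = total * Real.exp (-(β * moved)) := by
  simp [objective, Instr.result]

theorem steps_objective (β total : ℝ) (moved : ℤ) : steps I (objective β total moved) = 5 := by
  simp [objective, Instr.cost]

theorem output_natToReal (k : ℕ) : output I (natToReal k) = k := by
  simp [natToReal, Instr.result]

theorem steps_natToReal (k : ℕ) : steps I (natToReal k) = 2 := by
  simp [natToReal, Instr.cost]

/-- The test of the binary search for the number of further shifts. -/
noncomputable def farTest (β : ℝ) (D : DistTable) (k : ℕ) : Prog Bool := do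
  let K ← op (.addN (D.nZero + D.nOne) k)
  let K1 ← op (.addN K 1)
  let q ← op (.divR (← natToReal K) (← natToReal K1))
  let e ← objective β 1 (← kthDistance D K1)
  if ← op (.ltR q e) then pure false else pure true

/-- The number of further shifts that the binary search finds. -/
noncomputable def farShifts (β : ℝ) (D : DistTable) : ℕ :=
  output I (firstTrue (farTest β D) (D.n - (D.nZero + D.nOne)) 0 (D.n - (D.nZero + D.nOne)))

/-- For a fixed target, `bestAtTarget` finds the maximum over all numbers of shifts, as far as it is
positive. -/
theorem output_bestAtTarget (β x : ℝ) (sgn : Sign) (D₀ : Sorted) (t₀ t : ℤ) {l ds : List ℤ}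
    (h : IsDistTable l (output I (setTarget sgn D₀ t)) ds) (hx : 0 < x) (hβ : 0 < β)
    (h1 : ∀ y ∈ ds, 1 ≤ y) :
    (∀ k i, k ≤ (output I (setTarget sgn D₀ t)).nOne → i ≤ ds.length →
      shiftValue β (gain x sgn * (output I (setTarget sgn D₀ t)).nZero -
        loss x sgn * (output I (setTarget sgn D₀ t)).nOne) (gain x sgn + loss x sgn)
        (gain x sgn) ds |t₀ - t| k i ≤ max 0 (output I (bestAtTarget β x sgn D₀ t₀ t))) ∧
    ∃ k i, k ≤ (output I (setTarget sgn D₀ t)).nOne ∧ i ≤ ds.length ∧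
      output I (bestAtTarget β x sgn D₀ t₀ t) =
      shiftValue β (gain x sgn * (output I (setTarget sgn D₀ t)).nZero -
        loss x sgn * (output I (setTarget sgn D₀ t)).nOne) (gain x sgn + loss x sgn)
        (gain x sgn) ds |t₀ - t| k i := by
  set D := output I (setTarget sgn D₀ t) with hD
  set a := gain x sgn with ha
  set b := loss x sgn with hb
  have ha0 : 0 < a := by cases sgn <;> simp only [ha, gain] <;> linarith
  have hb0 : 0 < b := by cases sgn <;> simp only [hb, loss] <;> linarith
  have hout : output I (bestAtTarget β x sgn D₀ t₀ t) =
      if 1 / β - (a * D.nZero - b * D.nOne) / (a + b) < D.nOne then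
        max (shiftValue β (a * D.nZero - b * D.nOne) (a + b) a ds |t₀ - t|
            ⌊1 / β - (a * D.nZero - b * D.nOne) / (a + b)⌋₊ 0)
          (shiftValue β (a * D.nZero - b * D.nOne) (a + b) a ds |t₀ - t|
            ⌈1 / β - (a * D.nZero - b * D.nOne) / (a + b)⌉₊ 0)
      else
        a * (D.nZero + D.nOne + farShifts I β D : ℕ) * Real.exp (-(β *
          (output I (sumDistances D (D.nZero + D.nOne + farShifts I β D)) + |t₀ - t| : ℤ))) := by
    cases sgn <;>
    simp only [bestAtTarget, output_bind, output_op, Instr.result, ↓output_ite, output_maxR,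
      output_objective, output_natToReal, ← hD, decide_eq_true_eq, shiftValue, List.take_zero,
      List.sum_nil, add_zero, Nat.cast_zero, mul_zero, ha, hb, gain, loss] <;>
    rfl
  have hnear := h.near_eq
  have hlen := h.length_eq
  have hlr := h.left_le
  have hre := h.right_le
  have hfar : D.n - (D.nZero + D.nOne) = ds.length := by rw [h.n_eq]; omega
  rw [hout]
  split_ifs with hlt
  · refine ⟨fun k i hk hi => ?_, ?_⟩
    · exact shiftValue_le_of_lt (by linarith) hβ (by linarith) h1 k i hi
    · have hceil : ⌈1 / β - (a * D.nZero - b * D.nOne) / (a + b)⌉₊ ≤ D.nOne := Nat.ceil_le.2 hlt.le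
      rcases max_choice (shiftValue β (a * D.nZero - b * D.nOne) (a + b) a ds |t₀ - t|
            ⌊1 / β - (a * D.nZero - b * D.nOne) / (a + b)⌋₊ 0)
          (shiftValue β (a * D.nZero - b * D.nOne) (a + b) a ds |t₀ - t|
            ⌈1 / β - (a * D.nZero - b * D.nOne) / (a + b)⌉₊ 0) with hmax | hmax
      · exact ⟨_, 0, (Nat.floor_le_ceil _).trans hceil, Nat.zero_le _, hmax⟩
      · exact ⟨_, 0, hceil, Nat.zero_le _, hmax⟩
  · have hspec := firstTrue_spec I (farTest β D) (D.n - (D.nZero + D.nOne)) 0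
      (D.n - (D.nZero + D.nOne)) (Nat.zero_le _) (by omega)
    rw [← farShifts] at hspec
    obtain ⟨-, hm, hm₁, hm₂⟩ := hspec
    rw [hfar] at hm hm₁
    simp only [farTest, output_bind, output_op, Instr.result, ↓output_ite, output_pure,
      output_objective, output_natToReal, decide_eq_true_eq] at hm₁ hm₂
    set m := farShifts I β D
    have hval : a * (D.nZero + D.nOne + m : ℕ) * Real.exp (-(β *
          (output I (sumDistances D (D.nZero + D.nOne + m)) + |t₀ - t| : ℤ))) =
        shiftValue β (a * D.nZero - b * D.nOne) (a + b) a ds |t₀ - t| D.nOne m := by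
      rw [output_sumDistances h hm, shiftValue_all]
    rw [hval]
    refine ⟨fun k i hk hi => ?_, D.nOne, m, le_rfl, hm, rfl⟩
    refine shiftValue_le_of_le ha0 hb0 hβ h.ds_sorted h1 (not_lt.1 hlt) m ?_ ?_ hm k i hk hi
    · intro hmlt
      have := hm₁ hmlt
      rw [add_assoc (D.nZero + D.nOne), output_kthDistance h hmlt] at this
      by_contra! hcon
      rw [if_pos (by simpa [add_assoc] using hcon)] at this
      exact absurd this (by simp)
    · intro i hi hil
      have := hm₂ i hi (Nat.zero_le _)
      rw [add_assoc (D.nZero + D.nOne), output_kthDistance h hil] at this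
      by_contra! hcon
      rw [if_neg (by simpa [add_assoc] using hcon.le)] at this
      exact absurd this (by simp)

end Target

/-! ### Configurations with a fixed target -/

/-- The contribution of a value at offset `m` from the target: the difference of two consecutive
values of the unbiased estimator, or its negative. -/
noncomputable def contribution (x : ℝ) (sgn : Sign) (m : ℤ) : ℝ :=
  match sgn with
  | .pos => if m = 0 then -(1 + (x + x)) else if |m| = 1 then x else 0
  | .neg => if m = 0 then 1 + (x + x) else if |m| = 1 then -x else 0

/-- The offsets with a positive contribution. -/
def IsZero (sgn : Sign) (m : ℤ) : Prop :=
  match sgn with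
  | .pos => |m| = 1
  | .neg => m = 0

/-- The offsets with a negative contribution. -/
def IsOne (sgn : Sign) (m : ℤ) : Prop :=
  match sgn with
  | .pos => m = 0
  | .neg => |m| = 1

instance (sgn : Sign) : DecidablePred (IsZero sgn) := fun m => by
  cases sgn <;> (unfold IsZero; infer_instance)

instance (sgn : Sign) : DecidablePred (IsOne sgn) := fun m => by
  cases sgn <;> (unfold IsOne; infer_instance)

/-- The distance from an offset of absolute value at least two to the nearest offset with a
positive contribution. -/
def offsetDist (sgn : Sign) (m : ℤ) : ℤ :=
  match sgn with
  | .pos => |m| - 1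
  | .neg => |m|

/-- The value `T * exp (-β * D)` of a configuration, in which the target moves from `t₀` to `t` and
the values `c j` move to `c' j`: the total `T` of the contributions, discounted by the total
distance `D` of the movements. -/
noncomputable def configValue {ι : Type} (β x : ℝ) (J : Finset ι) (c : ι → ℤ) (t₀ : ℤ) (sgn : Sign)
    (t : ℤ) (c' : ι → ℤ) : ℝ :=
  (∑ j ∈ J, contribution x sgn (c' j - t)) *
    Real.exp (-(β * (∑ j ∈ J, |c' j - c j| + |t₀ - t| : ℤ)))

section Lists

theorem take_countP_lt {l : List ℤ} (hl : l.SortedLE) (y : ℤ) :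
    l.take (l.countP (· < y)) = l.filter (· < y) ∧
      l.drop (l.countP (· < y)) = l.filter (fun a => ¬ a < y) := by
  replace hl := hl.pairwise
  induction l with
  | nil => simp
  | cons a l ih =>
    rw [List.pairwise_cons] at hl
    by_cases ha : a < y
    · rw [List.countP_cons_of_pos (by simpa using ha)]
      simpa [ha] using ih hl.2
    · have h0 : ∀ b ∈ l, ¬ b < y := fun b hb => by have := hl.1 b hb; omega
      rw [List.countP_cons_of_neg (by simpa using ha), List.countP_eq_zero.2 (by simpa using h0)]
      simp only [List.take_zero, List.drop_zero]
      constructor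
      · symm
        rw [List.filter_eq_nil_iff]
        simpa [not_lt.1 ha] using h0
      · symm
        rw [List.filter_eq_self]
        simpa [not_lt.1 ha] using h0

theorem countP_lt_add_one (l : List ℤ) (y : ℤ) :
    l.countP (· < y + 1) = l.countP (· < y) + l.countP (· = y) := by
  induction l with
  | nil => simp
  | cons a l ih =>
    simp only [List.countP_cons, ih, decide_eq_true_eq]
    split_ifs <;> omega

/-- The four binary searches produce a distance table, and the counts of values at distance zero and
one are those of the offsets with positive and with negative contribution. -/
theorem setTarget_spec (I : Input) {l : List ℤ} (hl : l.SortedLE) (sgn : Sign) (t : ℤ) :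
    IsDistTable l (output I (setTarget sgn (sortedOf l) t))
      (((l.filter fun a => 2 ≤ |a - t|).map fun a => offsetDist sgn (a - t)).mergeSort (· ≤ ·)) ∧
    (output I (setTarget sgn (sortedOf l) t)).nZero = l.countP (fun a => IsZero sgn (a - t)) ∧
    (output I (setTarget sgn (sortedOf l) t)).nOne = l.countP (fun a => IsOne sgn (a - t)) := by
  have hlb : ∀ y, output I (lowerBound (sortedOf l).p (sortedOf l).n y) = l.countP (· < y) :=
    fun y => output_lowerBound I hl y
  have e₁ : l.countP (· < t) = l.countP (· < t - 1) + l.countP (· = t - 1) := by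
    simpa using countP_lt_add_one l (t - 1)
  have e₂ := countP_lt_add_one l t
  have e₃ : l.countP (· < t + 2) = l.countP (· < t + 1) + l.countP (· = t + 1) := by
    simpa [add_assoc] using countP_lt_add_one l (t + 1)
  have e₄ : l.countP (fun a => |a - t| = 1) = l.countP (· = t - 1) + l.countP (· = t + 1) := by
    clear hl hlb e₁ e₂ e₃
    induction l with
    | nil => simp
    | cons a l ih =>
      simp only [List.countP_cons, ih, decide_eq_true_eq]
      have : |a - t| = 1 ↔ a = t - 1 ∨ a = t + 1 := by
        rw [abs_eq one_pos.le]; omega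
      simp only [this]
      split_ifs <;> omega
  have e₅ : l.countP (fun a => a - t = 0) = l.countP (· = t) := by
    simp only [sub_eq_zero]
  have hfar : ∀ f g : ℤ → ℤ, (∀ a, a < t - 1 → f a = offsetDist sgn (a - t)) →
      (∀ a, ¬ a < t + 2 → g a = offsetDist sgn (a - t)) →
      ((l.filter fun a => 2 ≤ |a - t|).map fun a => offsetDist sgn (a - t)).Perm
        ((l.take (l.countP (· < t - 1))).map f ++ (l.drop (l.countP (· < t + 2))).map g) := by
    intro f g hf hg
    rw [(take_countP_lt hl _).1, (take_countP_lt hl _).2]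
    have h₁ : (l.filter (· < t - 1)).map f =
        (l.filter (· < t - 1)).map fun a => offsetDist sgn (a - t) :=
      List.map_congr_left fun a ha => hf a (by simpa using (List.mem_filter.1 ha).2)
    have h₂ : (l.filter (fun a => ¬ a < t + 2)).map g =
        (l.filter (fun a => ¬ a < t + 2)).map fun a => offsetDist sgn (a - t) :=
      List.map_congr_left fun a ha => hg a (by simpa using (List.mem_filter.1 ha).2)
    rw [h₁, h₂, ← List.map_append]
    refine List.Perm.map _ ?_
    refine (List.filter_append_perm (fun a => decide (a < t)) _).symm.trans ?_
    rw [List.filter_filter, List.filter_filter]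
    refine List.Perm.of_eq (congrArg₂ _ (List.filter_congr fun a _ => ?_)
      (List.filter_congr fun a _ => ?_))
    · rw [← Bool.decide_and, decide_eq_decide, le_abs]
      omega
    · rw [← decide_not, ← Bool.decide_and, decide_eq_decide, le_abs]
      omega
  have hnn : ∀ y ∈ (((l.filter fun a => 2 ≤ |a - t|).map
      fun a => offsetDist sgn (a - t)).mergeSort (· ≤ ·)), 0 ≤ y := by
    intro y hy
    rw [(List.mergeSort_perm _ _).mem_iff] at hy
    obtain ⟨a, ha, rfl⟩ := List.mem_map.1 hy
    have : 2 ≤ |a - t| := by simpa using (List.mem_filter.1 ha).2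
    cases sgn <;> simp only [offsetDist] <;> omega
  have hle : l.countP (· < t + 2) ≤ l.length := List.countP_le_length
  cases sgn
  · simp only [setTarget, output_bind, output_op, Instr.result, output_pure, hlb]
    refine ⟨⟨hl, rfl, ?_, hle, ?_, List.sortedLE_mergeSort, ?_, hnn⟩, ?_, ?_⟩
    · change l.countP (· < t - 1) ≤ l.countP (· < t + 2)
      omega
    · simp only
      omega
    · refine (List.mergeSort_perm _ _).trans (hfar _ _ (fun a ha => ?_) fun a ha => ?_)
      · simp only [offsetDist]
        rw [abs_of_neg (by omega)]
        omega
      · simp only [offsetDist]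
        rw [abs_of_pos (by omega)]
        omega
    · simp only [IsZero]
      omega
    · simp only [IsOne]
      omega
  · simp only [setTarget, output_bind, output_op, Instr.result, output_pure, hlb]
    refine ⟨⟨hl, rfl, ?_, hle, ?_, List.sortedLE_mergeSort, ?_, hnn⟩, ?_, ?_⟩
    · change l.countP (· < t - 1) ≤ l.countP (· < t + 2)
      omega
    · simp only
      omega
    · refine (List.mergeSort_perm _ _).trans (hfar _ _ (fun a ha => ?_) fun a ha => ?_)
      · simp only [offsetDist]
        rw [abs_of_neg (by omega)]
        omega
      · simp only [offsetDist]
        rw [abs_of_pos (by omega)]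
    · simp only [IsZero]
      omega
    · simp only [IsOne]
      omega

/-- The first entries of a sorted list have the least sum among all parts of the same size. -/
theorem sum_take_le_of_sublist {l' ds : List ℤ} (hds : ds.SortedLE) (h : l'.Sublist ds) :
    (ds.take l'.length).sum ≤ l'.sum := by
  replace hds := hds.pairwise
  induction h with
  | slnil => simp
  | @cons l' ds a h ih =>
    rw [List.pairwise_cons] at hds
    refine le_trans ?_ (ih hds.2)
    rcases hn : l'.length with _ | n
    · simp
    · have hlen := h.length_le
      have hn' : n < ds.length := by omega
      rw [List.take_succ_cons, List.sum_cons, List.sum_take_succ _ _ hn']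
      have := hds.1 _ (List.getElem_mem hn')
      omega
  | @cons_cons l' ds a h ih =>
    rw [List.pairwise_cons] at hds
    simpa using ih hds.2

end Lists

section Configurations

variable {ι : Type} {J : Finset ι} {c : ι → ℤ} {l : List ℤ}

theorem countP_eq_card (h : l.Perm (J.toList.map c)) (p : ℤ → Prop) [DecidablePred p] :
    l.countP (fun a => p a) = (J.filter fun j => p (c j)).card := by
  rw [h.countP_eq, List.countP_map, List.countP_eq_length_filter, ← Finset.length_toList]
  refine List.Perm.length_eq ?_
  rw [← Multiset.coe_eq_coe, Finset.coe_toList, Finset.filter_val, ← Finset.coe_toList J,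
    Multiset.filter_coe]
  rfl

theorem dists_perm (h : l.Perm (J.toList.map c)) (sgn : Sign) (t : ℤ) :
    (((l.filter fun a => 2 ≤ |a - t|).map fun a => offsetDist sgn (a - t)).mergeSort (· ≤ ·)).Perm
      ((J.filter fun j => 2 ≤ |c j - t|).toList.map fun j => offsetDist sgn (c j - t)) := by
  refine (List.mergeSort_perm _ _).trans ?_
  refine ((h.filter _).map _).trans ?_
  rw [List.filter_map, List.map_map]
  refine List.Perm.map _ ?_
  rw [← Multiset.coe_eq_coe, Finset.coe_toList, Finset.filter_val, ← Finset.coe_toList J,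
    Multiset.filter_coe]
  rfl

theorem sum_take_le_sum {K L : Finset ι} {f : ι → ℤ} {ds : List ℤ} (hds : ds.SortedLE)
    (hp : ds.Perm (K.toList.map f)) (hL : L ⊆ K) : (ds.take L.card).sum ≤ ∑ j ∈ L, f j := by
  have hsub : (L.toList.map f).mergeSort (· ≤ ·) |>.Sublist ds := by
    refine List.sublist_of_subperm_of_sortedLE ?_ List.sortedLE_mergeSort hds
    refine ((List.mergeSort_perm _ _).subperm_right).2 ?_ |>.trans hp.symm.subperm
    rw [← Multiset.coe_le, ← Multiset.map_coe, ← Multiset.map_coe, Finset.coe_toList,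
      Finset.coe_toList]
    exact Multiset.map_le_map (Finset.val_le_iff.2 hL)
  have := sum_take_le_of_sublist hds hsub
  rw [(List.mergeSort_perm _ _).length_eq, (List.mergeSort_perm _ _).sum_eq, List.length_map,
    Finset.length_toList, Finset.sum_map_toList] at this
  exact this

/-- The bound of `sum_take_le_sum` is attained. -/
theorem exists_subset_sum_take [DecidableEq ι] {K : Finset ι} {f : ι → ℤ} {ds : List ℤ}
    (hds : ds.SortedLE) (hp : ds.Perm (K.toList.map f)) {i : ℕ} (hi : i ≤ ds.length) :
    ∃ L ⊆ K, L.card = i ∧ ∑ j ∈ L, f j = (ds.take i).sum := by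
  set E := K.toList.mergeSort (fun a b => decide (f a ≤ f b)) with hE
  have hEp : E.Perm K.toList := List.mergeSort_perm _ _
  have hEs : (E.map f).SortedLE := by
    refine List.sortedLE_iff_pairwise.2 (List.pairwise_map.2 ?_)
    have := List.pairwise_mergeSort (le := fun a b => decide (f a ≤ f b))
      (fun a b c => by simpa using le_trans) (fun a b => by simpa using le_total _ _) K.toList
    simpa using this
  have hEd : E.map f = ds := List.Perm.eq_of_sortedLE hEs hds ((hEp.map f).trans hp.symm)
  have hnd : (E.take i).Nodup :=
    ((hEp.nodup_iff.2 K.nodup_toList).sublist (List.take_sublist _ _))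
  refine ⟨(E.take i).toFinset, fun j hj => ?_, ?_, ?_⟩
  · have := List.mem_of_mem_take (List.mem_toFinset.1 hj)
    simpa using hEp.mem_iff.1 this
  · rw [List.toFinset_card_of_nodup hnd, List.length_take]
    have := congrArg List.length hEd
    simp at this
    omega
  · rw [← hEd, ← List.map_take, List.sum_toFinset _ hnd]

theorem contribution_le_gain {x : ℝ} (hx : 0 < x) (sgn : Sign) (m : ℤ) :
    contribution x sgn m ≤ gain x sgn := by
  cases sgn <;> simp only [contribution, gain] <;> split_ifs <;> linarith

theorem contribution_of_isZero {x : ℝ} {sgn : Sign} {m : ℤ} (h : IsZero sgn m) :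
    contribution x sgn m = gain x sgn := by
  cases sgn <;> simp only [contribution, gain, IsZero] at h ⊢
  · rw [if_neg (by rintro rfl; simp at h), if_pos h]
  · rw [if_pos h]

theorem contribution_of_isOne {x : ℝ} {sgn : Sign} {m : ℤ} (h : IsOne sgn m) :
    contribution x sgn m = -loss x sgn := by
  cases sgn <;> simp only [contribution, loss, IsOne] at h ⊢
  · rw [if_pos h]
  · rw [if_neg (by rintro rfl; simp at h), if_pos h]

theorem contribution_of_far {x : ℝ} {sgn : Sign} {m : ℤ} (h : 2 ≤ |m|) :
    contribution x sgn m = 0 := by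
  have h0 : m ≠ 0 := by rintro rfl; simp at h
  have h1 : |m| ≠ 1 := by omega
  cases sgn <;> simp [contribution, h0, h1]

theorem isZero_of_contribution_pos {x : ℝ} (hx : 0 < x) {sgn : Sign} {m : ℤ}
    (h : 0 < contribution x sgn m) : IsZero sgn m := by
  cases sgn <;> simp only [contribution, IsZero] at h ⊢ <;> split_ifs at h <;>
    first | assumption | linarith

theorem offsetDist_le {sgn : Sign} {m m' : ℤ} (hm' : IsZero sgn m') :
    offsetDist sgn m ≤ |m' - m| := by
  have := abs_sub_abs_le_abs_sub m m'
  rw [abs_sub_comm] at this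
  cases sgn <;> simp only [offsetDist, IsZero] at hm' ⊢
  · omega
  · subst hm'; simp

/-- Every offset has a positive, a negative or a vanishing contribution; the last are those of
absolute value at least two. -/
theorem trichotomy_offset (sgn : Sign) (m : ℤ) :
    (IsZero sgn m ∧ ¬ IsOne sgn m ∧ ¬ 2 ≤ |m|) ∨ (¬ IsZero sgn m ∧ IsOne sgn m ∧ ¬ 2 ≤ |m|) ∨
      (¬ IsZero sgn m ∧ ¬ IsOne sgn m ∧ 2 ≤ |m|) := by
  have h0 : |m| = 0 ↔ m = 0 := abs_eq_zero
  have := abs_nonneg m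
  cases sgn <;> simp only [IsZero, IsOne] <;> omega

/-- The nearest offset with a positive contribution. -/
def nearestZero (sgn : Sign) (m : ℤ) : ℤ :=
  match sgn with
  | .pos => if m ≤ 0 then -1 else 1
  | .neg => 0

theorem isZero_nearestZero (sgn : Sign) (m : ℤ) : IsZero sgn (nearestZero sgn m) := by
  cases sgn <;> simp only [IsZero, nearestZero]
  split_ifs <;> simp

theorem abs_nearestZero_sub_of_isOne {sgn : Sign} {m : ℤ} (h : IsOne sgn m) :
    |nearestZero sgn m - m| = 1 := by
  cases sgn <;> simp only [IsOne, nearestZero] at h ⊢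
  · subst h; simp
  · simpa using h

theorem abs_nearestZero_sub {sgn : Sign} {m : ℤ} (h : m ≠ 0) :
    |nearestZero sgn m - m| = offsetDist sgn m := by
  cases sgn <;> simp only [offsetDist, nearestZero]
  · rcases lt_or_gt_of_ne h with h | h
    · rw [if_pos h.le, abs_of_nonneg (by omega), abs_of_neg h]
      omega
    · rw [if_neg (by omega), abs_of_nonpos (by omega), abs_of_pos h]
      omega
  · simp

variable [DecidableEq ι]

/-- The total contribution when the values in `K` are shifted from distance one and the values in
`L` from larger distances, each to an offset with a positive contribution. -/
theorem sum_indicators (sgn : Sign) (t : ℤ) (a b : ℝ) {K L : Finset ι} (hK : K ⊆ J) (hL : L ⊆ J) :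
    ∑ j ∈ J, (a * (if IsZero sgn (c j - t) then 1 else 0) -
        b * (if IsOne sgn (c j - t) then 1 else 0) + (a + b) * (if j ∈ K then 1 else 0) +
        a * (if j ∈ L then 1 else 0)) =
      a * (J.filter fun j => IsZero sgn (c j - t)).card -
        b * (J.filter fun j => IsOne sgn (c j - t)).card + (a + b) * K.card + a * L.card := by
  rw [Finset.sum_add_distrib, Finset.sum_add_distrib, Finset.sum_sub_distrib, ← Finset.mul_sum,
    ← Finset.mul_sum, ← Finset.mul_sum, ← Finset.mul_sum, Finset.sum_boole, Finset.sum_boole,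
    Finset.sum_boole, Finset.sum_boole, Finset.filter_mem_eq_inter, Finset.filter_mem_eq_inter,
    Finset.inter_eq_right.2 hK, Finset.inter_eq_right.2 hL]

/-- An arbitrary configuration with the target `t` is dominated by one that shifts only as many
values as it does from distance one and from larger distances, and among the latter the closest
ones. -/
theorem configValue_le_bestAtTarget (I : Input) {β x : ℝ} (hβ : 0 < β) (hx : 0 < x)
    (hl : l.SortedLE) (hp : l.Perm (J.toList.map c)) (t₀ t : ℤ) (sgn : Sign) (c' : ι → ℤ) :
    configValue β x J c t₀ sgn t c' ≤
      max 0 (output I (bestAtTarget β x sgn (sortedOf l) t₀ t)) := by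
  obtain ⟨hT, hZ, hO⟩ := setTarget_spec I hl sgn t
  have hd := dists_perm hp sgn t
  set ds := ((l.filter fun a => 2 ≤ |a - t|).map fun a => offsetDist sgn (a - t)).mergeSort (· ≤ ·)
  have h1 : ∀ y ∈ ds, 1 ≤ y := by
    intro y hy
    rw [hd.mem_iff] at hy
    obtain ⟨j, hj, rfl⟩ := List.mem_map.1 hy
    simp only [Finset.mem_toList, Finset.mem_filter] at hj
    cases sgn <;> simp only [offsetDist] <;> omega
  have hup := (output_bestAtTarget I β x sgn (sortedOf l) t₀ t hT hx hβ h1).1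
  rw [hZ, hO, countP_eq_card hp (fun a => IsZero sgn (a - t)),
    countP_eq_card hp (fun a => IsOne sgn (a - t))] at hup
  -- the values shifted from distance one, and the remaining values that contribute
  set K := J.filter fun j => IsOne sgn (c j - t) ∧ c' j ≠ c j with hK
  set L := J.filter fun j => 2 ≤ |c j - t| ∧ IsZero sgn (c' j - t) with hL
  have hLF : L ⊆ J.filter fun j => 2 ≤ |c j - t| := by
    intro j hj
    simp only [hL, Finset.mem_filter] at hj ⊢
    tauto
  have hlen : L.card ≤ ds.length := by
    rw [hd.length_eq, List.length_map, Finset.length_toList]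
    exact Finset.card_le_card hLF
  have hKJ : K ⊆ J := Finset.filter_subset _ _
  have hLJ : L ⊆ J := Finset.filter_subset _ _
  have hKO : K ⊆ J.filter fun j => IsOne sgn (c j - t) := by
    intro j hj
    simp only [hK, Finset.mem_filter] at hj ⊢
    tauto
  -- compared termwise: a value that is in neither set contributes no more than it does unshifted
  have htot : ∑ j ∈ J, contribution x sgn (c' j - t) ≤ _ :=
    (Finset.sum_le_sum fun j hj => ?_).trans
      (sum_indicators (c := c) sgn t (gain x sgn) (loss x sgn) hKJ hLJ).le
  swap
  · have hg := contribution_le_gain hx sgn (c' j - t)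
    have hnp : ¬ IsZero sgn (c' j - t) → contribution x sgn (c' j - t) ≤ 0 := fun h => by
      by_contra! h'
      exact h (isZero_of_contribution_pos hx h')
    have hK' : j ∈ K ↔ IsOne sgn (c j - t) ∧ c' j ≠ c j := by simp [hK, hj]
    have hL' : j ∈ L ↔ 2 ≤ |c j - t| ∧ IsZero sgn (c' j - t) := by simp [hL, hj]
    simp only [hK', hL']
    rcases trichotomy_offset sgn (c j - t) with ⟨h₁, h₂, h₃⟩ | ⟨h₁, h₂, h₃⟩ | ⟨h₁, h₂, h₃⟩
    · simpa [h₁, h₂, h₃] using hg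
    · by_cases hc : c' j = c j
      · rw [hc, contribution_of_isOne h₂]
        simp [h₁, h₂, h₃]
      · simpa [h₁, h₂, h₃, hc] using hg
    · by_cases hc : IsZero sgn (c' j - t)
      · simpa [h₁, h₂, h₃, hc] using hg
      · simpa [h₁, h₂, h₃, hc] using hnp hc
  have hcost : (K.card : ℤ) + (ds.take L.card).sum ≤ ∑ j ∈ J, |c' j - c j| := by
    have hdisj : Disjoint K L := by
      rw [Finset.disjoint_left]
      intro j hj hj'
      simp only [hK, hL, Finset.mem_filter] at hj hj'
      rcases trichotomy_offset sgn (c j - t) with ⟨h₁, h₂, h₃⟩ | ⟨h₁, h₂, h₃⟩ | ⟨h₁, h₂, h₃⟩ <;>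
        tauto
    calc (K.card : ℤ) + (ds.take L.card).sum
        ≤ ∑ j ∈ K, |c' j - c j| + ∑ j ∈ L, |c' j - c j| := by
          refine add_le_add ?_ ((sum_take_le_sum hT.ds_sorted hd hLF).trans
            (Finset.sum_le_sum fun j hj => ?_))
          · rw [Finset.card_eq_sum_ones, Nat.cast_sum]
            refine Finset.sum_le_sum fun j hj => ?_
            simp only [hK, Finset.mem_filter] at hj
            have := abs_pos.2 (sub_ne_zero.2 hj.2.2)
            push_cast
            omega
          · simp only [hL, Finset.mem_filter] at hj
            simpa using offsetDist_le (m := c j - t) hj.2.2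
      _ = ∑ j ∈ K ∪ L, |c' j - c j| := (Finset.sum_union hdisj).symm
      _ ≤ ∑ j ∈ J, |c' j - c j| := Finset.sum_le_sum_of_subset_of_nonneg
          (Finset.union_subset hKJ hLJ) fun j _ _ => abs_nonneg _
  rcases le_or_gt (∑ j ∈ J, contribution x sgn (c' j - t)) 0 with h0 | h0
  · exact le_max_of_le_left (mul_nonpos_of_nonpos_of_nonneg h0 (Real.exp_pos _).le)
  · refine le_trans ?_ (hup K.card L.card (Finset.card_le_card hKO) hlen)
    refine mul_le_mul htot ?_ (Real.exp_pos _).le (h0.le.trans htot)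
    refine Real.exp_le_exp.2 (neg_le_neg (mul_le_mul_of_nonneg_left (Int.cast_le.2 ?_) hβ.le))
    omega

/-- The value that the algorithm finds for a target is that of a configuration, even where it is
negative. -/
theorem bestAtTarget_eq_configValue (I : Input) {β x : ℝ} (hβ : 0 < β) (hx : 0 < x)
    (hl : l.SortedLE) (hp : l.Perm (J.toList.map c)) (t₀ t : ℤ) (sgn : Sign) :
    ∃ c', output I (bestAtTarget β x sgn (sortedOf l) t₀ t) =
      configValue β x J c t₀ sgn t c' := by
  obtain ⟨hT, hZ, hO⟩ := setTarget_spec I hl sgn t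
  have hd := dists_perm hp sgn t
  set ds := ((l.filter fun a => 2 ≤ |a - t|).map fun a => offsetDist sgn (a - t)).mergeSort (· ≤ ·)
  have h1 : ∀ y ∈ ds, 1 ≤ y := by
    intro y hy
    rw [hd.mem_iff] at hy
    obtain ⟨j, hj, rfl⟩ := List.mem_map.1 hy
    simp only [Finset.mem_toList, Finset.mem_filter] at hj
    cases sgn <;> simp only [offsetDist] <;> omega
  obtain ⟨k, i, hk, hi, hki⟩ :=
    (output_bestAtTarget I β x sgn (sortedOf l) t₀ t hT hx hβ h1).2
  rw [hZ, hO, countP_eq_card hp (fun a => IsZero sgn (a - t)),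
    countP_eq_card hp (fun a => IsOne sgn (a - t))] at hki
  rw [hO, countP_eq_card hp (fun a => IsOne sgn (a - t))] at hk
  obtain ⟨K, hKO, rfl⟩ := Finset.exists_subset_card_eq hk
  obtain ⟨L, hLF, rfl, hLsum⟩ := exists_subset_sum_take hT.ds_sorted hd hi
  have hKJ : K ⊆ J := hKO.trans (Finset.filter_subset _ _)
  have hLJ : L ⊆ J := hLF.trans (Finset.filter_subset _ _)
  have hK1 : ∀ j ∈ K, IsOne sgn (c j - t) := fun j hj => (Finset.mem_filter.1 (hKO hj)).2
  have hL2 : ∀ j ∈ L, 2 ≤ |c j - t| := fun j hj => (Finset.mem_filter.1 (hLF hj)).2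
  have hdisj : Disjoint K L := by
    rw [Finset.disjoint_left]
    intro j hj hj'
    have := hK1 j hj
    have := hL2 j hj'
    rcases trichotomy_offset sgn (c j - t) with ⟨h₁, h₂, h₃⟩ | ⟨h₁, h₂, h₃⟩ | ⟨h₁, h₂, h₃⟩ <;>
      tauto
  -- the selected values move to the nearest offset with a positive contribution
  set c' : ι → ℤ := fun j => if j ∈ K ∪ L then t + nearestZero sgn (c j - t) else c j with hc'
  have hin : ∀ j ∈ K ∪ L, c' j = t + nearestZero sgn (c j - t) := fun j hj => by
    simp only [hc', if_pos hj]
  have hout : ∀ j, j ∉ K ∪ L → c' j = c j := fun j hj => by simp only [hc', if_neg hj]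
  refine ⟨c', hki.trans ?_⟩
  have htot : ∑ j ∈ J, contribution x sgn (c' j - t) = _ :=
    (Finset.sum_congr rfl fun j hj => ?_).trans
      (sum_indicators (c := c) sgn t (gain x sgn) (loss x sgn) hKJ hLJ)
  swap
  · by_cases hj' : j ∈ K ∪ L
    · rw [hin j hj', add_sub_cancel_left, contribution_of_isZero (isZero_nearestZero _ _)]
      rcases Finset.mem_union.1 hj' with hjK | hjL
      · have hnL : j ∉ L := Finset.disjoint_left.1 hdisj hjK
        have := hK1 j hjK
        rcases trichotomy_offset sgn (c j - t) with ⟨h₁, h₂, h₃⟩ | ⟨h₁, h₂, h₃⟩ | ⟨h₁, h₂, h₃⟩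
        · tauto
        · simp [hjK, hnL, h₁, h₂]
        · tauto
      · have hnK : j ∉ K := Finset.disjoint_right.1 hdisj hjL
        have := hL2 j hjL
        rcases trichotomy_offset sgn (c j - t) with ⟨h₁, h₂, h₃⟩ | ⟨h₁, h₂, h₃⟩ | ⟨h₁, h₂, h₃⟩
        · tauto
        · tauto
        · simp [hnK, hjL, h₁, h₂]
    · rw [hout j hj']
      rw [Finset.mem_union, not_or] at hj'
      rcases trichotomy_offset sgn (c j - t) with ⟨h₁, h₂, h₃⟩ | ⟨h₁, h₂, h₃⟩ | ⟨h₁, h₂, h₃⟩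
      · simp [hj'.1, hj'.2, h₁, h₂, contribution_of_isZero h₁]
      · simp [hj'.1, hj'.2, h₁, h₂, contribution_of_isOne h₂]
      · simp [hj'.1, hj'.2, h₁, h₂, contribution_of_far h₃]
  have hcost : ∑ j ∈ J, |c' j - c j| = (K.card : ℤ) + (ds.take L.card).sum := by
    rw [← hLsum, ← Finset.sum_subset (Finset.union_subset hKJ hLJ) fun j _ hj => by
      rw [hout j hj]; simp, Finset.sum_union hdisj]
    congr 1
    · rw [Finset.card_eq_sum_ones, Nat.cast_sum]
      refine Finset.sum_congr rfl fun j hj => ?_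
      rw [hin j (Finset.mem_union_left _ hj), Nat.cast_one,
        ← abs_nearestZero_sub_of_isOne (hK1 j hj)]
      congr 1
      ring
    · refine Finset.sum_congr rfl fun j hj => ?_
      have h2 := hL2 j hj
      rw [hin j (Finset.mem_union_right _ hj),
        ← abs_nearestZero_sub fun h => by rw [h] at h2; simp at h2]
      congr 1
      ring
  rw [shiftValue, configValue, htot, hcost]

end Configurations

/-! ### Reduction to the candidate targets -/

section Reduction

variable {ι : Type} {β x : ℝ} {J : Finset ι} {c : ι → ℤ} {t₀ : ℤ}

/-- The targets that the algorithm tries. -/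
def IsCandidate (J : Finset ι) (c : ι → ℤ) (t₀ t : ℤ) : Prop :=
  t = t₀ ∨ ∃ j ∈ J, t = c j - 1 ∨ t = c j ∨ t = c j + 1

/-- Some configuration with a candidate target has at least the value `V`. -/
def CandidateReaches (β x : ℝ) (J : Finset ι) (c : ι → ℤ) (t₀ : ℤ) (V : ℝ) : Prop :=
  ∃ sgn t c', IsCandidate J c t₀ t ∧ V ≤ configValue β x J c t₀ sgn t c'

/-- The cost of moving the values in `L` to the nearest offsets with a positive contribution. -/
def moveCost (c : ι → ℤ) (t₀ : ℤ) (sgn : Sign) (t : ℤ) (L : Finset ι) : ℤ :=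
  ∑ j ∈ L, |nearestZero sgn (c j - t) - (c j - t)| + |t₀ - t|

/-- The configuration that moves the values in `L` to the nearest offsets with a positive
contribution and leaves all others in place. -/
theorem exists_configValue_eq [DecidableEq ι] (β x : ℝ) (t₀ : ℤ) (sgn : Sign) (t : ℤ) {L : Finset ι}
    (hL : L ⊆ J) :
    ∃ c', configValue β x J c t₀ sgn t c' =
      (gain x sgn * L.card + ∑ j ∈ J \ L, contribution x sgn (c j - t)) *
        Real.exp (-(β * (moveCost c t₀ sgn t L : ℤ))) := by
  refine ⟨fun j => if j ∈ L then t + nearestZero sgn (c j - t) else c j, ?_⟩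
  rw [configValue, moveCost]
  congr 1
  · rw [← Finset.sum_sdiff hL, add_comm]
    congr 1
    · rw [Finset.sum_congr rfl fun j hj => by
        rw [if_pos hj, add_sub_cancel_left, contribution_of_isZero (isZero_nearestZero _ _)]]
      simp [mul_comm]
    · exact Finset.sum_congr rfl fun j hj => by rw [if_neg (Finset.mem_sdiff.1 hj).2]
  · congr 5
    rw [← Finset.sum_sdiff hL, Finset.sum_eq_zero fun j hj => by
      rw [if_neg (Finset.mem_sdiff.1 hj).2]; simp, zero_add]
    exact Finset.sum_congr rfl fun j hj => by
      rw [if_pos hj]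
      congr 1
      ring

theorem moveCost_nonneg (c : ι → ℤ) (t₀ : ℤ) (sgn : Sign) (t : ℤ) (L : Finset ι) :
    0 ≤ moveCost c t₀ sgn t L :=
  add_nonneg (Finset.sum_nonneg fun _ _ => abs_nonneg _) (abs_nonneg _)

theorem abs_sub_one_eq {m s : ℤ} (hm : m ≠ 0) (hs : s = 1 ∨ s = -1) :
    |m - s| = |m| - s * m.sign := by
  rcases lt_or_gt_of_ne hm with h | h
  · rw [Int.sign_eq_neg_one_of_neg h, abs_of_neg h]
    rcases hs with rfl | rfl
    · rw [abs_of_neg (by omega)]; ring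
    · rw [abs_of_nonpos (by omega)]; ring
  · rw [Int.sign_eq_one_of_pos h, abs_of_pos h]
    rcases hs with rfl | rfl
    · rw [abs_of_nonneg (by omega)]; ring
    · rw [abs_of_pos (by omega)]; ring

/-- Away from the candidates, the cost is a linear function of the target. -/
theorem moveCost_add {sgn : Sign} {t s : ℤ} {L : Finset ι} (hs : s = 1 ∨ s = -1)
    (hL : ∀ j ∈ L, 2 ≤ |c j - t|) (ht : t ≠ t₀) :
    moveCost c t₀ sgn (t + s) L =
      moveCost c t₀ sgn t L - s * (∑ j ∈ L, (c j - t).sign + (t₀ - t).sign) := by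
  have h₀ : t₀ - t ≠ 0 := fun h => ht (by omega)
  have key : ∑ j ∈ L, |nearestZero sgn (c j - (t + s)) - (c j - (t + s))| =
      ∑ j ∈ L, |nearestZero sgn (c j - t) - (c j - t)| - s * ∑ j ∈ L, (c j - t).sign := by
    rw [Finset.mul_sum, ← Finset.sum_sub_distrib]
    refine Finset.sum_congr rfl fun j hj => ?_
    have h := hL j hj
    have h₁ : c j - t ≠ 0 := fun h' => by rw [h'] at h; simp at h
    have h₂ : c j - (t + s) ≠ 0 := fun h' => by
      have : c j - t = s := by omega
      rw [this] at h
      rcases hs with rfl | rfl <;> simp at h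
    rw [abs_nearestZero_sub h₁, abs_nearestZero_sub h₂]
    have := abs_sub_one_eq h₁ hs
    rw [sub_sub] at this
    cases sgn <;> simp only [offsetDist] <;> omega
  rw [moveCost, moveCost, key, ← sub_sub, abs_sub_one_eq h₀ hs]
  ring

theorem two_le_of_not_isCandidate {t : ℤ} (h : ¬ IsCandidate J c t₀ t) :
    t ≠ t₀ ∧ ∀ j ∈ J, 2 ≤ |c j - t| := by
  refine ⟨fun h' => h (Or.inl h'), fun j hj => ?_⟩
  by_contra! h'
  rw [abs_lt] at h'
  exact h (Or.inr ⟨j, hj, by omega⟩)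

theorem gain_pos (hx : 0 < x) (sgn : Sign) : 0 < gain x sgn := by
  cases sgn <;> simp only [gain] <;> linarith

/-- If the target can move by one without increasing the cost, and no value outside `L` then has a
negative contribution, the question is reduced to the new target. -/
theorem candidateReaches_of_move [DecidableEq ι] (hβ : 0 < β) (hx : 0 < x) {sgn : Sign} {t s : ℤ}
    {L : Finset ι} (hLJ : L ⊆ J)
    (hfree : ∀ j ∈ J \ L, 0 ≤ contribution x sgn (c j - (t + s)))
    (hcost : moveCost c t₀ sgn (t + s) L ≤ moveCost c t₀ sgn t L)
    (ih : ¬ IsCandidate J c t₀ (t + s) → CandidateReaches β x J c t₀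
      (gain x sgn * L.card * Real.exp (-(β * (moveCost c t₀ sgn (t + s) L : ℤ))))) :
    CandidateReaches β x J c t₀
      (gain x sgn * L.card * Real.exp (-(β * (moveCost c t₀ sgn t L : ℤ)))) := by
  have ha := gain_pos hx sgn
  have hexp : Real.exp (-(β * (moveCost c t₀ sgn t L : ℤ))) ≤
      Real.exp (-(β * (moveCost c t₀ sgn (t + s) L : ℤ))) :=
    Real.exp_le_exp.2 (neg_le_neg (mul_le_mul_of_nonneg_left (Int.cast_le.2 hcost) hβ.le))
  by_cases hcand : IsCandidate J c t₀ (t + s)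
  · obtain ⟨c', hc'⟩ := exists_configValue_eq (c := c) β x t₀ sgn (t + s) hLJ
    refine ⟨sgn, t + s, c', hcand, ?_⟩
    rw [hc']
    have := Finset.sum_nonneg hfree
    gcongr
    linarith
  · obtain ⟨sgn', t', c', h₁, h₂⟩ := ih hcand
    refine ⟨sgn', t', c', h₁, le_trans ?_ h₂⟩
    gcongr

/-- The values at the offset `2 * s` from the target. -/
def side (J : Finset ι) (c : ι → ℤ) (t s : ℤ) : Finset ι := J.filter fun j => c j = t + 2 * s

theorem contribution_of_abs_eq_one {m : ℤ} (h : |m| = 1) :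
    contribution x .pos m = x ∧ contribution x .neg m = -x := by
  have : m ≠ 0 := by rintro rfl; simp at h
  simp [contribution, this, h]

theorem sum_contribution_side [DecidableEq ι] {t s : ℤ} (hs : s = 1 ∨ s = -1)
    (hJ : ∀ j ∈ J, 2 ≤ |c j - t|)
    (sgn : Sign) (S : Finset ι) :
    ∑ j ∈ J \ S, contribution x sgn (c j - (t + s)) =
      contribution x sgn 1 * (side J c t s \ S).card := by
  have hsub : side J c t s \ S ⊆ J \ S :=
    Finset.sdiff_subset_sdiff (Finset.filter_subset _ _) le_rfl
  rw [← Finset.sum_subset hsub]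
  · rw [Finset.sum_congr rfl (g := fun _ => contribution x sgn 1), Finset.sum_const, nsmul_eq_mul,
      mul_comm]
    intro j hj
    have : c j = t + 2 * s := (Finset.mem_filter.1 (Finset.mem_sdiff.1 hj).1).2
    rw [this, show t + 2 * s - (t + s) = s by ring]
    rcases hs with rfl | rfl
    · rfl
    · cases sgn <;> simp [contribution]
  · intro j hj hj'
    rw [Finset.mem_sdiff] at hj hj'
    have h2 := hJ j hj.1
    have hne : c j ≠ t + 2 * s := fun h => hj' ⟨Finset.mem_filter.2 ⟨hj.1, h⟩, hj.2⟩
    apply contribution_of_far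
    rw [le_abs] at h2 ⊢
    rcases hs with rfl | rfl <;> omega

theorem isCandidate_of_mem_side {t s : ℤ} (hs : s = 1 ∨ s = -1) {j : ι} (hj : j ∈ side J c t s) :
    IsCandidate J c t₀ (t + s) := by
  obtain ⟨h₁, h₂⟩ := Finset.mem_filter.1 hj
  exact Or.inr ⟨j, h₁, by rcases hs with rfl | rfl <;> omega⟩

/-- The positive problem at the neighbouring target: all values of the side contribute. -/
theorem candidateReaches_pos [DecidableEq ι] {t s : ℤ} (hs : s = 1 ∨ s = -1)
    (hJ : ∀ j ∈ J, 2 ≤ |c j - t|) (hne : (side J c t s).Nonempty) :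
    CandidateReaches β x J c t₀
      (x * (side J c t s).card * Real.exp (-(β * (|t₀ - (t + s)| : ℤ)))) := by
  obtain ⟨j, hj⟩ := hne
  obtain ⟨c', hc'⟩ := exists_configValue_eq (c := c) β x t₀ .pos (t + s) (Finset.empty_subset J)
  refine ⟨.pos, t + s, c', isCandidate_of_mem_side hs hj, ?_⟩
  rw [hc', sum_contribution_side hs hJ]
  simp [moveCost, (contribution_of_abs_eq_one (x := x) (m := 1) (by simp)).1]

/-- The negative problem at the neighbouring target, with `k` shifts of values of the side and `m`
shifts of values of the opposite side. -/
theorem candidateReaches_neg [DecidableEq ι] {t s : ℤ} (hs : s = 1 ∨ s = -1)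
    (hJ : ∀ j ∈ J, 2 ≤ |c j - t|) (hne : (side J c t s).Nonempty) {k m : ℕ}
    (hk : k ≤ (side J c t s).card) (hm : m ≤ (side J c t (-s)).card) :
    CandidateReaches β x J c t₀
      ((gain x .neg * (k + m) - x * ((side J c t s).card - k)) * Real.exp (-β) ^ (k + 3 * m) *
        Real.exp (-(β * (|t₀ - (t + s)| : ℤ)))) := by
  obtain ⟨j, hj⟩ := hne
  obtain ⟨K, hK, rfl⟩ := Finset.exists_subset_card_eq hk
  obtain ⟨M, hM, rfl⟩ := Finset.exists_subset_card_eq hm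
  have hdisj : Disjoint (side J c t s) M := by
    rw [Finset.disjoint_left]
    intro i hi hi'
    have h₁ := (Finset.mem_filter.1 hi).2
    have h₂ := (Finset.mem_filter.1 (hM hi')).2
    rcases hs with rfl | rfl <;> omega
  have hKM : Disjoint K M := hdisj.mono_left hK
  have hsub : K ∪ M ⊆ J := Finset.union_subset (hK.trans (Finset.filter_subset _ _))
    (hM.trans (Finset.filter_subset _ _))
  obtain ⟨c', hc'⟩ := exists_configValue_eq (c := c) β x t₀ .neg (t + s) hsub
  refine ⟨.neg, t + s, c', isCandidate_of_mem_side hs hj, ?_⟩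
  have hcost : moveCost c t₀ .neg (t + s) (K ∪ M) =
      ((K.card + 3 * M.card : ℕ) : ℤ) + |t₀ - (t + s)| := by
    rw [moveCost, Finset.sum_union hKM, Finset.sum_congr rfl (g := fun _ => (1 : ℤ)),
      Finset.sum_congr (s₁ := M) rfl (g := fun _ => (3 : ℤ))]
    · simp [mul_comm]
    · intro i hi
      rw [(Finset.mem_filter.1 (hM hi)).2, nearestZero]
      rcases hs with rfl | rfl
      · ring_nf; simp
      · ring_nf; simp
    · intro i hi
      rw [(Finset.mem_filter.1 (hK hi)).2, nearestZero]
      rcases hs with rfl | rfl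
      · ring_nf; simp
      · ring_nf; simp
  rw [hc', sum_contribution_side hs hJ, hcost,
    (contribution_of_abs_eq_one (x := x) (m := 1) (by simp)).2, Finset.card_union_of_disjoint hKM,
    Finset.sdiff_union_distrib, Finset.sdiff_eq_self_of_disjoint hdisj,
    Finset.inter_eq_left.2 Finset.sdiff_subset, Finset.card_sdiff_of_subset hK,
    Nat.cast_sub (Finset.card_le_card hK), mul_assoc, ← Real.exp_nat_mul, ← Real.exp_add]
  push_cast
  refine le_of_eq ?_
  congr 1
  · ring
  · congr 1
    ring

/-- The trade-off between the two problems at the neighbouring target: if `p ≥ 2 l` values are at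
distance one from it, either the positive problem profits from all of them, or the negative problem
from shifting `l` or `2 l` of them. If `x p < a l q ^ 3`, so that the positive problem may fail, the
`p` values cost the negative problem little: shifting `2 l` of them suffices if
`q (2 - q ^ 3) ≥ 1`, and shifting `l` of them if `1 - q ^ 3 ≥ q`. The value `q = 3 / 5` lies in
both ranges. -/
theorem exists_good_shift {a x q : ℝ} {l p : ℕ} (ha : 0 < a) (hx : 0 < x) (hq : 0 < q) (hq1 : q < 1)
    (hl : 2 ≤ l) (hp : 2 * l ≤ p) :
    a * l * q ^ (2 * l - 1) ≤ x * p ∨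
      ∃ k, k ≤ p ∧ a * l * q ^ (2 * l - 1) ≤ (a * k - x * (p - k)) * q ^ k := by
  by_contra! h
  obtain ⟨h₁, h₂⟩ := h
  have hpow : q ^ (2 * l - 1) ≤ q ^ 3 := pow_le_pow_of_le_one hq.le hq1.le (by omega)
  have hal : 0 < a * l := by positivity
  have hl0 : (0 : ℝ) < l := by positivity
  have hxp : x * p < a * l * q ^ 3 := h₁.trans_le (mul_le_mul_of_nonneg_left hpow hal.le)
  rcases le_total (3 / 5) q with hc | hc
  · have h := h₂ (2 * l) hp
    rw [show q ^ (2 * l) = q ^ (2 * l - 1) * q by rw [← pow_succ]; congr 1; omega,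
      ← mul_assoc, mul_right_comm _ _ q] at h
    have h' := lt_of_mul_lt_mul_right h (by positivity)
    -- `q (2 - q ^ 3) - 1` is `(1 - q) (q + q ^ 2 + q ^ 3 - 1)`
    have hfac : 0 ≤ q + q ^ 2 + q ^ 3 - 1 := by
      nlinarith [sq_nonneg q, mul_nonneg hq.le (sq_nonneg q),
        mul_nonneg hq.le (sub_nonneg.2 hc)]
    have h3 : 1 ≤ q * (2 - q ^ 3) := by nlinarith [mul_nonneg (sub_nonneg.2 hq1.le) hfac]
    push_cast at h'
    have h4 : a * l * (2 - q ^ 3) ≤ a * (2 * l) - x * (p - 2 * l) := by nlinarith [mul_pos hx hl0]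
    nlinarith [mul_le_mul_of_nonneg_right h4 hq.le]
  · have h := h₂ l (by omega)
    have e : q ^ (2 * l - 1) ≤ q ^ l * q := by
      rw [← pow_succ]; exact pow_le_pow_of_le_one hq.le hq1.le (by omega)
    have h3 : q ≤ 1 - q ^ 3 := by
      have : q ^ 3 ≤ (3 / 5) ^ 3 := by gcongr
      norm_num at this
      linarith
    have h4 : a * l * (1 - q ^ 3) ≤ a * l - x * (p - l) := by nlinarith [mul_pos hx hl0]
    have h5 : a * l * q * q ^ l ≤ (a * l - x * (p - l)) * q ^ l := by
      refine mul_le_mul_of_nonneg_right (le_trans ?_ h4) (by positivity)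
      exact mul_le_mul_of_nonneg_left h3 hal.le
    have h6 := mul_le_mul_of_nonneg_left e hal.le
    nlinarith

theorem CandidateReaches.mono {V W : ℝ} (h : CandidateReaches β x J c t₀ W) (hV : V ≤ W) :
    CandidateReaches β x J c t₀ V := by
  obtain ⟨sgn, t, c', h₁, h₂⟩ := h
  exact ⟨sgn, t, c', h₁, hV.trans h₂⟩

theorem contribution_pos_nonneg (hx : 0 < x) {m : ℤ} (hm : m ≠ 0) : 0 ≤ contribution x .pos m := by
  rw [contribution, if_neg hm]
  split_ifs <;> linarith

/-- If no value outside `L` obstructs the moves of the target by one, then one of the two moves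
does not increase the cost, because the cost is linear there. The move towards `t₀` is preferred;
the move away from it is used only if it lowers the cost. So `2 * cost + |t₀ - t|` decreases. -/
theorem candidateReaches_of_free [DecidableEq ι] (hβ : 0 < β) (hx : 0 < x) {sgn : Sign} {t : ℤ}
    {L : Finset ι} (hLJ : L ⊆ J) (ht : ¬ IsCandidate J c t₀ t)
    (hfree : ∀ s : ℤ, s = 1 ∨ s = -1 → ∀ j ∈ J \ L, 0 ≤ contribution x sgn (c j - (t + s)))
    (ih : ∀ t', 2 * moveCost c t₀ sgn t' L + |t₀ - t'| < 2 * moveCost c t₀ sgn t L + |t₀ - t| →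
      ¬ IsCandidate J c t₀ t' → CandidateReaches β x J c t₀
        (gain x sgn * L.card * Real.exp (-(β * (moveCost c t₀ sgn t' L : ℤ))))) :
    CandidateReaches β x J c t₀
      (gain x sgn * L.card * Real.exp (-(β * (moveCost c t₀ sgn t L : ℤ)))) := by
  obtain ⟨ht₀, hJ⟩ := two_le_of_not_isCandidate ht
  have h₀ : t₀ - t ≠ 0 := fun h => ht₀ (by omega)
  have hs : (t₀ - t).sign = 1 ∨ (t₀ - t).sign = -1 := by
    rcases lt_or_gt_of_ne h₀ with h | h
    · exact Or.inr (Int.sign_eq_neg_one_of_neg h)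
    · exact Or.inl (Int.sign_eq_one_of_pos h)
  have hs' : -(t₀ - t).sign = 1 ∨ -(t₀ - t).sign = -1 := by omega
  have hss : (t₀ - t).sign * (t₀ - t).sign = 1 := by rcases hs with h | h <;> rw [h] <;> rfl
  have e₁ := moveCost_add (c := c) (sgn := sgn) hs (fun j hj => hJ j (hLJ hj)) ht₀
  have e₂ := moveCost_add (c := c) (sgn := sgn) hs' (fun j hj => hJ j (hLJ hj)) ht₀
  have o₁ := abs_sub_one_eq h₀ hs
  have o₂ := abs_sub_one_eq h₀ hs'
  rw [sub_sub] at o₁ o₂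
  set s := (t₀ - t).sign
  set σ := ∑ j ∈ L, (c j - t).sign + s
  rw [neg_mul] at e₂ o₂
  rcases le_or_gt 0 (s * σ) with hle | hlt
  · refine candidateReaches_of_move (s := s) hβ hx hLJ (hfree s hs) (by omega) fun h => ih _ ?_ h
    omega
  · refine candidateReaches_of_move (s := -s) hβ hx hLJ (hfree (-s) hs') (by omega)
      fun h => ih _ ?_ h
    omega

/-- In the negative problem, values just outside a neighbouring target would cause a loss there.
If at least two values are shifted to `t`, all of them from distance two, and a further value has
distance two, then one of the neighbouring targets is nevertheless as good. -/
theorem candidateReaches_of_two_le [DecidableEq ι] (hβ : 0 < β) (hx : 0 < x) {t : ℤ} {l : ℕ}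
    (hJ : ∀ j ∈ J, 2 ≤ |c j - t|) (hl : 2 ≤ l)
    (hsides : l + 1 ≤ (side J c t 1).card + (side J c t (-1)).card) :
    CandidateReaches β x J c t₀
      (gain x .neg * l * Real.exp (-(β * (2 * l + |t₀ - t| : ℤ)))) := by
  obtain ⟨s, hs, hps, hsum⟩ : ∃ s : ℤ, (s = 1 ∨ s = -1) ∧ l + 1 ≤ 2 * (side J c t s).card ∧
      l + 1 ≤ (side J c t s).card + (side J c t (-s)).card := by
    rcases le_total (side J c t 1).card (side J c t (-1)).card with h | h
    · exact ⟨-1, Or.inr rfl, by omega, by rw [neg_neg]; omega⟩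
    · exact ⟨1, Or.inl rfl, by omega, hsides⟩
  set p := (side J c t s).card with hp
  have hne : (side J c t s).Nonempty := Finset.card_pos.1 (by omega)
  have ha := gain_pos hx .neg
  set a := gain x .neg
  set q := Real.exp (-β) with hq
  have hq0 : 0 < q := Real.exp_pos _
  have hq1 : q < 1 := Real.exp_lt_one_iff.2 (by linarith)
  set E := Real.exp (-(β * (|t₀ - (t + s)| : ℤ))) with hE
  have hE0 : 0 < E := Real.exp_pos _
  have hown : |t₀ - (t + s)| ≤ |t₀ - t| + 1 := by
    have := abs_sub (t₀ - t) s
    rw [sub_sub] at this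
    rcases hs with rfl | rfl <;> simpa using this
  -- the target moves by one, so the cost without the shifts grows by at most one
  have hV : a * l * Real.exp (-(β * (2 * l + |t₀ - t| : ℤ))) ≤ a * l * q ^ (2 * l - 1) * E := by
    rw [mul_assoc (a * l), hq, hE, ← Real.exp_nat_mul, ← Real.exp_add]
    refine mul_le_mul_of_nonneg_left (Real.exp_le_exp.2 ?_) (by positivity)
    have : ((2 * l - 1 : ℕ) : ℤ) + |t₀ - (t + s)| ≤ 2 * l + |t₀ - t| := by omega
    have h' := mul_le_mul_of_nonneg_left (Int.cast_le (R := ℝ) |>.2 this) hβ.le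
    rw [Int.cast_add _ (|t₀ - (t + s)|), Int.cast_natCast] at h'
    linarith
  rcases lt_or_ge p l with hpl | hpl
  · -- all values of the side and some of the opposite side
    refine (candidateReaches_neg (k := p) (m := l - p) hs hJ hne le_rfl (by omega)).mono
      (hV.trans ?_)
    refine mul_le_mul_of_nonneg_right ?_ hE0.le
    rw [Nat.cast_sub hpl.le, ← hp, sub_self, mul_zero, sub_zero, add_sub_cancel]
    exact mul_le_mul_of_nonneg_left (pow_le_pow_of_le_one hq0.le hq1.le (by omega)) (by positivity)
  rcases lt_or_ge p (2 * l) with hpl' | hpl'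
  · -- all values of the side
    refine (candidateReaches_neg (k := p) (m := 0) hs hJ hne le_rfl (Nat.zero_le _)).mono
      (hV.trans ?_)
    refine mul_le_mul_of_nonneg_right ?_ hE0.le
    rw [← hp, sub_self, mul_zero, sub_zero, Nat.cast_zero, add_zero]
    refine mul_le_mul ?_ (pow_le_pow_of_le_one hq0.le hq1.le (by omega)) (by positivity)
      (by positivity)
    gcongr
  · rcases exists_good_shift ha hx hq0 hq1 hl hpl' with h | ⟨k, hk, h⟩
    · exact (candidateReaches_pos hs hJ hne).mono
        (hV.trans (mul_le_mul_of_nonneg_right h hE0.le))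
    · refine (candidateReaches_neg (k := k) (m := 0) hs hJ hne hk (Nat.zero_le _)).mono
        (hV.trans (mul_le_mul_of_nonneg_right ?_ hE0.le))
      simpa using h

/-- The same if a single value is shifted to `t` and the side towards `t₀` is not empty. -/
theorem candidateReaches_of_single [DecidableEq ι] (hβ : 0 < β) (hx : 0 < x) {t s : ℤ}
    (hs : s = 1 ∨ s = -1) (hJ : ∀ j ∈ J, 2 ≤ |c j - t|) (hne : (side J c t s).Nonempty)
    (hown : |t₀ - (t + s)| + 1 = |t₀ - t|) :
    CandidateReaches β x J c t₀ (gain x .neg * Real.exp (-(β * (2 + |t₀ - t| : ℤ)))) := by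
  set p := (side J c t s).card with hp
  have hp0 : 1 ≤ p := Finset.card_pos.2 hne
  have ha := gain_pos hx .neg
  set a := gain x .neg
  set q := Real.exp (-β) with hq
  have hq0 : 0 < q := Real.exp_pos _
  have hq1 : q < 1 := Real.exp_lt_one_iff.2 (by linarith)
  set E := Real.exp (-(β * (|t₀ - (t + s)| : ℤ))) with hE
  have hE0 : 0 < E := Real.exp_pos _
  have hV : a * Real.exp (-(β * (2 + |t₀ - t| : ℤ))) = a * q ^ 3 * E := by
    rw [mul_assoc a, hq, hE, ← Real.exp_nat_mul, ← Real.exp_add, ← hown]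
    congr 2
    push_cast
    ring
  have hq3 : q ^ 3 ≤ q := by simpa using pow_le_pow_of_le_one hq0.le hq1.le (show 1 ≤ 3 by omega)
  have hq2 : q ^ 3 ≤ q ^ 2 := pow_le_pow_of_le_one hq0.le hq1.le (by omega)
  rcases hp0.eq_or_lt with h1 | h1
  · refine (candidateReaches_neg (k := 1) (m := 0) hs hJ hne hp0 (Nat.zero_le _)).mono
      (hV.le.trans (mul_le_mul_of_nonneg_right ?_ hE0.le))
    rw [← hp, ← h1]
    simpa using mul_le_mul_of_nonneg_left hq3 ha.le
  · rcases le_or_gt (a * q ^ 3) (x * p) with h | h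
    · exact (candidateReaches_pos hs hJ hne).mono
        (hV.le.trans (mul_le_mul_of_nonneg_right h hE0.le))
    · refine (candidateReaches_neg (k := 2) (m := 0) hs hJ hne h1 (Nat.zero_le _)).mono
        (hV.le.trans (mul_le_mul_of_nonneg_right ?_ hE0.le))
      rw [← hp]
      simp only [mul_zero, add_zero, Nat.cast_zero, Nat.cast_ofNat]
      have : q ^ 3 ≤ 1 := pow_le_one₀ hq0.le hq1.le
      refine mul_le_mul ?_ hq2 (by positivity) ?_ <;> nlinarith

/-- Shifting the values in `L` to a target that is no candidate is not better than the best
configuration with a candidate target. The proof is by induction on `2 * cost + |t₀ - t|`. In the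
positive problem the target moves freely. In the negative problem the values at distance two from
the target that are not shifted obstruct the moves: either they replace more distant values in `L`,
or all values in `L` are at distance two as well, and the problem is solved at a neighbouring
target. -/
theorem candidateReaches_of_subset [DecidableEq ι] (hβ : 0 < β) (hx : 0 < x) (sgn : Sign) (n : ℕ) :
    ∀ (t : ℤ) (L : Finset ι), L ⊆ J → L.Nonempty → ¬ IsCandidate J c t₀ t →
      2 * moveCost c t₀ sgn t L + |t₀ - t| < n →
      CandidateReaches β x J c t₀
        (gain x sgn * L.card * Real.exp (-(β * (moveCost c t₀ sgn t L : ℤ)))) := by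
  induction n with
  | zero =>
    intro t L _ _ _ h
    have := moveCost_nonneg c t₀ sgn t L
    have := abs_nonneg (t₀ - t)
    push_cast at h
    omega
  | succ n ih =>
    intro t L hLJ hLne ht hn
    push_cast at hn
    obtain ⟨ht₀, hJ⟩ := two_le_of_not_isCandidate ht
    have hfree := candidateReaches_of_free (sgn := sgn) hβ hx hLJ ht
    have ihfree : ∀ t', 2 * moveCost c t₀ sgn t' L + |t₀ - t'| <
        2 * moveCost c t₀ sgn t L + |t₀ - t| → ¬ IsCandidate J c t₀ t' →
        CandidateReaches β x J c t₀
          (gain x sgn * L.card * Real.exp (-(β * (moveCost c t₀ sgn t' L : ℤ)))) :=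
      fun t' h' hc => ih t' L hLJ hLne hc (by omega)
    cases sgn
    · refine hfree (fun s hs j hj => contribution_pos_nonneg hx fun h => ?_) ihfree
      have := hJ j (Finset.mem_sdiff.1 hj).1
      rw [show c j - t = s by omega] at this
      rcases hs with rfl | rfl <;> simp at this
    · by_cases h3 : ∀ j ∈ J \ L, 3 ≤ |c j - t|
      · refine hfree (fun s hs j hj => (contribution_of_far ?_).ge) ihfree
        have := h3 j hj
        rw [le_abs] at this ⊢
        rcases hs with rfl | rfl <;> omega
      push Not at h3
      obtain ⟨j, hj, hj3⟩ := h3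
      obtain ⟨hjJ, hjL⟩ := Finset.mem_sdiff.1 hj
      by_cases h2 : ∃ i ∈ L, 3 ≤ |c i - t|
      · -- shift the closer value `j` instead of `i`
        obtain ⟨i, hi, hi3⟩ := h2
        have hjE : j ∉ L.erase i := fun h => hjL (Finset.mem_of_mem_erase h)
        have hcard : (insert j (L.erase i)).card = L.card := by
          rw [Finset.card_insert_of_notMem hjE, Finset.card_erase_add_one hi]
        have hcost : moveCost c t₀ .neg t (insert j (L.erase i)) < moveCost c t₀ .neg t L := by
          rw [moveCost, moveCost, Finset.sum_insert hjE, ← Finset.add_sum_erase L _ hi]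
          simp only [nearestZero, zero_sub, abs_neg]
          omega
        have := ih t (insert j (L.erase i))
          (Finset.insert_subset hjJ ((Finset.erase_subset _ _).trans hLJ))
          (Finset.insert_nonempty _ _) ht (by omega)
        rw [hcard] at this
        refine this.mono ?_
        have ha := gain_pos hx .neg
        gcongr
      · push Not at h2
        have hmem : ∀ i ∈ J, |c i - t| < 3 → i ∈ side J c t 1 ∪ side J c t (-1) := by
          intro i hi hi3
          have h₁ := hJ i hi
          have h₂ : |c i - t| = 2 := by omega
          rw [abs_eq (by norm_num)] at h₂
          rw [Finset.mem_union, side, side, Finset.mem_filter, Finset.mem_filter]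
          rcases h₂ with h₂ | h₂
          · exact Or.inl ⟨hi, by omega⟩
          · exact Or.inr ⟨hi, by omega⟩
        have hsides : L.card + 1 ≤ (side J c t 1).card + (side J c t (-1)).card := by
          rw [← Finset.card_insert_of_notMem hjL]
          refine (Finset.card_le_card ?_).trans (Finset.card_union_le _ _)
          intro i hi
          rcases Finset.mem_insert.1 hi with rfl | hi
          · exact hmem i hjJ hj3
          · exact hmem i (hLJ hi) (h2 i hi)
        have hcost : moveCost c t₀ .neg t L = 2 * L.card + |t₀ - t| := by
          rw [moveCost, Finset.sum_congr rfl (g := fun _ => (2 : ℤ))]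
          · simp [mul_comm]
          · intro i hi
            have h₁ := hJ i (hLJ hi)
            have h₂ := h2 i hi
            simp only [nearestZero, zero_sub, abs_neg]
            omega
        rcases lt_or_ge 1 L.card with h1 | h1
        · rw [hcost]
          exact candidateReaches_of_two_le hβ hx hJ h1 hsides
        have h1 : L.card = 1 := le_antisymm h1 (Finset.card_pos.2 hLne)
        have h₀ : t₀ - t ≠ 0 := fun h => ht₀ (by omega)
        have hs : (t₀ - t).sign = 1 ∨ (t₀ - t).sign = -1 := by
          rcases lt_or_gt_of_ne h₀ with h | h
          · exact Or.inr (Int.sign_eq_neg_one_of_neg h)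
          · exact Or.inl (Int.sign_eq_one_of_pos h)
        have hss : (t₀ - t).sign * (t₀ - t).sign = 1 := by
          rcases hs with h | h <;> rw [h] <;> rfl
        have hown := abs_sub_one_eq h₀ hs
        rw [hss, sub_sub] at hown
        have hadd := moveCost_add (c := c) (sgn := .neg) hs (fun j hj => hJ j (hLJ hj)) ht₀
        set s := (t₀ - t).sign
        rcases (side J c t s).eq_empty_or_nonempty with he | hne
        · -- no value lies on the side towards `t₀`
          have hnot : ∀ i ∈ J, c i ≠ t + 2 * s := by
            intro i hi h
            have : i ∈ side J c t s := Finset.mem_filter.2 ⟨hi, h⟩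
            simp [he] at this
          have hcost' : moveCost c t₀ .neg (t + s) L ≤ moveCost c t₀ .neg t L := by
            obtain ⟨i, rfl⟩ := Finset.card_eq_one.1 h1
            have hi := hJ i (hLJ (by simp))
            have hi' := hnot i (hLJ (by simp))
            have hi'' := h2 i (by simp)
            rw [hadd, Finset.sum_singleton, mul_add, hss]
            have : -1 ≤ s * (c i - t).sign := by
              rcases hs with hs | hs <;> rcases Int.sign_trichotomy (c i - t) with h | h | h <;>
                rw [hs, h] <;> norm_num
            omega
          refine candidateReaches_of_move hβ hx hLJ (fun i hi => ?_) hcost' fun hc =>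
            ihfree _ (by omega) hc
          refine (contribution_of_far ?_).ge
          have h₁ := hJ i (Finset.mem_sdiff.1 hi).1
          have h₂ := hnot i (Finset.mem_sdiff.1 hi).1
          rw [le_abs] at h₁ ⊢
          rcases hs with hs | hs <;> omega
        · rw [hcost, h1]
          simpa using candidateReaches_of_single hβ hx hs hJ hne (by omega)

/-- It suffices to consider the candidate targets, provided that both signs are considered: for the
negative problem alone this is false. -/
theorem configValue_nonpos_or_candidateReaches [DecidableEq ι] (hβ : 0 < β) (hx : 0 < x)
    (sgn : Sign) (t : ℤ) (c' : ι → ℤ) :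
    configValue β x J c t₀ sgn t c' ≤ 0 ∨
      CandidateReaches β x J c t₀ (configValue β x J c t₀ sgn t c') := by
  by_cases ht : IsCandidate J c t₀ t
  · exact Or.inr ⟨sgn, t, c', ht, le_rfl⟩
  obtain ⟨ht₀, hJ⟩ := two_le_of_not_isCandidate ht
  set L := J.filter fun j => 0 < contribution x sgn (c' j - t) with hL
  have hLJ : L ⊆ J := Finset.filter_subset _ _
  have ha := gain_pos hx sgn
  have htot : ∑ j ∈ J, contribution x sgn (c' j - t) ≤ gain x sgn * L.card := by
    rw [← Finset.sum_filter_add_sum_filter_not J fun j => 0 < contribution x sgn (c' j - t)]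
    have h₁ : ∑ j ∈ J with 0 < contribution x sgn (c' j - t), contribution x sgn (c' j - t) ≤
        gain x sgn * L.card := by
      rw [mul_comm, ← nsmul_eq_mul]
      exact Finset.sum_le_card_nsmul _ _ _ fun j _ => contribution_le_gain hx sgn _
    have h₂ : ∑ j ∈ J with ¬ 0 < contribution x sgn (c' j - t), contribution x sgn (c' j - t) ≤ 0 :=
      Finset.sum_nonpos fun j hj => not_lt.1 (Finset.mem_filter.1 hj).2
    linarith
  rcases L.eq_empty_or_nonempty with he | hne
  · left
    rw [he] at htot
    exact mul_nonpos_of_nonpos_of_nonneg (by simpa using htot) (Real.exp_pos _).le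
  · right
    refine (candidateReaches_of_subset hβ hx sgn
      (2 * moveCost c t₀ sgn t L + |t₀ - t| + 1).toNat t L hLJ hne ht ?_).mono ?_
    · have := moveCost_nonneg c t₀ sgn t L
      have := abs_nonneg (t₀ - t)
      omega
    · have hcost : moveCost c t₀ sgn t L ≤ ∑ j ∈ J, |c' j - c j| + |t₀ - t| := by
        refine add_le_add_left ?_ _
        refine le_trans (Finset.sum_le_sum fun j hj => ?_)
          (Finset.sum_le_sum_of_subset_of_nonneg hLJ fun j _ _ => abs_nonneg _)
        have h₁ : c j - t ≠ 0 := fun h => by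
          have := hJ j (hLJ hj)
          rw [h] at this
          simp at this
        rw [abs_nearestZero_sub h₁]
        simpa using offsetDist_le (m := c j - t)
          (isZero_of_contribution_pos hx (Finset.mem_filter.1 hj).2)
      refine mul_le_mul htot (Real.exp_le_exp.2 (neg_le_neg (mul_le_mul_of_nonneg_left
        (Int.cast_le.2 hcost) hβ.le))) (Real.exp_pos _).le (by positivity)

end Reduction

/-! ### The result and the running time of the algorithm -/

section Algorithm

variable (I : Input)

theorem lowerBound_le (a : Array ℤ) (n : ℕ) (y : ℤ) : output I (lowerBound a n y) ≤ n :=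
  (firstTrue_spec I _ n 0 n (Nat.zero_le _) (by omega)).2.1

theorem left_setTarget_le (sgn : Sign) (D : Sorted) (t : ℤ) :
    (output I (setTarget sgn D t)).left ≤ D.n ∧ (output I (setTarget sgn D t)).n = D.n := by
  cases sgn <;>
  · simp only [setTarget, output_bind, output_pure, and_true]
    exact lowerBound_le I _ _ _

theorem steps_setTarget_le (sgn : Sign) (D : Sorted) (t : ℤ) (e : ℕ) (h : D.n < 2 ^ e) :
    steps I (setTarget sgn D t) ≤ 28 * e + 16 := by
  have hb : ∀ y, steps I (lowerBound D.p D.n y) ≤ e * 7 + 2 :=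
    fun y => steps_lowerBound_le I D.p D.n e y h
  cases sgn <;>
  · simp only [setTarget, steps_bind, steps_op, Instr.cost, steps_pure]
    grw [hb, hb, hb, hb]
    omega

theorem steps_farTest_le (β : ℝ) (D : DistTable) (k e : ℕ) (he : D.left < 2 ^ e) :
    steps I (farTest β D k) ≤ 15 * e + 33 := by
  simp only [farTest, steps_bind, steps_op, Instr.cost, ↓steps_ite, steps_pure, steps_natToReal,
    steps_objective, ite_self]
  grw [steps_kthDistance_le _ e he]
  omega

/-- The two nested binary searches account for the square. -/
theorem steps_bestAtTarget_le (β x : ℝ) (sgn : Sign) (D₀ : Sorted) (t₀ t : ℤ) (e : ℕ)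
    (h : D₀.n < 2 ^ e) : steps I (bestAtTarget β x sgn D₀ t₀ t) ≤ 150 * (e + 1) ^ 2 := by
  obtain ⟨hl, hn⟩ := left_setTarget_le I sgn D₀ t
  have hs := steps_setTarget_le I sgn D₀ t e h
  have he : (output I (setTarget sgn D₀ t)).left < 2 ^ e := by omega
  have hf : ∀ m ≤ D₀.n, steps I (firstTrue (farTest β (output I (setTarget sgn D₀ t))) m 0 m) ≤
      e * ((15 * e + 33) + 5) + 2 := fun m hm =>
    steps_firstTrue_le I _ _ (fun k => steps_farTest_le I β _ k e he) e m 0 m (by omega)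
  have hd : ∀ k, steps I (sumDistances (output I (setTarget sgn D₀ t)) k) ≤ e * 15 + 30 :=
    fun k => steps_sumDistances_le k e he
  have hsq : 150 * (e + 1) ^ 2 = 150 * (e * e) + 300 * e + 150 := by ring
  have hmul : e * ((15 * e + 33) + 5) = 15 * (e * e) + 38 * e := by ring
  have hf' := hf _ (show (output I (setTarget sgn D₀ t)).n -
    ((output I (setTarget sgn D₀ t)).nZero + (output I (setTarget sgn D₀ t)).nOne) ≤ D₀.n by omega)
  unfold farTest at hf'
  cases sgn <;>
  · simp only [bestAtTarget, steps_bind, steps_op, Instr.cost, ↓steps_ite, steps_maxR,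
      steps_objective, steps_natToReal, output_bind, output_op, Instr.result]
    split_ifs with hif
    · grw [hs]
      omega
    · clear hif
      generalize hA : steps I (firstTrue _ _ _ _) = A
      generalize hB : steps I (sumDistances _ _) = B
      have hA' : A ≤ e * ((15 * e + 33) + 5) + 2 := by rw [← hA]; exact hf'
      have hB' : B ≤ e * 15 + 30 := by rw [← hB]; exact hd _
      grw [hs, hA', hB', hmul, hsq]
      clear * -
      omega

theorem scanTargets_induction (β x : ℝ) (sgn : Sign) (D : Sorted) (t₀ : ℤ) {P : ℝ → Prop}
    (ts : List ℤ) (s : ℝ) (hs : P s)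
    (h : ∀ t ∈ ts, P (output I (bestAtTarget β x sgn D t₀ t))) :
    P (output I (scanTargets β x sgn D t₀ ts s)) := by
  induction ts generalizing s with
  | nil => simpa [scanTargets] using hs
  | cons t ts ih =>
    simp only [scanTargets, output_bind, output_maxR]
    refine ih _ ?_ fun t' ht' => h t' (List.mem_cons_of_mem _ ht')
    rcases max_choice s (output I (bestAtTarget β x sgn D t₀ t)) with hm | hm <;> rw [hm]
    · exact hs
    · exact h t List.mem_cons_self

theorem le_scanTargets (β x : ℝ) (sgn : Sign) (D : Sorted) (t₀ : ℤ) (ts : List ℤ) (s : ℝ) :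
    s ≤ output I (scanTargets β x sgn D t₀ ts s) ∧
      ∀ t ∈ ts, output I (bestAtTarget β x sgn D t₀ t) ≤
        output I (scanTargets β x sgn D t₀ ts s) := by
  induction ts generalizing s with
  | nil => simp [scanTargets]
  | cons t ts ih =>
    simp only [scanTargets, output_bind, output_maxR]
    obtain ⟨h₁, h₂⟩ := ih (max s (output I (bestAtTarget β x sgn D t₀ t)))
    refine ⟨(le_max_left _ _).trans h₁, fun t' ht' => ?_⟩
    rcases List.mem_cons.1 ht' with rfl | ht'
    · exact (le_max_right _ _).trans h₁
    · exact h₂ t' ht'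

theorem steps_scanTargets_le (β x : ℝ) (sgn : Sign) (D : Sorted) (t₀ : ℤ) (ts : List ℤ) (s : ℝ)
    (e : ℕ) (h : D.n < 2 ^ e) :
    steps I (scanTargets β x sgn D t₀ ts s) ≤ ts.length * (150 * (e + 1) ^ 2 + 2) := by
  induction ts generalizing s with
  | nil => simp [scanTargets]
  | cons t ts ih =>
    simp only [scanTargets, steps_bind, steps_op, Instr.cost, steps_maxR, List.length_cons,
      add_one_mul]
    grw [ih, steps_bestAtTarget_le I β x sgn D t₀ t e h]
    omega

theorem candidates_spec (acc l : List ℤ) :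
    (∀ t, t ∈ output I (candidates acc l) ↔
      t ∈ acc ∨ ∃ a ∈ l, t = a - 1 ∨ t = a ∨ t = a + 1) ∧
    (output I (candidates acc l)).length = 3 * l.length + acc.length ∧
    steps I (candidates acc l) = 6 * l.length := by
  induction l with
  | nil => simp [candidates]
  | cons a l ih =>
    obtain ⟨h₁, h₂, h₃⟩ := ih
    simp only [candidates, output_bind, output_op, Instr.result, steps_bind, steps_op, Instr.cost,
      List.length_cons, h₂, h₃, List.mem_cons, h₁]
    refine ⟨fun t => ?_, by omega, by omega⟩
    constructor
    · rintro (rfl | rfl | rfl | h | ⟨b, hb, h⟩)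
      · exact Or.inr ⟨_, Or.inl rfl, Or.inl rfl⟩
      · exact Or.inr ⟨_, Or.inl rfl, Or.inr (Or.inl rfl)⟩
      · exact Or.inr ⟨_, Or.inl rfl, Or.inr (Or.inr rfl)⟩
      · exact Or.inl h
      · exact Or.inr ⟨b, Or.inr hb, h⟩
    · rintro (h | ⟨b, rfl | hb, h⟩)
      · tauto
      · tauto
      · exact Or.inr (Or.inr (Or.inr (Or.inr ⟨b, hb, h⟩)))

variable {ι : Type} [DecidableEq ι] {J : Finset ι} {c : ι → ℤ} {l : List ℤ} {β x : ℝ}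

/-- The two scans together bound the values of all configurations that are positive, and their
result is `s` or one of these values. The last clause is stated with a predicate `P` so that it
passes through the loops unchanged. -/
theorem solveBoth_spec (hβ : 0 < β) (hx : 0 < x) (hl : l.SortedLE)
    (hp : l.Perm (J.toList.map c)) (t₀ : ℤ) (s : ℝ) :
    s ≤ output I (solveBoth β x l t₀ s) ∧
    (∀ sgn t c', configValue β x J c t₀ sgn t c' ≤ max 0 (output I (solveBoth β x l t₀ s))) ∧
    ∀ P : ℝ → Prop, P s → (∀ sgn t c', P (configValue β x J c t₀ sgn t c')) →
      P (output I (solveBoth β x l t₀ s)) := by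
  simp only [solveBoth, output_bind, output_op, Instr.result, output_buildSorted]
  set ts := output I (sort (output I (candidates [t₀] l))) with hts
  obtain ⟨h₁, h₂⟩ := le_scanTargets I β x .pos (sortedOf l) t₀ ts s
  obtain ⟨h₃, h₄⟩ := le_scanTargets I β x .neg (sortedOf l) t₀ ts
    (output I (scanTargets β x .pos (sortedOf l) t₀ ts s))
  refine ⟨h₁.trans h₃, fun sgn t c' => ?_, fun P hs hP => ?_⟩
  · rcases configValue_nonpos_or_candidateReaches (J := J) (c := c) (t₀ := t₀) hβ hx sgn t c' with
      h | ⟨sgn', t', c'', ht', h⟩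
    · exact le_max_of_le_left h
    · have hmem : t' ∈ ts := by
        rw [hts, (output_sort I _).1.mem_iff, (candidates_spec I _ _).1]
        rcases ht' with rfl | ⟨j, hj, h'⟩
        · simp
        · refine Or.inr ⟨c j, hp.mem_iff.2 (List.mem_map_of_mem (by simpa using hj)), h'⟩
      refine h.trans ((configValue_le_bestAtTarget I hβ hx hl hp t₀ t' sgn' c'').trans
        (max_le_max le_rfl ?_))
      cases sgn'
      · exact (h₂ t' hmem).trans h₃
      · exact h₄ t' hmem
  · have hbest : ∀ sgn t, P (output I (bestAtTarget β x sgn (sortedOf l) t₀ t)) := fun sgn t => by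
      obtain ⟨c', hc'⟩ := bestAtTarget_eq_configValue I hβ hx hl hp t₀ t sgn
      rw [hc']
      exact hP sgn t c'
    exact scanTargets_induction I β x .neg _ t₀ ts _
      (scanTargets_induction I β x .pos _ t₀ ts s hs fun t _ => hbest _ t) fun t _ => hbest _ t

theorem steps_solveBoth_le (t₀ : ℤ) (s : ℝ) (d e : ℕ) (hd : l.length ≤ d) (he : d < 2 ^ e) :
    steps I (solveBoth β x l t₀ s) ≤ 1000 * ((d + 1) * (e + 1) ^ 2) := by
  obtain ⟨-, hlen, hst⟩ := candidates_spec I [t₀] l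
  have hsort := steps_sort_le I (e + 2) (output I (candidates [t₀] l)) (by
    rw [hlen, pow_add]
    simp only [List.length_singleton]
    omega)
  have hts := (output_sort I (output I (candidates [t₀] l))).1.length_eq
  rw [hlen, List.length_singleton] at hsort hts
  have hn : (sortedOf l).n < 2 ^ e := by change l.length < 2 ^ e; omega
  simp only [solveBoth, steps_bind, steps_op, output_op, Instr.cost, Instr.result,
    output_buildSorted, steps_buildSorted, hst]
  grw [hsort, steps_scanTargets_le I β x .pos _ t₀ _ _ e hn,
    steps_scanTargets_le I β x .neg _ t₀ _ _ e hn, hts, hd]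
  nlinarith [Nat.zero_le (d * e), Nat.zero_le (d * e ^ 2), Nat.zero_le e, Nat.zero_le d]

theorem output_partialWeights (i d : ℕ) (acc : List ℤ) :
    output I (partialWeights i d acc) =
      ((List.range d).filter (I.assigned i)).map (fun j => I.weight j + I.noisy i j) ++ acc := by
  induction d generalizing acc with
  | zero => simp [partialWeights]
  | succ j ih =>
    simp only [partialWeights, output_bind, output_op, Instr.result, ↓output_ite, ih,
      List.range_succ, List.filter_append, List.map_append, List.append_assoc]
    split_ifs with h <;> simp [h]

theorem steps_partialWeights_le (i d : ℕ) (acc : List ℤ) :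
    steps I (partialWeights i d acc) ≤ 6 * d := by
  induction d generalizing acc with
  | zero => simp [partialWeights]
  | succ j ih =>
    simp only [partialWeights, steps_bind, steps_op, Instr.cost, ↓steps_ite]
    split_ifs <;> grw [ih] <;> omega

/-- The edges that lie in an assigned triangle with the edge `i`. -/
def partners (I : Input) (d i : ℕ) : Finset ℕ :=
  (Finset.range d).filter fun j => I.assigned i j = true

/-- The partial weight of the triangle formed by the edges `i` and `j`. -/
def partialWeight (I : Input) (i j : ℕ) : ℤ := I.weight j + I.noisy i j

theorem partialWeights_perm (d i : ℕ) :
    (output I (sort (output I (partialWeights i d [])))).Perm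
      ((partners I d i).toList.map (partialWeight I i)) := by
  refine (output_sort I _).1.trans ?_
  rw [output_partialWeights, List.append_nil]
  refine List.Perm.map (partialWeight I i) ?_
  rw [← Multiset.coe_eq_coe, Finset.coe_toList, partners, Finset.filter_val, Finset.range_val,
    Multiset.range, Multiset.filter_coe]
  simp

/-- The result of an iteration is at least all values of configurations of the edge `i` that are
positive, and shares every property that they have in common with the initial value. -/
theorem edgeStep_spec (hβ : 0 < β) (hx : 0 < x) (lam : ℤ) (d i : ℕ) (s : ℝ) :
    s ≤ output I (edgeStep β x lam d i s) ∧
    (∀ t₀, t₀ = lam - I.weight i - 1 ∨ t₀ = lam - I.weight i → ∀ sgn t c',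
      configValue β x (partners I d i) (partialWeight I i) t₀ sgn t c' ≤
        max 0 (output I (edgeStep β x lam d i s))) ∧
    ∀ P : ℝ → Prop, P s → (∀ t₀, t₀ = lam - I.weight i - 1 ∨ t₀ = lam - I.weight i →
      ∀ sgn t c', P (configValue β x (partners I d i) (partialWeight I i) t₀ sgn t c')) →
      P (output I (edgeStep β x lam d i s)) := by
  simp only [edgeStep, output_bind, output_op, Instr.result]
  have hp := partialWeights_perm I d i
  have hl := (output_sort I (output I (partialWeights i d []))).2
  set l := output I (sort (output I (partialWeights i d [])))
  obtain ⟨a₁, a₂, a₃⟩ := solveBoth_spec I hβ hx hl hp (lam - I.weight i - 1) s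
  obtain ⟨b₁, b₂, b₃⟩ := solveBoth_spec I hβ hx hl hp (lam - I.weight i)
    (output I (solveBoth β x l (lam - I.weight i - 1) s))
  refine ⟨a₁.trans b₁, ?_, fun P hs hP => ?_⟩
  · rintro t₀ (rfl | rfl) sgn t c'
    · exact (a₂ sgn t c').trans (max_le_max le_rfl b₁)
    · exact b₂ sgn t c'
  · exact b₃ P (a₃ P hs (hP _ (Or.inl rfl))) (hP _ (Or.inr rfl))

theorem steps_edgeStep_le (β x : ℝ) (lam : ℤ) (d i : ℕ) (s : ℝ) (e : ℕ) (he : d < 2 ^ e) :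
    steps I (edgeStep β x lam d i s) ≤ 2020 * ((d + 1) * (e + 1) ^ 2) := by
  have hlen : (output I (partialWeights i d [])).length ≤ d := by
    rw [output_partialWeights]
    simpa using List.length_filter_le (I.assigned i) (List.range d)
  have hlen' : (output I (sort (output I (partialWeights i d [])))).length ≤ d := by
    rwa [(output_sort I _).1.length_eq]
  simp only [edgeStep, steps_bind, steps_op, output_op, Instr.cost]
  grw [steps_partialWeights_le, steps_sort_le I e _ (by omega), hlen,
    steps_solveBoth_le I _ _ d e hlen' he, steps_solveBoth_le I _ _ d e hlen' he]
  nlinarith [Nat.zero_le (d * e), Nat.zero_le (d * e ^ 2), Nat.zero_le e, Nat.zero_le d]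

theorem edgeLoop_spec (hβ : 0 < β) (hx : 0 < x) (lam : ℤ) (d m : ℕ) (s : ℝ) :
    s ≤ output I (edgeLoop β x lam d m s) ∧
    (∀ i < m, ∀ t₀, t₀ = lam - I.weight i - 1 ∨ t₀ = lam - I.weight i → ∀ sgn t c',
      configValue β x (partners I d i) (partialWeight I i) t₀ sgn t c' ≤
        max 0 (output I (edgeLoop β x lam d m s))) ∧
    ∀ P : ℝ → Prop, P s → (∀ i < m, ∀ t₀, t₀ = lam - I.weight i - 1 ∨ t₀ = lam - I.weight i →
      ∀ sgn t c', P (configValue β x (partners I d i) (partialWeight I i) t₀ sgn t c')) →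
      P (output I (edgeLoop β x lam d m s)) := by
  induction m generalizing s with
  | zero => simp [edgeLoop]
  | succ m ih =>
    simp only [edgeLoop, output_bind]
    obtain ⟨a₁, a₂, a₃⟩ := edgeStep_spec I hβ hx lam d m s
    obtain ⟨b₁, b₂, b₃⟩ := ih (output I (edgeStep β x lam d m s))
    refine ⟨a₁.trans b₁, fun i hi => ?_, fun P hs hP => ?_⟩
    · rcases (Nat.lt_succ_iff_lt_or_eq.1 hi) with hi | rfl
      · exact b₂ i hi
      · exact fun t₀ ht₀ sgn t c' => (a₂ t₀ ht₀ sgn t c').trans (max_le_max le_rfl b₁)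
    · exact b₃ P (a₃ P hs (hP m (Nat.lt_succ_self m))) fun i hi => hP i (hi.trans m.lt_succ_self)

theorem steps_edgeLoop_le (β x : ℝ) (lam : ℤ) (d m : ℕ) (s : ℝ) (e : ℕ) (he : d < 2 ^ e) :
    steps I (edgeLoop β x lam d m s) ≤ m * (2021 * ((d + 1) * (e + 1) ^ 2)) := by
  induction m generalizing s with
  | zero => simp [edgeLoop]
  | succ m ih =>
    simp only [edgeLoop, steps_bind, steps_op, Instr.cost]
    rw [add_one_mul m]
    grw [ih, steps_edgeStep_le I β x lam d m s e he]
    have : 1 ≤ (d + 1) * (e + 1) ^ 2 := Nat.one_le_iff_ne_zero.2 (by positivity)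
    generalize (d + 1) * (e + 1) ^ 2 = K at *
    omega

theorem output_smoothSensitivityUnbiased :
    output I smoothSensitivityUnbiased =
      output I (edgeLoop I.beta (Real.exp (-I.eps) / (1 - Real.exp (-I.eps)) ^ 2) I.threshold
        I.degree I.degree 0) := by
  simp [smoothSensitivityUnbiased, Instr.result, sq]

theorem steps_smoothSensitivityUnbiased_le (e : ℕ) (he : I.degree < 2 ^ e) :
    steps I smoothSensitivityUnbiased ≤
      I.degree * (2021 * ((I.degree + 1) * (e + 1) ^ 2)) + 9 := by
  simp only [smoothSensitivityUnbiased, steps_bind, steps_op, output_op, Instr.cost, Instr.result]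
  grw [steps_edgeLoop_le I _ _ _ _ _ _ e he]
  omega

end Algorithm

end RAM

/-! ### Local changes of the local count -/

section Graph

open RAM

/-- The differences of the unbiased estimator are supported on three consecutive integers. -/
theorem unbiasedStep_add_one_sub (lam : ℤ) (p : ℝ) (m : ℤ) :
    unbiasedStep lam p (m + 1) - unbiasedStep lam p m =
      contribution (p / (1 - p) ^ 2) .pos (m - (lam - 1)) := by
  have hab : |m - (lam - 1)| = 1 ↔ m = lam ∨ m = lam - 2 := by
    rw [abs_eq one_pos.le]; omega
  simp only [unbiasedStep, contribution, hab]
  split_ifs <;> first | omega | ring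

variable {n : ℕ} (G : SimpleGraph (Fin n)) [DecidableRel G.Adj] (noisy : Sym2 (Fin n) → ℤ)
  (ρ : Finset (Fin n) → Fin n) (lam : ℤ) (ε₁ : ℝ) {v : Fin n}

theorem seenWeight_triple (y : IncidentVector G v) (a b : G.neighborSet v)
    (hab : G.Adj (a : Fin n) b) :
    seenWeight G noisy v y {v, (a : Fin n), (b : Fin n)} =
      y a + y b + noisy s((a : Fin n), (b : Fin n)) := by
  have hva : G.Adj v a := a.2
  have hvb : G.Adj v b := b.2
  have hne : a ≠ b := fun h => hab.ne (congrArg _ h)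
  rw [seenWeight]
  congr 1
  · rw [show (Finset.univ.filter fun u : G.neighborSet v =>
        (u : Fin n) ∈ ({v, (a : Fin n), (b : Fin n)} : Finset (Fin n))) = {a, b} from ?_,
      Finset.sum_pair hne]
    ext u
    have hu : (u : Fin n) ≠ v := (G.ne_of_adj u.2).symm
    simp [hu, Subtype.ext_iff]
  · rw [show ({v, (a : Fin n), (b : Fin n)} : Finset (Fin n)).erase v = {(a : Fin n), (b : Fin n)}
      from Finset.erase_insert (by simp [hva.ne, hvb.ne])]
    rw [show (G.edgeFinset.filter fun e => e ∈ ({(a : Fin n), (b : Fin n)} : Finset (Fin n)).sym2)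
        = {s((a : Fin n), (b : Fin n))} from ?_, Finset.sum_singleton]
    ext e
    induction e with
    | _ p q =>
      simp only [Finset.mem_filter, SimpleGraph.mem_edgeFinset, SimpleGraph.mem_edgeSet,
        Finset.mk_mem_sym2_iff, Finset.mem_insert, Finset.mem_singleton, Sym2.eq_iff]
      constructor
      · rintro ⟨h, rfl | rfl, rfl | rfl⟩
        · exact absurd rfl h.ne
        · simp
        · simp
        · exact absurd rfl h.ne
      · rintro (⟨rfl, rfl⟩ | ⟨rfl, rfl⟩)
        · exact ⟨hab, by simp, by simp⟩
        · exact ⟨hab.symm, by simp, by simp⟩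

/-- In particular `a` and `b` are distinct if the left-hand side holds, although this is not
required of the set. -/
theorem mem_assignedTriangles_triple (a b : G.neighborSet v) :
    {v, (a : Fin n), (b : Fin n)} ∈ assignedTriangles G ρ v ↔
      G.Adj (a : Fin n) b ∧ ρ {v, (a : Fin n), (b : Fin n)} = v := by
  have hva : G.Adj v a := a.2
  have hvb : G.Adj v b := b.2
  simp [assignedTriangles, SimpleGraph.mem_cliqueFinset_iff, SimpleGraph.is3Clique_triple_iff,
    hva, hvb]

/-- Increasing the weight of the edge from `v` to `a` by one changes the contributions of the
assigned triangles that contain this edge. -/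
theorem localCount_update_sub (hρ : ∀ T ∈ G.cliqueFinset 3, ρ T ∈ T) (y : IncidentVector G v)
    (a : G.neighborSet v) :
    localCount G noisy ρ lam ε₁ v (Function.update y a (y a + 1)) -
        localCount G noisy ρ lam ε₁ v y =
      ∑ b ∈ Finset.univ.filter fun b : G.neighborSet v =>
          {v, (a : Fin n), (b : Fin n)} ∈ assignedTriangles G ρ v,
        contribution (Real.exp (-ε₁) / (1 - Real.exp (-ε₁)) ^ 2) .pos
          (y b + noisy s((a : Fin n), (b : Fin n)) - (lam - 1 - y a)) := by
  rw [localCount, localCount, ← Finset.sum_sub_distrib]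
  have hva : G.Adj v a := a.2
  -- triangles without the edge keep their weight
  rw [← Finset.sum_filter_add_sum_filter_not _ fun T : Finset (Fin n) => (a : Fin n) ∈ T,
    Finset.sum_eq_zero (s := (assignedTriangles G ρ v).filter fun T => (a : Fin n) ∉ T), add_zero]
  swap
  · intro T hT
    have haT : (a : Fin n) ∉ T := (Finset.mem_filter.1 hT).2
    have : seenWeight G noisy v (Function.update y a (y a + 1)) T = seenWeight G noisy v y T := by
      rw [seenWeight, seenWeight]
      congr 1
      refine Finset.sum_congr rfl fun u hu => Function.update_of_ne ?_ _ _
      rintro rfl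
      exact haT (Finset.mem_filter.1 hu).2
    rw [this, sub_self]
  symm
  refine Finset.sum_bij (fun b _ => {v, (a : Fin n), (b : Fin n)}) ?_ ?_ ?_ ?_
  · intro b hb
    exact Finset.mem_filter.2 ⟨(Finset.mem_filter.1 hb).2, by simp⟩
  · intro b hb b' hb' h
    have hab := ((mem_assignedTriangles_triple G ρ a b).1 (Finset.mem_filter.1 hb).2).1
    have hvb : G.Adj v b := b.2
    have : (b : Fin n) ∈ ({v, (a : Fin n), (b' : Fin n)} : Finset (Fin n)) := by
      rw [← h]; simp
    simp only [Finset.mem_insert, Finset.mem_singleton, hvb.ne', hab.ne', false_or] at this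
    exact Subtype.ext this
  · intro T hT
    obtain ⟨hT, haT⟩ := Finset.mem_filter.1 hT
    obtain ⟨hT3, hTv⟩ := Finset.mem_filter.1 hT
    have hvT : v ∈ T := by rw [← hTv]; exact hρ T hT3
    rw [SimpleGraph.mem_cliqueFinset_iff, SimpleGraph.isNClique_iff] at hT3
    have haT' : (a : Fin n) ∈ T.erase v := Finset.mem_erase.2 ⟨hva.ne', haT⟩
    have hcard : ((T.erase v).erase a).card = 1 := by
      rw [Finset.card_erase_of_mem haT', Finset.card_erase_of_mem hvT, hT3.2]
    obtain ⟨z, hz⟩ := Finset.card_eq_one.1 hcard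
    have hTz : T = {v, (a : Fin n), z} := by
      rw [← Finset.insert_erase hvT, ← Finset.insert_erase haT', hz]
    have hzm : z ∈ (T.erase v).erase a := by rw [hz]; simp
    simp only [Finset.mem_erase] at hzm
    have hvz : G.Adj v z := hT3.1 hvT hzm.2.2 (Ne.symm hzm.2.1)
    refine ⟨⟨z, hvz⟩, ?_, hTz.symm⟩
    rw [Finset.mem_filter]
    refine ⟨Finset.mem_univ _, ?_⟩
    rw [← hTz]
    exact hT
  · intro b hb
    have hab := ((mem_assignedTriangles_triple G ρ a b).1 (Finset.mem_filter.1 hb).2).1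
    have hne : b ≠ a := fun h => hab.ne' (congrArg _ h)
    rw [seenWeight_triple G noisy _ a b hab, seenWeight_triple G noisy _ a b hab,
      Function.update_self, Function.update_of_ne hne,
      show y a + 1 + y b + noisy s((a : Fin n), (b : Fin n)) =
        y a + y b + noisy s((a : Fin n), (b : Fin n)) + 1 by ring, unbiasedStep_add_one_sub]
    congr 1
    ring

end Graph

section L1

variable {ι : Type} [Fintype ι] [DecidableEq ι]

theorem l1Dist_update (y : ι → ℤ) (a : ι) (m : ℤ) :
    l1Dist y (Function.update y a m) = |y a - m| := by
  rw [l1Dist, Finset.sum_eq_single a]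
  · simp
  · intro b _ hb
    simp [Function.update_of_ne hb]
  · simp

theorem eq_update_of_l1Dist_le_one {y z : ι → ℤ} (h : l1Dist y z ≤ 1) :
    z = y ∨ ∃ a, z = Function.update y a (y a + 1) ∨ z = Function.update y a (y a - 1) := by
  by_cases hyz : z = y
  · exact Or.inl hyz
  right
  obtain ⟨a, ha⟩ := Function.ne_iff.1 hyz
  have ha1 : 1 ≤ |y a - z a| := Int.one_le_abs (sub_ne_zero.2 (Ne.symm ha))
  rw [l1Dist, ← Finset.add_sum_erase _ _ (Finset.mem_univ a)] at h
  have hnn : ∀ b ∈ Finset.univ.erase a, 0 ≤ |y b - z b| := fun b _ => abs_nonneg _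
  have hsum := Finset.sum_nonneg hnn
  have h0 := (Finset.sum_eq_zero_iff_of_nonneg hnn).1 (by omega)
  have hz : z = Function.update y a (z a) := by
    ext b
    by_cases hb : b = a
    · subst hb; simp
    · have := abs_eq_zero.1 (h0 b (Finset.mem_erase.2 ⟨hb, Finset.mem_univ _⟩))
      rw [Function.update_of_ne hb]
      omega
  have hone : |y a - z a| = 1 := by omega
  refine ⟨a, ?_⟩
  rw [abs_eq one_pos.le] at hone
  rcases hone with h' | h'
  · exact Or.inr (by rw [show y a - 1 = z a by omega]; exact hz)
  · exact Or.inl (by rw [show y a + 1 = z a by omega]; exact hz)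

/-- Local sensitivities exist, because a ball of radius one is finite. -/
theorem exists_isLocalSensitivity (f : (ι → ℤ) → ℝ) (y : ι → ℤ) :
    ∃ s, IsLocalSensitivity f y s := by
  have hfin : {z : ι → ℤ | l1Dist y z ≤ 1}.Finite := by
    refine ((Set.finite_singleton y).union ((Set.finite_range fun a =>
      Function.update y a (y a + 1)).union (Set.finite_range fun a =>
      Function.update y a (y a - 1)))).subset fun z hz => ?_
    rcases eq_update_of_l1Dist_le_one hz with h | ⟨a, h | h⟩
    · exact Or.inl h
    · exact Or.inr (Or.inl ⟨a, h.symm⟩)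
    · exact Or.inr (Or.inr ⟨a, h.symm⟩)
  obtain ⟨z, hz, hmax⟩ := Set.exists_max_image _ (fun z => |f y - f z|) hfin
    ⟨y, by simp [l1Dist]⟩
  refine ⟨_, ⟨z, hz, rfl⟩, ?_⟩
  rintro _ ⟨z', hz', rfl⟩
  exact hmax z' hz'

/-- A number is the smooth sensitivity if it bounds all discounted changes of the function by steps
of length at most one, and is bounded by one of them. -/
theorem isSmoothSensitivity_of_forall_le {β : ℝ} {f : (ι → ℤ) → ℝ} {x : ι → ℤ} {S : ℝ}
    (hle : ∀ y z, l1Dist y z ≤ 1 → |f y - f z| * Real.exp (-(β * (l1Dist x y : ℤ))) ≤ S)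
    (hex : ∃ y z, l1Dist y z ≤ 1 ∧ S ≤ |f y - f z| * Real.exp (-(β * (l1Dist x y : ℤ)))) :
    IsSmoothSensitivity β f x S := by
  choose LS hLS using exists_isLocalSensitivity f
  have hup : ∀ y, LS y * Real.exp (-β * (l1Dist x y : ℝ)) ≤ S := by
    intro y
    obtain ⟨⟨z, hz, h⟩, -⟩ := hLS y
    rw [h, neg_mul]
    exact hle y z hz
  refine ⟨LS, hLS, ?_, ?_⟩
  · obtain ⟨y, z, hz, h⟩ := hex
    refine ⟨y, le_antisymm (h.trans ?_) (hup y)⟩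
    rw [neg_mul]
    exact mul_le_mul_of_nonneg_right ((hLS y).2 ⟨z, hz, rfl⟩) (Real.exp_pos _).le
  · rintro _ ⟨y, rfl⟩
    exact hup y

end L1

/-! ### Numbering of the incident edges -/

section Numbering

open RAM

variable {n : ℕ} (G : SimpleGraph (Fin n)) [DecidableRel G.Adj] (w noisy : Sym2 (Fin n) → ℤ)
  (ρ : Finset (Fin n) → Fin n) (lam : ℤ) (ε₁ β : ℝ) {v : Fin n}
  (num : Fin (G.degree v) ≃ G.neighborSet v)

/-- A vector of incident weights as a function of the number of the edge, continued by zero. -/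
def numbered (y : IncidentVector G v) (j : ℕ) : ℤ :=
  if hj : j < G.degree v then y (num ⟨j, hj⟩) else 0

theorem numbered_symm (y : IncidentVector G v) (b : G.neighborSet v) :
    numbered G num y (num.symm b) = y b := by
  simp [numbered]

theorem nodeInput_weight :
    (nodeInput G w noisy ρ lam ε₁ β v num).weight = numbered G num (incidentWeights G w v) := by
  ext j
  simp only [nodeInput, numbered, incidentWeights]

theorem mem_partners_nodeInput (a b : G.neighborSet v) :
    (num.symm b : ℕ) ∈ partners (nodeInput G w noisy ρ lam ε₁ β v num) (G.degree v) (num.symm a) ↔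
      {v, (a : Fin n), (b : Fin n)} ∈ assignedTriangles G ρ v := by
  simp [partners, nodeInput]

theorem noisy_nodeInput (a b : G.neighborSet v) :
    (nodeInput G w noisy ρ lam ε₁ β v num).noisy (num.symm a) (num.symm b) =
      noisy s((a : Fin n), (b : Fin n)) := by
  simp [nodeInput]

theorem sum_range_degree {M : Type*} [AddCommMonoid M] (F : ℕ → M) :
    ∑ j ∈ Finset.range (G.degree v), F j = ∑ b : G.neighborSet v, F (num.symm b) := by
  rw [Finset.sum_range]
  exact Fintype.sum_equiv num _ _ fun j => by simp

theorem sum_partners_nodeInput {M : Type*} [AddCommMonoid M] (a : G.neighborSet v) (F : ℕ → M) :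
    ∑ j ∈ partners (nodeInput G w noisy ρ lam ε₁ β v num) (G.degree v) (num.symm a), F j =
      ∑ b ∈ Finset.univ.filter fun b : G.neighborSet v =>
        {v, (a : Fin n), (b : Fin n)} ∈ assignedTriangles G ρ v, F (num.symm b) := by
  rw [Finset.sum_filter, partners, Finset.sum_filter, sum_range_degree G num]
  refine Finset.sum_congr rfl fun b _ => ?_
  exact if_congr (by simp [nodeInput]) rfl rfl

theorem not_mem_assignedTriangles_self (a : G.neighborSet v) :
    {v, (a : Fin n), (a : Fin n)} ∉ assignedTriangles G ρ v := fun h =>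
  ((mem_assignedTriangles_triple G ρ a a).1 h).1.ne rfl

/-- The cost of the shifts of the partners of an edge and of the edge itself is part of the
distance. -/
theorem sum_partners_add_le_l1Dist (y z : IncidentVector G v) (a : G.neighborSet v) :
    ∑ j ∈ partners (nodeInput G w noisy ρ lam ε₁ β v num) (G.degree v) (num.symm a),
      |numbered G num y j - numbered G num z j| + |y a - z a| ≤ l1Dist z y := by
  rw [sum_partners_nodeInput, l1Dist, ← Finset.add_sum_erase _ _ (Finset.mem_univ a), add_comm,
    abs_sub_comm (y a)]
  refine add_le_add le_rfl ?_
  simp only [numbered_symm]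
  refine (Finset.sum_le_sum_of_subset_of_nonneg (fun b hb => ?_)
    fun _ _ _ => abs_nonneg _).trans_eq (Finset.sum_congr rfl fun b _ => abs_sub_comm _ _)
  refine Finset.mem_erase.2 ⟨?_, Finset.mem_univ _⟩
  rintro rfl
  exact not_mem_assignedTriangles_self G ρ b (Finset.mem_filter.1 hb).2

/-- A vector of incident weights with prescribed values at an edge and at its partners, and no
change elsewhere. -/
theorem exists_vector (a : G.neighborSet v) (m : ℤ) (c' : ℕ → ℤ) :
    ∃ y : IncidentVector G v, y a = m ∧
      (∀ j ∈ partners (nodeInput G w noisy ρ lam ε₁ β v num) (G.degree v) (num.symm a),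
        numbered G num y j + (nodeInput G w noisy ρ lam ε₁ β v num).noisy (num.symm a) j = c' j) ∧
      l1Dist (incidentWeights G w v) y =
        ∑ j ∈ partners (nodeInput G w noisy ρ lam ε₁ β v num) (G.degree v) (num.symm a),
          |c' j - partialWeight (nodeInput G w noisy ρ lam ε₁ β v num) (num.symm a) j| +
        |m - incidentWeights G w v a| := by
  set I := nodeInput G w noisy ρ lam ε₁ β v num with hI
  set B := Finset.univ.filter fun b : G.neighborSet v =>
    {v, (a : Fin n), (b : Fin n)} ∈ assignedTriangles G ρ v with hB
  have haB : a ∉ B := fun h =>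
    not_mem_assignedTriangles_self G ρ a (Finset.mem_filter.1 h).2
  set y : IncidentVector G v := fun b => if b = a then m else if b ∈ B then
    c' (num.symm b) - I.noisy (num.symm a) (num.symm b) else incidentWeights G w v b with hy
  have hya : y a = m := by simp [hy]
  have hyB : ∀ b ∈ B, y b = c' (num.symm b) - I.noisy (num.symm a) (num.symm b) := by
    intro b hb
    have : b ≠ a := fun h => haB (h ▸ hb)
    simp [hy, this, hb]
  refine ⟨y, hya, fun j hj => ?_, ?_⟩
  · have hjd : j < G.degree v := Finset.mem_range.1 (Finset.mem_filter.1 hj).1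
    obtain ⟨b, rfl⟩ : ∃ b, (num.symm b : ℕ) = j := ⟨num ⟨j, hjd⟩, by simp⟩
    have hb : b ∈ B := Finset.mem_filter.2
      ⟨Finset.mem_univ _, (mem_partners_nodeInput G w noisy ρ lam ε₁ β num a b).1 hj⟩
    rw [numbered_symm, hyB b hb]
    ring
  · rw [sum_partners_nodeInput, ← hB, l1Dist, ← Finset.add_sum_erase _ _ (Finset.mem_univ a), hya,
      add_comm, abs_sub_comm m]
    congr 1
    rw [← Finset.sum_subset (s₁ := B)]
    · refine Finset.sum_congr rfl fun b hb => ?_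
      rw [hyB b hb, partialWeight, hI, nodeInput_weight, numbered_symm, abs_sub_comm]
      congr 1
      ring
    · intro b hb
      exact Finset.mem_erase.2 ⟨fun h => haB (h ▸ hb), Finset.mem_univ _⟩
    · intro b hb hbB
      simp [hy, (Finset.mem_erase.1 hb).1, hbB]

/-- The effect on the local count of increasing one weight by one is a sum of contributions, with
the target determined by this weight. -/
theorem localCount_update_sub_eq_sum_partners (hρ : ∀ T ∈ G.cliqueFinset 3, ρ T ∈ T)
    (y : IncidentVector G v) (a : G.neighborSet v) :
    localCount G noisy ρ lam ε₁ v (Function.update y a (y a + 1)) -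
        localCount G noisy ρ lam ε₁ v y =
      ∑ j ∈ partners (nodeInput G w noisy ρ lam ε₁ β v num) (G.degree v) (num.symm a),
        contribution (Real.exp (-ε₁) / (1 - Real.exp (-ε₁)) ^ 2) .pos
          (numbered G num y j + (nodeInput G w noisy ρ lam ε₁ β v num).noisy (num.symm a) j -
            (lam - 1 - y a)) := by
  rw [localCount_update_sub G noisy ρ lam ε₁ hρ, sum_partners_nodeInput]
  simp only [numbered_symm, noisy_nodeInput]

theorem RAM.exists_sum_contribution_eq_abs {x : ℝ} (J : Finset ℕ) (m : ℕ → ℤ) :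
    ∃ sgn, ∑ j ∈ J, contribution x sgn (m j) = |∑ j ∈ J, contribution x .pos (m j)| := by
  rcases abs_choice (∑ j ∈ J, contribution x .pos (m j)) with h | h
  · exact ⟨.pos, h.symm⟩
  · refine ⟨.neg, ?_⟩
    rw [h, ← Finset.sum_neg_distrib]
    refine Finset.sum_congr rfl fun j _ => ?_
    simp only [contribution]
    split_ifs <;> ring

theorem RAM.sum_contribution_le_abs {x : ℝ} (sgn : Sign) (J : Finset ℕ) (m : ℕ → ℤ) :
    ∑ j ∈ J, contribution x sgn (m j) ≤ |∑ j ∈ J, contribution x .pos (m j)| := by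
  cases sgn
  · exact le_abs_self _
  · refine le_trans (le_of_eq ?_) (neg_le_abs _)
    rw [← Finset.sum_neg_distrib]
    refine Finset.sum_congr rfl fun j _ => ?_
    simp only [contribution]
    split_ifs <;> ring

/-- The effect of increasing the weight of the edge `a` by one is the total of a configuration. So a
bound for the values of all configurations bounds the discounted effect, provided that the distance
`l` of the discount covers the cost of the configuration. -/
theorem abs_localCount_update_sub_mul_exp_le (hρ : ∀ T ∈ G.cliqueFinset 3, ρ T ∈ T)
    (hβ : 0 ≤ β) {S : ℝ} (hS : 0 ≤ S) {t₀ l : ℤ} (y : IncidentVector G v) (a : G.neighborSet v)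
    (hle : ∀ sgn t c',
      configValue β (Real.exp (-ε₁) / (1 - Real.exp (-ε₁)) ^ 2)
        (partners (nodeInput G w noisy ρ lam ε₁ β v num) (G.degree v) (num.symm a))
        (partialWeight (nodeInput G w noisy ρ lam ε₁ β v num) (num.symm a)) t₀ sgn t c' ≤ max 0 S)
    (hl : ∑ j ∈ partners (nodeInput G w noisy ρ lam ε₁ β v num) (G.degree v) (num.symm a),
      |numbered G num y j - numbered G num (incidentWeights G w v) j| +
        |t₀ - (lam - 1 - y a)| ≤ l) :
    |localCount G noisy ρ lam ε₁ v (Function.update y a (y a + 1)) -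
        localCount G noisy ρ lam ε₁ v y| * Real.exp (-(β * (l : ℤ))) ≤ S := by
  rw [localCount_update_sub_eq_sum_partners G w noisy ρ lam ε₁ β num hρ]
  obtain ⟨sgn, hsgn⟩ := exists_sum_contribution_eq_abs
    (x := Real.exp (-ε₁) / (1 - Real.exp (-ε₁)) ^ 2)
    (partners (nodeInput G w noisy ρ lam ε₁ β v num) (G.degree v) (num.symm a))
    fun j => numbered G num y j + (nodeInput G w noisy ρ lam ε₁ β v num).noisy (num.symm a) j -
      (lam - 1 - y a)
  have h := hle sgn (lam - 1 - y a) fun j =>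
    numbered G num y j + (nodeInput G w noisy ρ lam ε₁ β v num).noisy (num.symm a) j
  rw [max_eq_right hS, configValue, hsgn] at h
  refine le_trans (mul_le_mul_of_nonneg_left (Real.exp_le_exp.2 (neg_le_neg
    (mul_le_mul_of_nonneg_left (Int.cast_le.2 ?_) hβ))) (abs_nonneg _)) h
  refine le_trans (le_of_eq ?_) hl
  congr 1
  refine Finset.sum_congr rfl fun j _ => ?_
  rw [partialWeight, nodeInput_weight]
  congr 1
  ring

/-- The value of a configuration is at most the discounted effect of a unit change of the weight of
the edge, in a suitable vector of incident weights. -/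
theorem configValue_le_abs_localCount_sub (hρ : ∀ T ∈ G.cliqueFinset 3, ρ T ∈ T)
    {a : G.neighborSet v} {t₀ : ℤ}
    (ht₀ : t₀ = lam - incidentWeights G w v a - 1 ∨ t₀ = lam - incidentWeights G w v a)
    (sgn : Sign) (t : ℤ) (c' : ℕ → ℤ) :
    ∃ y z : IncidentVector G v, l1Dist y z ≤ 1 ∧
      configValue β (Real.exp (-ε₁) / (1 - Real.exp (-ε₁)) ^ 2)
        (partners (nodeInput G w noisy ρ lam ε₁ β v num) (G.degree v) (num.symm a))
        (partialWeight (nodeInput G w noisy ρ lam ε₁ β v num) (num.symm a)) t₀ sgn t c' ≤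
      |localCount G noisy ρ lam ε₁ v y - localCount G noisy ρ lam ε₁ v z| *
        Real.exp (-(β * (l1Dist (incidentWeights G w v) y : ℤ))) := by
  rcases ht₀ with rfl | rfl
  · obtain ⟨y, hya, hy, hdist⟩ := exists_vector G w noisy ρ lam ε₁ β num a (lam - 1 - t) c'
    refine ⟨y, Function.update y a (y a + 1), by simp [l1Dist_update], ?_⟩
    rw [abs_sub_comm, localCount_update_sub_eq_sum_partners G w noisy ρ lam ε₁ β num hρ, hdist,
      configValue, hya, show lam - 1 - t - incidentWeights G w v a =
        lam - incidentWeights G w v a - 1 - t by ring]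
    refine mul_le_mul_of_nonneg_right ((sum_contribution_le_abs _ _ _).trans_eq ?_)
      (Real.exp_pos _).le
    congr 1
    refine Finset.sum_congr rfl fun j hj => ?_
    rw [hy j hj]
    congr 1
    ring
  · obtain ⟨y, hya, hy, hdist⟩ := exists_vector G w noisy ρ lam ε₁ β num a (lam - t) c'
    set z := Function.update y a (y a - 1) with hz
    refine ⟨y, z, by simp [hz, l1Dist_update], ?_⟩
    have hza : z a = y a - 1 := by simp [hz]
    have hyz : y = Function.update z a (z a + 1) := by simp [hz]
    have hzy : ∀ j ∈ partners (nodeInput G w noisy ρ lam ε₁ β v num) (G.degree v) (num.symm a),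
        numbered G num z j = numbered G num y j := by
      intro j hj
      have hjd : j < G.degree v := Finset.mem_range.1 (Finset.mem_filter.1 hj).1
      obtain ⟨b, rfl⟩ : ∃ b, (num.symm b : ℕ) = j := ⟨num ⟨j, hjd⟩, by simp⟩
      rw [mem_partners_nodeInput] at hj
      rw [numbered_symm, numbered_symm, hz, Function.update_of_ne]
      rintro rfl
      exact not_mem_assignedTriangles_self G ρ b hj
    have hD := localCount_update_sub_eq_sum_partners G w noisy ρ lam ε₁ β num hρ z a
    rw [← hyz] at hD
    rw [hD, hdist, configValue, hza, hya, show lam - t - incidentWeights G w v a =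
        lam - incidentWeights G w v a - t by ring]
    refine mul_le_mul_of_nonneg_right ((sum_contribution_le_abs _ _ _).trans_eq ?_)
      (Real.exp_pos _).le
    congr 1
    refine Finset.sum_congr rfl fun j hj => ?_
    rw [hzy j hj, hy j hj]
    congr 1
    ring

/-- The algorithm computes the smooth sensitivity: its result bounds the values of all
configurations and, being zero or one of these values, is attained. -/
theorem isSmoothSensitivity_output (hρ : ∀ T ∈ G.cliqueFinset 3, ρ T ∈ T) (hε₁ : 0 < ε₁)
    (hβ : 0 < β) :
    IsSmoothSensitivity β (localCount G noisy ρ lam ε₁ v) (incidentWeights G w v)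
      (smoothSensitivityUnbiased.output (nodeInput G w noisy ρ lam ε₁ β v num)) := by
  have hx : 0 < Real.exp (-ε₁) / (1 - Real.exp (-ε₁)) ^ 2 := by
    have : Real.exp (-ε₁) < 1 := by simpa using hε₁
    have : 0 < 1 - Real.exp (-ε₁) := by linarith
    positivity
  obtain ⟨h₁, h₂, h₃⟩ := edgeLoop_spec (nodeInput G w noisy ρ lam ε₁ β v num) hβ hx lam
    (G.degree v) (G.degree v) 0
  have hout : smoothSensitivityUnbiased.output (nodeInput G w noisy ρ lam ε₁ β v num) = _ :=
    output_smoothSensitivityUnbiased (nodeInput G w noisy ρ lam ε₁ β v num)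
  change _ = Prog.output (nodeInput G w noisy ρ lam ε₁ β v num) (edgeLoop β
    (Real.exp (-ε₁) / (1 - Real.exp (-ε₁)) ^ 2) lam (G.degree v) (G.degree v) 0) at hout
  rw [← hout] at h₁ h₂ h₃
  have hw : ∀ b, (nodeInput G w noisy ρ lam ε₁ β v num).weight (num.symm b) =
      incidentWeights G w v b := fun b => by rw [nodeInput_weight, numbered_symm]
  refine isSmoothSensitivity_of_forall_le (fun y z hyz => ?_) ?_
  · have hdist := sum_partners_add_le_l1Dist G w noisy ρ lam ε₁ β num y (incidentWeights G w v)
    rcases eq_update_of_l1Dist_le_one hyz with rfl | ⟨a, hza | hza⟩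
    · simpa using h₁
    · rw [hza, abs_sub_comm]
      refine abs_localCount_update_sub_mul_exp_le G w noisy ρ lam ε₁ β num hρ hβ.le h₁ y a
        (h₂ (num.symm a) (num.symm a).2 _ (Or.inl rfl)) ?_
      rw [hw, show lam - incidentWeights G w v a - 1 - (lam - 1 - y a) =
        y a - incidentWeights G w v a by ring]
      exact hdist a
    · -- a decrease from `y` to `z` is an increase from `z` to `y`
      have hyz' : y = Function.update z a (z a + 1) := by simp [hza]
      have key := abs_localCount_update_sub_mul_exp_le G w noisy ρ lam ε₁ β num hρ hβ.le h₁
        (l := l1Dist (incidentWeights G w v) y) z a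
        (h₂ (num.symm a) (num.symm a).2 _ (Or.inr rfl)) ?_
      · rwa [← hyz'] at key
      · rw [hw, show lam - incidentWeights G w v a - (lam - 1 - z a) =
          y a - incidentWeights G w v a by rw [hza, Function.update_self]; ring]
        refine le_trans (le_of_eq ?_) (hdist a)
        congr 1
        rw [sum_partners_nodeInput, sum_partners_nodeInput]
        refine Finset.sum_congr rfl fun b hb => ?_
        rw [numbered_symm, numbered_symm, numbered_symm, hza, Function.update_of_ne]
        rintro rfl
        exact not_mem_assignedTriangles_self G ρ b (Finset.mem_filter.1 hb).2
  · refine h₃ (fun r => ∃ y z : IncidentVector G v, l1Dist y z ≤ 1 ∧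
      r ≤ |localCount G noisy ρ lam ε₁ v y - localCount G noisy ρ lam ε₁ v z| *
        Real.exp (-(β * (l1Dist (incidentWeights G w v) y : ℤ)))) ?_ ?_
    · exact ⟨0, 0, by simp [l1Dist], by simp⟩
    · intro i hi t₀ ht₀ sgn t c'
      obtain ⟨a, rfl⟩ : ∃ a, (num.symm a : ℕ) = i := ⟨num ⟨i, hi⟩, by simp⟩
      rw [hw] at ht₀
      exact configValue_le_abs_localCount_sub G w noisy ρ lam ε₁ β num hρ ht₀ sgn t c'

end Numbering

/-! ### The running time -/

theorem RAM.steps_smoothSensitivityUnbiased_le_log (I : Input) (hd : 2 ≤ I.degree) :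
    (smoothSensitivityUnbiased.steps I : ℝ) ≤
      1000000 * (I.degree : ℝ) ^ 2 * Real.log I.degree ^ 2 := by
  set d := I.degree with hdd
  have hle := steps_smoothSensitivityUnbiased_le I (Nat.log 2 d + 1)
    (Nat.lt_pow_succ_log_self one_lt_two d)
  rw [← hdd] at hle
  have hle' : (smoothSensitivityUnbiased.steps I : ℝ) ≤
      d * (2021 * ((d + 1) * ((Nat.log 2 d : ℝ) + 1 + 1) ^ 2)) + 9 := by exact_mod_cast hle
  have hd2 : (2 : ℝ) ≤ d := by exact_mod_cast hd
  set L := Real.log d with hL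
  have hlog2 := Real.log_two_gt_d9
  have hL2 : Real.log 2 ≤ L := Real.log_le_log two_pos hd2
  -- as `log 2 > 1 / 2`, the rounded binary logarithm is at most twice the natural one
  have hnat : (Nat.log 2 d : ℝ) * Real.log 2 ≤ L := by
    rw [hL, ← Real.log_pow]
    refine Real.log_le_log (by positivity) ?_
    exact_mod_cast Nat.pow_log_le_self 2 (by omega : d ≠ 0)
  have hlogd : (Nat.log 2 d : ℝ) + 1 + 1 ≤ 6 * L := by
    have : (0 : ℝ) ≤ Nat.log 2 d := Nat.cast_nonneg _
    nlinarith
  have hL0 : 1 / 2 ≤ L := by linarith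
  have hsq : ((Nat.log 2 d : ℝ) + 1 + 1) ^ 2 ≤ (6 * L) ^ 2 := by gcongr
  have hd1 : (d : ℝ) + 1 ≤ 2 * d := by linarith
  calc (smoothSensitivityUnbiased.steps I : ℝ)
      ≤ d * (2021 * ((2 * d) * (6 * L) ^ 2)) + 9 := by
        refine hle'.trans ?_
        gcongr
    _ = 145512 * ((d : ℝ) ^ 2 * L ^ 2) + 9 := by ring
    _ ≤ 145512 * ((d : ℝ) ^ 2 * L ^ 2) + 9 * ((d : ℝ) ^ 2 * L ^ 2) := by
        have : 2 ^ 2 * (1 / 2) ^ 2 ≤ (d : ℝ) ^ 2 * L ^ 2 := by gcongr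
        linarith
    _ ≤ 1000000 * (d : ℝ) ^ 2 * L ^ 2 := by
        have : 0 ≤ (d : ℝ) ^ 2 * L ^ 2 := by positivity
        linarith

theorem RAM.steps_smoothSensitivityUnbiased_le_of_degree_le_one (I : Input) (hd : I.degree ≤ 1) :
    smoothSensitivityUnbiased.steps I ≤ 1000000 := by
  refine (steps_smoothSensitivityUnbiased_le I 1 (by omega)).trans ?_
  generalize I.degree = d at hd
  interval_cases d <;> norm_num

/-- There is an absolute constant `C` such that for every weighted graph, every assignment of its
triangles, every node `v` and every numbering of the edges at `v`, the algorithm returns the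
`β`-smooth sensitivity of the local count of `v` and makes at most `C * d² * log² d` steps, where
`d ≥ 2` is the degree of `v` (and at most `C` steps if `d ≤ 1`, where the logarithm degenerates). -/
theorem mainTheorem8 :
    ∃ C : ℝ, ∀ (n : ℕ) (G : SimpleGraph (Fin n)) [DecidableRel G.Adj]
      (w noisy : Sym2 (Fin n) → ℤ) (ρ : Finset (Fin n) → Fin n)
      (_hρ : ∀ T ∈ G.cliqueFinset 3, ρ T ∈ T)
      (lam : ℤ) (ε₁ β : ℝ) (_hε₁ : 0 < ε₁) (_hβ : 0 < β)
      (v : Fin n) (num : Fin (G.degree v) ≃ G.neighborSet v),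
      IsSmoothSensitivity β (localCount G noisy ρ lam ε₁ v) (incidentWeights G w v)
        (RAM.smoothSensitivityUnbiased.output (RAM.nodeInput G w noisy ρ lam ε₁ β v num)) ∧
      (2 ≤ G.degree v →
        (RAM.smoothSensitivityUnbiased.steps (RAM.nodeInput G w noisy ρ lam ε₁ β v num) : ℝ) ≤
          C * (G.degree v : ℝ) ^ 2 * Real.log (G.degree v) ^ 2) ∧
      (G.degree v ≤ 1 →
        (RAM.smoothSensitivityUnbiased.steps (RAM.nodeInput G w noisy ρ lam ε₁ β v num) : ℝ) ≤
          C) := by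
  refine ⟨1000000, fun n G _ w noisy ρ hρ lam ε₁ β hε₁ hβ v num =>
    ⟨isSmoothSensitivity_output G w noisy ρ lam ε₁ β num hρ hε₁ hβ, fun hd => ?_, fun hd => ?_⟩⟩
  · exact RAM.steps_smoothSensitivityUnbiased_le_log (RAM.nodeInput G w noisy ρ lam ε₁ β v num) hd
  · exact_mod_cast RAM.steps_smoothSensitivityUnbiased_le_of_degree_le_one
      (RAM.nodeInput G w noisy ρ lam ε₁ β v num) hd
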